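/- All graphs are finite, simple and nonempty, and all $*$-algebras are unital, over $\mathbb C$. A matrix $u=(u_{ij})_{1\le i,j\le n}$ over a $*$-algebra is a magic unitary if $u_{ij}^*=u_{ij}=u_{ij}^2$, $\sum_k u_{ik}=\sum_k u_{kj}=1$ for all $i,j$, and $u_{ij}u_{ik}=0$, $u_{ji}u_{ki}=0$ for all $i$ and all $j\neq k$. A quantum permutation group of size $n\ge1$ is a pair $(A,u)$ where $A$ is a $*$-algebra generated by the entries of an $n\times n$ magic unitary $u$, such that there is a (necessarily unique) $*$-morphism $\Delta:A\to A\otimes A$ (algebraic tensor product) with $\Delta(u_{ij})=\sum_k u_{ik}\otimes u_{kj}$. Quantum permutation groups, of arbitrary sizes, are identified when there is a $*$-isomorphism of their algebras intertwining the comultiplications. The trivial one is $(\mathbb C,1)$. - $S_n^+$ is given by the universal $*$-algebra generated by the entries of an $n\times n$ magic unitary. - For a graph $G$ with adjacency matrix $M$, the quantum automorphism group $\mathrm{Qu}(G)$ is given by the universal $*$-algebra generated by the entries of a magic unitary $u$ indexed by $V(G)$ with $Mu=uM$. - The free product of $(A,u)$ and $(B,v)$ is $(A*B,\mathrm{Diag}(u,v))$,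 where $*$ is the unital free product of $*$-algebras. - For $n\ge 1$, with $S_n^+=(S,p)$ and $\nu_i:A\to A^{*n}$ the $i$-th canonical inclusion, the wreath product of $(A,u)$ by $S_n^+$ is the quotient of $A^{*n}*S$ by the relations $\nu_i(a)p_{ij}=p_{ij}\nu_i(a)$ ($a\in A$, $1\le i,j\le n$), with the magic unitary $w_{(i,k),(j,l)}=\nu_i(u_{kl})\,p_{ij}$. The class of tree-cographs is the smallest class of graphs (closed under isomorphism) which contains all trees and is stable by disjoint sums and complements. **Theorem.** The family of quantum automorphism groups of tree-cographs is exactly the smallest family of quantum permutation groups which contains the trivial quantum group and is stable by free products and by wreath products with $S_n^+$ for every $n\ge 1$. In particular, it is equal to the family of quantum automorphism groups of trees. -/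

import Mathlib

open scoped TensorProduct

/-! ## Universal unital complex `*`-algebras -/

/-- The free unital complex `*`-algebra on `X`, that is, the algebra of noncommutative
`*`-polynomials in the variables `x ∈ X`: the second copy of `X` provides the adjoints. -/
def FreeStarAlgebra (X : Type) : Type := FreeAlgebra ℂ (X ⊕ X)

namespace FreeStarAlgebra

noncomputable instance instRing (X : Type) : Ring (FreeStarAlgebra X) :=
  inferInstanceAs (Ring (FreeAlgebra ℂ (X ⊕ X)))

noncomputable instance instAlgebra (X : Type) : Algebra ℂ (FreeStarAlgebra X) :=
  inferInstanceAs (Algebra ℂ (FreeAlgebra ℂ (X ⊕ X)))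

/-- A letter: `inl x` is the variable `x` and `inr x` is its adjoint. -/
noncomputable def letter {X : Type} (y : X ⊕ X) : FreeStarAlgebra X := FreeAlgebra.ι ℂ y

/-- The variable `x`. -/
noncomputable def of {X : Type} (x : X) : FreeStarAlgebra X := letter (Sum.inl x)

theorem letter_induction {X : Type} {C : FreeStarAlgebra X → Prop}
    (hc : ∀ c : ℂ, C (algebraMap ℂ _ c)) (hl : ∀ y, C (letter y))
    (hm : ∀ a b, C a → C b → C (a * b)) (ha : ∀ a b, C a → C b → C (a + b))
    (a : FreeStarAlgebra X) : C a :=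
  FreeAlgebra.induction ℂ (X ⊕ X) hc hl hm ha a

/-- The opposite algebra with the conjugate scalar action (used locally to define the star). -/
noncomputable abbrev conjAlgebra (X : Type) : Algebra ℂ (FreeStarAlgebra X)ᵐᵒᵖ :=
  RingHom.toAlgebra' ((algebraMap ℂ (FreeStarAlgebra X)ᵐᵒᵖ).comp (starRingEnd ℂ))
    (fun c x => Algebra.commutes (A := (FreeStarAlgebra X)ᵐᵒᵖ) (starRingEnd ℂ c) x)

/-- The conjugate-linear multiplicative reversal exchanging each variable with its adjoint. -/
noncomputable def conjReverse (X : Type) : FreeStarAlgebra X →+* (FreeStarAlgebra X)ᵐᵒᵖ :=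
  letI := conjAlgebra X
  (FreeAlgebra.lift ℂ (fun y : X ⊕ X => MulOpposite.op (letter y.swap)) :
    FreeAlgebra ℂ (X ⊕ X) →ₐ[ℂ] (FreeStarAlgebra X)ᵐᵒᵖ).toRingHom

theorem conjReverse_letter {X : Type} (y : X ⊕ X) :
    conjReverse X (letter y) = MulOpposite.op (letter y.swap) := by
  let _ := conjAlgebra X
  exact FreeAlgebra.lift_ι_apply (A := (FreeStarAlgebra X)ᵐᵒᵖ)
    (fun y : X ⊕ X => MulOpposite.op (letter y.swap)) y

theorem conjReverse_algebraMap {X : Type} (c : ℂ) :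
    conjReverse X (algebraMap ℂ _ c)
      = MulOpposite.op (algebraMap ℂ (FreeStarAlgebra X) (starRingEnd ℂ c)) := by
  let _ := conjAlgebra X
  exact AlgHom.commutes (FreeAlgebra.lift ℂ (fun y : X ⊕ X => MulOpposite.op (letter y.swap)) :
    FreeAlgebra ℂ (X ⊕ X) →ₐ[ℂ] (FreeStarAlgebra X)ᵐᵒᵖ) c

noncomputable instance instStarRing (X : Type) : StarRing (FreeStarAlgebra X) where
  star a := (conjReverse X a).unop
  star_involutive a := by
    induction a using letter_induction with
    | hc c => simp [conjReverse_algebraMap]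
    | hl y => simp [conjReverse_letter]
    | hm a b h1 h2 => simp [h1, h2]
    | ha a b h1 h2 => simp [h1, h2]
  star_mul a b := by simp
  star_add a b := by simp

theorem star_letter {X : Type} (y : X ⊕ X) : star (letter y) = letter y.swap := by
  change (conjReverse X (letter y)).unop = _
  rw [conjReverse_letter]; rfl

theorem star_algebraMap' {X : Type} (c : ℂ) :
    star (algebraMap ℂ (FreeStarAlgebra X) c) = algebraMap ℂ _ (star c) := by
  change (conjReverse X _).unop = _
  rw [conjReverse_algebraMap]; rfl

instance instStarModule (X : Type) : StarModule ℂ (FreeStarAlgebra X) where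
  star_smul c a := by
    rw [Algebra.smul_def, star_mul, star_algebraMap', ← Algebra.commutes, ← Algebra.smul_def]

section lift

variable {X : Type} {B : Type} [Ring B] [Algebra ℂ B] [StarRing B] [StarModule ℂ B]

/-- Evaluation of `*`-polynomials at a family of elements of a `*`-algebra. -/
noncomputable def lift (f : X → B) : FreeStarAlgebra X →⋆ₐ[ℂ] B :=
  let g : FreeStarAlgebra X →ₐ[ℂ] B :=
    (FreeAlgebra.lift ℂ (Sum.elim f (fun x => star (f x))) : FreeAlgebra ℂ (X ⊕ X) →ₐ[ℂ] B)
  { g with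
    map_star' := fun a => by
      have hl : ∀ y : X ⊕ X, g (letter y) = Sum.elim f (fun x => star (f x)) y := fun y =>
        FreeAlgebra.lift_ι_apply _ y
      change g (star a) = star (g a)
      induction a using letter_induction with
      | hc c => rw [star_algebraMap', AlgHom.commutes, AlgHom.commutes, algebraMap_star_comm]
      | hl y => rw [star_letter, hl, hl]; cases y <;> simp
      | hm a b h1 h2 => simp [h1, h2]
      | ha a b h1 h2 => simp [h1, h2] }

@[simp] theorem lift_of (f : X → B) (x : X) : lift f (of x) = f x :=
  FreeAlgebra.lift_ι_apply (Sum.elim f (fun x => star (f x))) (Sum.inl x)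

end lift

theorem hom_ext {X B : Type} [Ring B] [Algebra ℂ B] [StarRing B]
    {f g : FreeStarAlgebra X →⋆ₐ[ℂ] B} (h : ∀ x, f (of x) = g (of x)) : f = g := by
  ext a
  induction a using letter_induction with
  | hc c => rw [AlgHomClass.commutes, AlgHomClass.commutes]
  | hl y =>
    cases y with
    | inl x => exact h x
    | inr x =>
      have : (letter (Sum.inr x) : FreeStarAlgebra X) = star (of x) := by
        rw [of, star_letter]; rfl
      rw [this, map_star, map_star, h]
  | hm a b h1 h2 => simp [h1, h2]
  | ha a b h1 h2 => simp [h1, h2]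

end FreeStarAlgebra

/-- The quotient of a unital complex `*`-algebra by the `*`-ideal generated by the differences
`a - b` with `r a b`. -/
def StarQuot (A : Type) [Ring A] [Algebra ℂ A] [StarRing A] [StarModule ℂ A]
    (r : A → A → Prop) : Type :=
  RingQuot (fun a b => r a b ∨ r (star a) (star b))

namespace StarQuot

section

variable (A : Type) [Ring A] [Algebra ℂ A] [StarRing A] [StarModule ℂ A] (r : A → A → Prop)

noncomputable instance instRing : Ring (StarQuot A r) :=
  inferInstanceAs (Ring (RingQuot _))

noncomputable instance instAlgebra : Algebra ℂ (StarQuot A r) :=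
  inferInstanceAs (Algebra ℂ (RingQuot _))

noncomputable instance instStarRing : StarRing (StarQuot A r) :=
  RingQuot.starRing (fun a b => r a b ∨ r (star a) (star b))
    (fun a b h => by simpa [or_comm] using h)

/-- The quotient map, as an algebra morphism. -/
noncomputable def mkAlg : A →ₐ[ℂ] StarQuot A r :=
  RingQuot.mkAlgHom ℂ (fun a b => r a b ∨ r (star a) (star b))

theorem mkAlg_surjective : Function.Surjective (mkAlg A r) :=
  RingQuot.mkAlgHom_surjective ℂ _

theorem mkAlg_star (a : A) : mkAlg A r (star a) = star (mkAlg A r a) := by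
  simp only [mkAlg, RingQuot.mkAlgHom_def, RingQuot.mkRingHom_def]
  rfl

instance instStarModule : StarModule ℂ (StarQuot A r) where
  star_smul c a := by
    obtain ⟨a, rfl⟩ := mkAlg_surjective A r a
    rw [← map_smul, ← mkAlg_star, star_smul, map_smul, mkAlg_star]

/-- The quotient map. -/
noncomputable def mk : A →⋆ₐ[ℂ] StarQuot A r :=
  { mkAlg A r with map_star' := mkAlg_star A r }

end

variable {A : Type} [Ring A] [Algebra ℂ A] [StarRing A] [StarModule ℂ A] {r : A → A → Prop}
variable {B : Type} [Ring B] [Algebra ℂ B] [StarRing B]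

theorem mk_surjective : Function.Surjective (mk A r) := mkAlg_surjective A r

theorem mk_eq {a b : A} (h : r a b) : mk A r a = mk A r b :=
  RingQuot.mkAlgHom_rel ℂ (Or.inl h)

/-- The universal property of the quotient. -/
noncomputable def lift (f : A →⋆ₐ[ℂ] B) (h : ∀ a b, r a b → f a = f b) :
    StarQuot A r →⋆ₐ[ℂ] B :=
  let g : StarQuot A r →ₐ[ℂ] B := RingQuot.liftAlgHom ℂ
    ⟨f.toAlgHom, fun a b hab => by
      rcases hab with hab | hab
      · exact h a b hab
      · have := h _ _ hab
        rw [map_star, map_star] at this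
        exact star_injective this⟩
  { g with
    map_star' := fun a => by
      have hg : ∀ x, g (mkAlg A r x) = f x := fun x => RingQuot.liftAlgHom_mkAlgHom_apply ..
      obtain ⟨a, rfl⟩ := mkAlg_surjective A r a
      change g (star _) = star (g _)
      rw [← mkAlg_star, hg, hg, map_star] }

@[simp] theorem lift_mk (f : A →⋆ₐ[ℂ] B) (h : ∀ a b, r a b → f a = f b) (a : A) :
    lift f h (mk A r a) = f a :=
  RingQuot.liftAlgHom_mkAlgHom_apply ..

theorem hom_ext {C : Type} [Ring C] [Algebra ℂ C] [StarRing C]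
    {f g : StarQuot A r →⋆ₐ[ℂ] C} (h : ∀ a, f (mk A r a) = g (mk A r a)) :
    f = g := by
  ext a
  obtain ⟨a, rfl⟩ := mk_surjective a
  exact h a

end StarQuot

/-- The tensor product of two `*`-morphisms. -/
noncomputable def starTensorMap {A B C D : Type}
    [Ring A] [Algebra ℂ A] [StarRing A] [StarModule ℂ A]
    [Ring B] [Algebra ℂ B] [StarRing B] [StarModule ℂ B]
    [Ring C] [Algebra ℂ C] [StarRing C] [StarModule ℂ C]
    [Ring D] [Algebra ℂ D] [StarRing D] [StarModule ℂ D]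
    (f : A →⋆ₐ[ℂ] C) (g : B →⋆ₐ[ℂ] D) : A ⊗[ℂ] B →⋆ₐ[ℂ] C ⊗[ℂ] D :=
  { Algebra.TensorProduct.map f.toAlgHom g.toAlgHom with
    map_star' := fun x => by
      change Algebra.TensorProduct.map f.toAlgHom g.toAlgHom (star x)
        = star (Algebra.TensorProduct.map f.toAlgHom g.toAlgHom x)
      induction x using TensorProduct.induction_on with
      | zero => simp
      | tmul a b =>
        simp only [TensorProduct.star_tmul, Algebra.TensorProduct.map_tmul]
        exact congrArg₂ (· ⊗ₜ[ℂ] ·) (map_star f a) (map_star g b)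
      | add x y hx hy => simp only [star_add, map_add, hx, hy] }

@[simp] theorem starTensorMap_tmul {A B C D : Type}
    [Ring A] [Algebra ℂ A] [StarRing A] [StarModule ℂ A]
    [Ring B] [Algebra ℂ B] [StarRing B] [StarModule ℂ B]
    [Ring C] [Algebra ℂ C] [StarRing C] [StarModule ℂ C]
    [Ring D] [Algebra ℂ D] [StarRing D] [StarModule ℂ D]
    (f : A →⋆ₐ[ℂ] C) (g : B →⋆ₐ[ℂ] D) (a : A) (b : B) :
    starTensorMap f g (a ⊗ₜ[ℂ] b) = f a ⊗ₜ[ℂ] g b :=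
  rfl

/-! ## Magic unitaries -/

/-- The defining relations of the quantum permutation group: the entries are self-adjoint
idempotents which sum to one and are pairwise orthogonal along each row and each column. -/
structure IsMagic {ι A : Type} [Fintype ι] [Ring A] [StarRing A] (p : Matrix ι ι A) : Prop where
  star_eq : ∀ i j, star (p i j) = p i j
  mul_self : ∀ i j, p i j * p i j = p i j
  row_sum : ∀ i, ∑ j, p i j = 1
  col_sum : ∀ j, ∑ i, p i j = 1
  row_orth : ∀ i j k, j ≠ k → p i j * p i k = 0
  col_orth : ∀ i j k, i ≠ k → p i j * p k j = 0

theorem IsMagic.map {ι A B : Type} [Fintype ι] [Ring A] [Algebra ℂ A] [StarRing A]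
    [Ring B] [Algebra ℂ B] [StarRing B] {p : Matrix ι ι A} (hp : IsMagic p)
    (f : A →⋆ₐ[ℂ] B) : IsMagic (p.map f) where
  star_eq i j := by simp [← map_star, hp.star_eq]
  mul_self i j := by simp [← map_mul, hp.mul_self]
  row_sum i := by simp [← map_sum, hp.row_sum]
  col_sum i := by simp [← map_sum, hp.col_sum]
  row_orth i j k h := by simp [← map_mul, hp.row_orth i j k h]
  col_orth i j k h := by simp [← map_mul, hp.col_orth i j k h]

/-- The matrix with entries `∑ k, p i k ⊗ q k j`. -/
noncomputable def tensorMul {ι A B : Type} [Fintype ι] [Ring A] [Algebra ℂ A] [Ring B]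
    [Algebra ℂ B] (p : Matrix ι ι A) (q : Matrix ι ι B) : Matrix ι ι (A ⊗[ℂ] B) :=
  fun i j => ∑ k, p i k ⊗ₜ[ℂ] q k j

theorem isMagic_tensorMul {ι A B : Type} [Fintype ι]
    [Ring A] [Algebra ℂ A] [StarRing A] [StarModule ℂ A]
    [Ring B] [Algebra ℂ B] [StarRing B] [StarModule ℂ B]
    {p : Matrix ι ι A} {q : Matrix ι ι B} (hp : IsMagic p) (hq : IsMagic q) :
    IsMagic (tensorMul p q) := by
  classical
  have hmul : ∀ i j i' j', tensorMul p q i j * tensorMul p q i' j'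
      = ∑ a, ∑ b, (p i a * p i' b) ⊗ₜ[ℂ] (q a j * q b j') := fun i j i' j' => by
    simp only [tensorMul, Finset.sum_mul_sum, Algebra.TensorProduct.tmul_mul_tmul]
  refine ⟨fun i j => ?_, fun i j => ?_, fun i => ?_, fun j => ?_, fun i j k h => ?_,
    fun i j k h => ?_⟩
  · simp [tensorMul, star_sum, hp.star_eq, hq.star_eq]
  · rw [hmul]
    refine Finset.sum_congr rfl fun a _ => ?_
    rw [Finset.sum_eq_single a (fun b _ hb => by rw [hp.row_orth i a b hb.symm,
      TensorProduct.zero_tmul]) (by simp), hp.mul_self, hq.mul_self]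
  · simp only [tensorMul]
    rw [Finset.sum_comm]
    simp only [← TensorProduct.tmul_sum, hq.row_sum, ← TensorProduct.sum_tmul, hp.row_sum]
    rfl
  · simp only [tensorMul]
    rw [Finset.sum_comm]
    simp only [← TensorProduct.sum_tmul, hp.col_sum, ← TensorProduct.tmul_sum, hq.col_sum]
    rfl
  · rw [hmul]
    refine Finset.sum_eq_zero fun a _ => Finset.sum_eq_zero fun b _ => ?_
    rcases eq_or_ne a b with rfl | hab
    · rw [hq.row_orth a j k h, TensorProduct.tmul_zero]
    · rw [hp.row_orth i a b hab, TensorProduct.zero_tmul]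
  · rw [hmul]
    refine Finset.sum_eq_zero fun a _ => Finset.sum_eq_zero fun b _ => ?_
    rcases eq_or_ne a b with rfl | hab
    · rw [hp.col_orth i a k h, TensorProduct.zero_tmul]
    · rw [hq.col_orth a j b hab, TensorProduct.tmul_zero]

/-! ## Quantum permutation groups -/

/-- A quantum permutation group: a unital complex `*`-algebra (the algebra of coefficients)
generated by the entries of a magic unitary `u`, with a comultiplication given on the generators
by matrix multiplication. The rows and columns of `u` are labelled by a finite nonempty type `ι`. -/
structure QuantumPermutationGroup : Type 1 where
  coeff : Type
  [ring : Ring coeff]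
  [algebra : Algebra ℂ coeff]
  [starRing : StarRing coeff]
  [starModule : StarModule ℂ coeff]
  ι : Type
  [fintype : Fintype ι]
  [nonempty : Nonempty ι]
  u : Matrix ι ι coeff
  magic : IsMagic u
  generated : StarAlgebra.adjoin ℂ (Set.range fun ij : ι × ι => u ij.1 ij.2) = ⊤
  comul : coeff →⋆ₐ[ℂ] coeff ⊗[ℂ] coeff
  comul_u : ∀ i j, comul (u i j) = ∑ k, u i k ⊗ₜ[ℂ] u k j

namespace QuantumPermutationGroup

attribute [instance] ring algebra starRing starModule fintype nonempty

/-- Isomorphism of quantum groups: an isomorphism of the `*`-algebras of coefficients which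
intertwines the comultiplications. -/
def Isomorphic (Γ Λ : QuantumPermutationGroup) : Prop :=
  ∃ f : Γ.coeff ≃⋆ₐ[ℂ] Λ.coeff, ∀ a : Γ.coeff,
    Λ.comul (f a) = starTensorMap (f : Γ.coeff →⋆ₐ[ℂ] Λ.coeff) (f : Γ.coeff →⋆ₐ[ℂ] Λ.coeff)
      (Γ.comul a)

theorem generated_le (Γ : QuantumPermutationGroup) (S : StarSubalgebra ℂ Γ.coeff)
    (h : ∀ i j, Γ.u i j ∈ S) (a : Γ.coeff) : a ∈ S := by
  have : (⊤ : StarSubalgebra ℂ Γ.coeff) ≤ S := by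
    rw [← Γ.generated]
    refine StarAlgebra.adjoin_le ?_
    rintro _ ⟨ij, rfl⟩
    exact h ij.1 ij.2
  exact this trivial

/-- The trivial quantum group. -/
noncomputable def trivialGroup : QuantumPermutationGroup where
  coeff := ℂ
  ι := Unit
  u := fun _ _ => 1
  magic := by constructor <;> simp
  generated := by
    refine eq_top_iff.2 fun a _ => ?_
    exact (StarAlgebra.adjoin ℂ _).algebraMap_mem a
  comul := StarAlgHom.ofId ℂ (ℂ ⊗[ℂ] ℂ)
  comul_u _ _ := by
    simp only [Finset.univ_unique, Finset.sum_const, Finset.card_singleton, one_smul, map_one]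
    rfl

end QuantumPermutationGroup

/-- The relations of a magic unitary indexed by `ι`, together with the additional relations `R`
between `*`-polynomials in the entries. -/
inductive MagicRel (ι : Type) [Fintype ι]
    (R : FreeStarAlgebra (ι × ι) → FreeStarAlgebra (ι × ι) → Prop) :
    FreeStarAlgebra (ι × ι) → FreeStarAlgebra (ι × ι) → Prop
  | star_eq (i j) : MagicRel ι R (star (FreeStarAlgebra.of (i, j))) (FreeStarAlgebra.of (i, j))
  | mul_self (i j) : MagicRel ι R
      (FreeStarAlgebra.of (i, j) * FreeStarAlgebra.of (i, j)) (FreeStarAlgebra.of (i, j))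
  | row_sum (i) : MagicRel ι R (∑ j, FreeStarAlgebra.of (i, j)) 1
  | col_sum (j) : MagicRel ι R (∑ i, FreeStarAlgebra.of (i, j)) 1
  | row_orth (i j k) : j ≠ k →
      MagicRel ι R (FreeStarAlgebra.of (i, j) * FreeStarAlgebra.of (i, k)) 0
  | col_orth (i j k) : i ≠ k →
      MagicRel ι R (FreeStarAlgebra.of (i, j) * FreeStarAlgebra.of (k, j)) 0
  | rel (a b) : R a b → MagicRel ι R a b

/-- The universal unital `*`-algebra generated by a magic unitary satisfying the relations `R`. -/
abbrev UniversalMagic (ι : Type) [Fintype ι]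
    (R : FreeStarAlgebra (ι × ι) → FreeStarAlgebra (ι × ι) → Prop) : Type :=
  StarQuot (FreeStarAlgebra (ι × ι)) (MagicRel ι R)

namespace UniversalMagic

variable {ι : Type} [Fintype ι] (R : FreeStarAlgebra (ι × ι) → FreeStarAlgebra (ι × ι) → Prop)

/-- The universal magic unitary. -/
noncomputable def gen : Matrix ι ι (UniversalMagic ι R) :=
  fun i j => StarQuot.mk _ _ (FreeStarAlgebra.of (i, j))

theorem gen_magic : IsMagic (gen R) where
  star_eq i j := by
    simpa [gen, map_star] using
      StarQuot.mk_eq (A := FreeStarAlgebra (ι × ι)) (MagicRel.star_eq (R := R) i j)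
  mul_self i j := by
    simpa [gen] using
      StarQuot.mk_eq (A := FreeStarAlgebra (ι × ι)) (MagicRel.mul_self (R := R) i j)
  row_sum i := by
    simpa [gen] using
      StarQuot.mk_eq (A := FreeStarAlgebra (ι × ι)) (MagicRel.row_sum (R := R) i)
  col_sum i := by
    simpa [gen] using
      StarQuot.mk_eq (A := FreeStarAlgebra (ι × ι)) (MagicRel.col_sum (R := R) i)
  row_orth i j k h := by
    simpa [gen] using
      StarQuot.mk_eq (A := FreeStarAlgebra (ι × ι)) (MagicRel.row_orth (R := R) i j k h)
  col_orth i j k h := by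
    simpa [gen] using
      StarQuot.mk_eq (A := FreeStarAlgebra (ι × ι)) (MagicRel.col_orth (R := R) i j k h)

theorem mk_eq_lift (a : FreeStarAlgebra (ι × ι)) :
    StarQuot.mk _ (MagicRel ι R) a
      = FreeStarAlgebra.lift (fun ij : ι × ι => gen R ij.1 ij.2) a := by
  have : StarQuot.mk _ (MagicRel ι R)
      = FreeStarAlgebra.lift (fun ij : ι × ι => gen R ij.1 ij.2) :=
    FreeStarAlgebra.hom_ext fun x => by rw [FreeStarAlgebra.lift_of]; rfl
  rw [this]

variable {R} {B : Type} [Ring B] [Algebra ℂ B] [StarRing B] [StarModule ℂ B]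

/-- The universal property. -/
noncomputable def lift (p : Matrix ι ι B) (hp : IsMagic p)
    (h : ∀ a b, R a b → FreeStarAlgebra.lift (fun ij : ι × ι => p ij.1 ij.2) a
      = FreeStarAlgebra.lift (fun ij : ι × ι => p ij.1 ij.2) b) :
    UniversalMagic ι R →⋆ₐ[ℂ] B :=
  StarQuot.lift (FreeStarAlgebra.lift (fun ij : ι × ι => p ij.1 ij.2)) fun a b hab => by
    cases hab with
    | star_eq i j => simp [map_star, hp.star_eq]
    | mul_self i j => simp [hp.mul_self]
    | row_sum i => simp [hp.row_sum]
    | col_sum i => simp [hp.col_sum]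
    | row_orth i j k h => simp [hp.row_orth i j k h]
    | col_orth i j k h => simp [hp.col_orth i j k h]
    | rel _ _ hR => exact h _ _ hR

theorem lift_gen (p : Matrix ι ι B) (hp : IsMagic p)
    (h : ∀ a b, R a b → FreeStarAlgebra.lift (fun ij : ι × ι => p ij.1 ij.2) a
      = FreeStarAlgebra.lift (fun ij : ι × ι => p ij.1 ij.2) b) (i j : ι) :
    lift p hp h (gen R i j) = p i j := by
  simp [lift, gen]

theorem hom_ext {C : Type} [Ring C] [Algebra ℂ C] [StarRing C]
    {f g : UniversalMagic ι R →⋆ₐ[ℂ] C}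
    (h : ∀ i j, f (gen R i j) = g (gen R i j)) : f = g := by
  refine StarQuot.hom_ext fun a => ?_
  have : f.comp (StarQuot.mk _ _) = g.comp (StarQuot.mk _ _) :=
    FreeStarAlgebra.hom_ext fun x => h x.1 x.2
  exact DFunLike.congr_fun this a

theorem generated : StarAlgebra.adjoin ℂ (Set.range fun ij : ι × ι => gen R ij.1 ij.2) = ⊤ := by
  set S := StarAlgebra.adjoin ℂ (Set.range fun ij : ι × ι => gen R ij.1 ij.2) with hS
  have hm : ∀ ij : ι × ι, gen R ij.1 ij.2 ∈ S := fun ij =>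
    StarAlgebra.subset_adjoin ℂ _ ⟨ij, rfl⟩
  refine eq_top_iff.2 fun a _ => ?_
  obtain ⟨b, rfl⟩ := StarQuot.mk_surjective a
  have key : S.subtype.comp (FreeStarAlgebra.lift fun ij : ι × ι => (⟨_, hm ij⟩ : S))
      = StarQuot.mk _ (MagicRel ι R) :=
    FreeStarAlgebra.hom_ext fun x => by simp; rfl
  rw [← key]
  exact Subtype.property _

end UniversalMagic

namespace QuantumPermutationGroup

/-- The quantum subgroup of the quantum permutation group on `ι` defined by relations `R` that
are compatible with the comultiplication. -/
noncomputable def ofRelations (ι : Type) [Fintype ι] [Nonempty ι]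
    (R : FreeStarAlgebra (ι × ι) → FreeStarAlgebra (ι × ι) → Prop)
    (h : ∀ a b, R a b →
      FreeStarAlgebra.lift (fun ij : ι × ι =>
        tensorMul (UniversalMagic.gen R) (UniversalMagic.gen R) ij.1 ij.2) a
      = FreeStarAlgebra.lift (fun ij : ι × ι =>
        tensorMul (UniversalMagic.gen R) (UniversalMagic.gen R) ij.1 ij.2) b) :
    QuantumPermutationGroup where
  coeff := UniversalMagic ι R
  ι := ι
  u := UniversalMagic.gen R
  magic := UniversalMagic.gen_magic R
  generated := UniversalMagic.generated
  comul := UniversalMagic.lift (tensorMul (UniversalMagic.gen R) (UniversalMagic.gen R))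
    (isMagic_tensorMul (UniversalMagic.gen_magic R) (UniversalMagic.gen_magic R)) h
  comul_u i j := UniversalMagic.lift_gen _ _ h i j

/-- The quantum permutation group on `n` points. -/
noncomputable def symmetric (n : ℕ) [NeZero n] : QuantumPermutationGroup :=
  ofRelations (Fin n) (fun _ _ => False) (fun _ _ h => h.elim)

open scoped Classical in
/-- The relations saying that the matrix of generators commutes with the adjacency matrix
of `G`. -/
inductive CommuteRel {V : Type} [Fintype V] (G : SimpleGraph V) :
    FreeStarAlgebra (V × V) → FreeStarAlgebra (V × V) → Prop
  | comm (x y : V) : CommuteRel G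
      (∑ z, G.adjMatrix ℂ x z • FreeStarAlgebra.of (z, y))
      (∑ z, G.adjMatrix ℂ z y • FreeStarAlgebra.of (x, z))

theorem commuteRel_tensorMul {V : Type} [Fintype V] (G : SimpleGraph V)
    (a b : FreeStarAlgebra (V × V)) (h : CommuteRel G a b) :
    FreeStarAlgebra.lift (fun ij : V × V => tensorMul (UniversalMagic.gen (CommuteRel G))
        (UniversalMagic.gen (CommuteRel G)) ij.1 ij.2) a
      = FreeStarAlgebra.lift (fun ij : V × V => tensorMul (UniversalMagic.gen (CommuteRel G))
        (UniversalMagic.gen (CommuteRel G)) ij.1 ij.2) b := by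
  classical
  have key : ∀ x y : V,
      ∑ z, G.adjMatrix ℂ x z • UniversalMagic.gen (CommuteRel G) z y
        = ∑ z, G.adjMatrix ℂ z y • UniversalMagic.gen (CommuteRel G) x z := fun x y => by
    have := StarQuot.mk_eq (A := FreeStarAlgebra (V × V))
      (MagicRel.rel (R := CommuteRel G) _ _ (CommuteRel.comm x y))
    rw [map_sum, map_sum] at this
    simp only [map_smul] at this
    convert this <;> rfl
  obtain ⟨x, y⟩ := h
  simp only [map_sum, map_smul, FreeStarAlgebra.lift_of, tensorMul]
  calc _ = ∑ k, (∑ z, G.adjMatrix ℂ x z • UniversalMagic.gen (CommuteRel G) z k)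
              ⊗ₜ[ℂ] UniversalMagic.gen (CommuteRel G) k y := by
        simp only [Finset.smul_sum, TensorProduct.sum_tmul, TensorProduct.smul_tmul']
        rw [Finset.sum_comm]
    _ = ∑ k, (∑ z, G.adjMatrix ℂ z k • UniversalMagic.gen (CommuteRel G) x z)
              ⊗ₜ[ℂ] UniversalMagic.gen (CommuteRel G) k y := by simp only [key]
    _ = ∑ z, UniversalMagic.gen (CommuteRel G) x z
              ⊗ₜ[ℂ] (∑ k, G.adjMatrix ℂ z k • UniversalMagic.gen (CommuteRel G) k y) := by
        simp only [TensorProduct.sum_tmul, TensorProduct.tmul_sum, TensorProduct.smul_tmul]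
        rw [Finset.sum_comm]
    _ = ∑ z, UniversalMagic.gen (CommuteRel G) x z
              ⊗ₜ[ℂ] (∑ k, G.adjMatrix ℂ k y • UniversalMagic.gen (CommuteRel G) z k) := by
        simp only [key]
    _ = _ := by
        simp only [Finset.smul_sum, TensorProduct.tmul_sum, TensorProduct.tmul_smul]
        rw [Finset.sum_comm]

/-- The quantum automorphism group of a finite graph. -/
noncomputable def ofGraph {V : Type} [Fintype V] [Nonempty V] (G : SimpleGraph V) :
    QuantumPermutationGroup :=
  ofRelations V (CommuteRel G) (commuteRel_tensorMul G)

end QuantumPermutationGroup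

/-! ## Free products of `*`-algebras -/

/-- The relations expressing that `j` is a morphism of unital complex `*`-algebras. -/
inductive StarHomRel {A F : Type} [Ring A] [Algebra ℂ A] [StarRing A] [Ring F] [Algebra ℂ F]
    [StarRing F] (j : A → F) : F → F → Prop
  | algebraMap (c : ℂ) : StarHomRel j (j (algebraMap ℂ A c)) (algebraMap ℂ F c)
  | add (a b : A) : StarHomRel j (j (a + b)) (j a + j b)
  | mul (a b : A) : StarHomRel j (j (a * b)) (j a * j b)
  | star (a : A) : StarHomRel j (j (star a)) (star (j a))

section homOfRel

variable {A F : Type} [Ring A] [Algebra ℂ A] [StarRing A]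
  [Ring F] [Algebra ℂ F] [StarRing F] [StarModule ℂ F]

/-- The morphism into a quotient where the relations `StarHomRel j` hold. -/
noncomputable def homOfRel (j : A → F) (r : F → F → Prop) (h : ∀ a b, StarHomRel j a b → r a b) :
    A →⋆ₐ[ℂ] StarQuot F r where
  toFun a := StarQuot.mk F r (j a)
  map_one' := by
    simpa using StarQuot.mk_eq (h _ _ (StarHomRel.algebraMap (j := j) 1))
  map_mul' a b := by simpa using StarQuot.mk_eq (h _ _ (StarHomRel.mul a b))
  map_zero' := by
    simpa using StarQuot.mk_eq (h _ _ (StarHomRel.algebraMap (j := j) 0))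
  map_add' a b := by simpa using StarQuot.mk_eq (h _ _ (StarHomRel.add a b))
  commutes' c := by
    have := StarQuot.mk_eq (h _ _ (StarHomRel.algebraMap (j := j) c))
    rwa [AlgHomClass.commutes] at this
  map_star' a := by
    have := StarQuot.mk_eq (h _ _ (StarHomRel.star a))
    rwa [map_star] at this

theorem StarHomRel.lift_eq {X B : Type} [Ring B] [Algebra ℂ B] [StarRing B] [StarModule ℂ B]
    (i : A → X) (g : X → B) (f : A →⋆ₐ[ℂ] B) (hf : ∀ a, g (i a) = f a)
    {x y : FreeStarAlgebra X} (h : StarHomRel (fun a => FreeStarAlgebra.of (i a)) x y) :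
    FreeStarAlgebra.lift g x = FreeStarAlgebra.lift g y := by
  cases h with
  | algebraMap c => rw [FreeStarAlgebra.lift_of, hf, AlgHomClass.commutes, AlgHomClass.commutes]
  | add a b => simp [hf]
  | mul a b => simp [hf]
  | star a => simp [hf, map_star]

end homOfRel

/-- The relations of the unital free product of `A` and `B`. -/
def FreeProductRel (A B : Type) [Ring A] [Algebra ℂ A] [StarRing A]
    [Ring B] [Algebra ℂ B] [StarRing B] (x y : FreeStarAlgebra (A ⊕ B)) : Prop :=
  StarHomRel (fun a : A => FreeStarAlgebra.of (Sum.inl a)) x y ∨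
    StarHomRel (fun b : B => FreeStarAlgebra.of (Sum.inr b)) x y

/-- The unital free product (the coproduct) of two unital complex `*`-algebras. -/
abbrev FreeProduct (A B : Type) [Ring A] [Algebra ℂ A] [StarRing A]
    [Ring B] [Algebra ℂ B] [StarRing B] : Type :=
  StarQuot (FreeStarAlgebra (A ⊕ B)) (FreeProductRel A B)

namespace FreeProduct

variable {A B C : Type} [Ring A] [Algebra ℂ A] [StarRing A]
  [Ring B] [Algebra ℂ B] [StarRing B] [Ring C] [Algebra ℂ C] [StarRing C]

/-- The first canonical morphism. -/
noncomputable def inl : A →⋆ₐ[ℂ] FreeProduct A B :=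
  homOfRel (fun a : A => FreeStarAlgebra.of (Sum.inl a)) _ (fun _ _ h => Or.inl h)

/-- The second canonical morphism. -/
noncomputable def inr : B →⋆ₐ[ℂ] FreeProduct A B :=
  homOfRel (fun b : B => FreeStarAlgebra.of (Sum.inr b)) _ (fun _ _ h => Or.inr h)

/-- The universal property. -/
noncomputable def lift [StarModule ℂ C] (f : A →⋆ₐ[ℂ] C) (g : B →⋆ₐ[ℂ] C) :
    FreeProduct A B →⋆ₐ[ℂ] C :=
  StarQuot.lift (FreeStarAlgebra.lift (Sum.elim f g)) fun _ _ h => by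
    rcases h with h | h
    · exact StarHomRel.lift_eq Sum.inl _ f (fun _ => rfl) h
    · exact StarHomRel.lift_eq Sum.inr _ g (fun _ => rfl) h

@[simp] theorem lift_inl [StarModule ℂ C] (f : A →⋆ₐ[ℂ] C) (g : B →⋆ₐ[ℂ] C) (a : A) :
    lift f g (inl a) = f a :=
  (StarQuot.lift_mk _ _ _).trans (FreeStarAlgebra.lift_of _ _)

@[simp] theorem lift_inr [StarModule ℂ C] (f : A →⋆ₐ[ℂ] C) (g : B →⋆ₐ[ℂ] C) (b : B) :
    lift f g (inr b) = g b :=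
  (StarQuot.lift_mk _ _ _).trans (FreeStarAlgebra.lift_of _ _)

theorem hom_ext {f g : FreeProduct A B →⋆ₐ[ℂ] C} (hl : ∀ a, f (inl a) = g (inl a))
    (hr : ∀ b, f (inr b) = g (inr b)) : f = g := by
  refine StarQuot.hom_ext fun a => ?_
  have : f.comp (StarQuot.mk _ _) = g.comp (StarQuot.mk _ _) :=
    FreeStarAlgebra.hom_ext fun x => by
      cases x with
      | inl a => exact hl a
      | inr b => exact hr b
  exact DFunLike.congr_fun this a

theorem mem_of_mem (S : StarSubalgebra ℂ (FreeProduct A B)) (hl : ∀ a, inl a ∈ S)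
    (hr : ∀ b, inr b ∈ S) (x : FreeProduct A B) : x ∈ S := by
  have key : S.subtype.comp (lift (StarAlgHom.codRestrict inl S hl)
      (StarAlgHom.codRestrict inr S hr)) = StarAlgHom.id ℂ _ :=
    hom_ext (fun a => by simp) (fun b => by simp)
  have : _ = x := DFunLike.congr_fun key x
  rw [← this]
  exact Subtype.property _

end FreeProduct

/-- The relations of the unital free product of copies of `A` indexed by `I`. -/
def FreePowerRel (I A : Type) [Ring A] [Algebra ℂ A] [StarRing A]
    (x y : FreeStarAlgebra (I × A)) : Prop :=
  ∃ i : I, StarHomRel (fun a : A => FreeStarAlgebra.of (i, a)) x y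

/-- The unital free product of copies of `A` indexed by `I`. -/
abbrev FreePower (I A : Type) [Ring A] [Algebra ℂ A] [StarRing A] : Type :=
  StarQuot (FreeStarAlgebra (I × A)) (FreePowerRel I A)

namespace FreePower

variable {I A C : Type} [Ring A] [Algebra ℂ A] [StarRing A] [Ring C] [Algebra ℂ C] [StarRing C]

/-- The canonical morphism from the `i`-th copy. -/
noncomputable def incl (i : I) : A →⋆ₐ[ℂ] FreePower I A :=
  homOfRel (fun a : A => FreeStarAlgebra.of (i, a)) _ (fun _ _ h => ⟨i, h⟩)

/-- The universal property. -/
noncomputable def lift [StarModule ℂ C] (f : I → A →⋆ₐ[ℂ] C) : FreePower I A →⋆ₐ[ℂ] C :=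
  StarQuot.lift (FreeStarAlgebra.lift fun ia : I × A => f ia.1 ia.2) fun _ _ ⟨i, h⟩ =>
    StarHomRel.lift_eq (fun a => (i, a)) _ (f i) (fun _ => rfl) h

@[simp] theorem lift_incl [StarModule ℂ C] (f : I → A →⋆ₐ[ℂ] C) (i : I) (a : A) :
    lift f (incl i a) = f i a :=
  (StarQuot.lift_mk _ _ _).trans (FreeStarAlgebra.lift_of _ _)

theorem hom_ext {f g : FreePower I A →⋆ₐ[ℂ] C} (h : ∀ i a, f (incl i a) = g (incl i a)) :
    f = g := by
  refine StarQuot.hom_ext fun a => ?_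
  have : f.comp (StarQuot.mk _ _) = g.comp (StarQuot.mk _ _) :=
    FreeStarAlgebra.hom_ext fun x => h x.1 x.2
  exact DFunLike.congr_fun this a

theorem mem_of_mem (S : StarSubalgebra ℂ (FreePower I A)) (h : ∀ i a, incl i a ∈ S)
    (x : FreePower I A) : x ∈ S := by
  have key : S.subtype.comp (lift fun i => StarAlgHom.codRestrict (incl i) S (h i))
      = StarAlgHom.id ℂ _ :=
    hom_ext (fun i a => by simp)
  have : _ = x := DFunLike.congr_fun key x
  rw [← this]
  exact Subtype.property _

end FreePower

namespace QuantumPermutationGroup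

/-! ## Free products and wreath products of quantum permutation groups -/

/-- The free product of two quantum permutation groups: its algebra is the unital free product
and its magic unitary is block diagonal. -/
noncomputable def freeProduct (Γ Λ : QuantumPermutationGroup) : QuantumPermutationGroup where
  coeff := FreeProduct Γ.coeff Λ.coeff
  ι := Γ.ι ⊕ Λ.ι
  u := Matrix.fromBlocks (Γ.u.map FreeProduct.inl) 0 0 (Λ.u.map FreeProduct.inr)
  magic := by
    have h1 := Γ.magic.map (FreeProduct.inl (B := Λ.coeff))
    have h2 := Λ.magic.map (FreeProduct.inr (A := Γ.coeff))
    refine ⟨?_, ?_, ?_, ?_, ?_, ?_⟩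
    · rintro (i | i) (j | j) <;> simp [-Matrix.map_apply, h1.star_eq, h2.star_eq]
    · rintro (i | i) (j | j) <;> simp [-Matrix.map_apply, h1.mul_self, h2.mul_self]
    · rintro (i | i) <;> simp [-Matrix.map_apply, h1.row_sum, h2.row_sum]
    · rintro (i | i) <;> simp [-Matrix.map_apply, h1.col_sum, h2.col_sum]
    · rintro (i | i) (j | j) (k | k) h <;> simp [-Matrix.map_apply]
      · exact h1.row_orth i j k (fun e => h (by rw [e]))
      · exact h2.row_orth i j k (fun e => h (by rw [e]))
    · rintro (i | i) (j | j) (k | k) h <;> simp [-Matrix.map_apply]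
      · exact h1.col_orth i j k (fun e => h (by rw [e]))
      · exact h2.col_orth i j k (fun e => h (by rw [e]))
  generated := by
    set S := StarAlgebra.adjoin ℂ (Set.range fun ij : (Γ.ι ⊕ Λ.ι) × (Γ.ι ⊕ Λ.ι) =>
      (Matrix.fromBlocks (Γ.u.map (FreeProduct.inl (B := Λ.coeff))) 0 0
        (Λ.u.map (FreeProduct.inr (A := Γ.coeff)))) ij.1 ij.2) with hS
    refine eq_top_iff.2 fun x _ => FreeProduct.mem_of_mem S (fun a => ?_) (fun b => ?_) x
    · refine Γ.generated_le (S.comap FreeProduct.inl) (fun i j => ?_) a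
      exact StarAlgebra.subset_adjoin ℂ _ ⟨(Sum.inl i, Sum.inl j), rfl⟩
    · refine Λ.generated_le (S.comap FreeProduct.inr) (fun i j => ?_) b
      exact StarAlgebra.subset_adjoin ℂ _ ⟨(Sum.inr i, Sum.inr j), rfl⟩
  comul := FreeProduct.lift
    ((starTensorMap FreeProduct.inl FreeProduct.inl).comp Γ.comul)
    ((starTensorMap FreeProduct.inr FreeProduct.inr).comp Λ.comul)
  comul_u := by
    rintro (i | i) (j | j) <;> simp [Γ.comul_u, Λ.comul_u]

/-- The relations imposed on the free product of `n` copies of the algebra of `Γ` and the algebra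
of the quantum permutation group on `n` points: the `i`-th copy commutes with the `i`-th row. -/
inductive WreathRel (Γ : QuantumPermutationGroup) (n : ℕ) [NeZero n] :
    FreeProduct (FreePower (Fin n) Γ.coeff) (symmetric n).coeff →
    FreeProduct (FreePower (Fin n) Γ.coeff) (symmetric n).coeff → Prop
  | comm (i j : Fin n) (a : Γ.coeff) : WreathRel Γ n
      (FreeProduct.inl (FreePower.incl i a) * FreeProduct.inr ((symmetric n).u i j))
      (FreeProduct.inr ((symmetric n).u i j) * FreeProduct.inl (FreePower.incl i a))

/-- The algebra of the free wreath product. -/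
abbrev WreathAlgebra (Γ : QuantumPermutationGroup) (n : ℕ) [NeZero n] : Type :=
  StarQuot (FreeProduct (FreePower (Fin n) Γ.coeff) (symmetric n).coeff) (WreathRel Γ n)

namespace Wreath

variable (Γ : QuantumPermutationGroup) (n : ℕ) [NeZero n]

/-- The morphism `ν i` from the `i`-th copy of the algebra of `Γ`. -/
noncomputable def nu (i : Fin n) : Γ.coeff →⋆ₐ[ℂ] WreathAlgebra Γ n :=
  (StarQuot.mk _ _).comp (FreeProduct.inl.comp (FreePower.incl i))

/-- The canonical morphism from the algebra of the quantum permutation group on `n` points. -/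
noncomputable def base : (symmetric n).coeff →⋆ₐ[ℂ] WreathAlgebra Γ n :=
  (StarQuot.mk _ _).comp FreeProduct.inr

/-- The image of the magic unitary of the quantum permutation group on `n` points. -/
noncomputable def p : Matrix (Fin n) (Fin n) (WreathAlgebra Γ n) :=
  (symmetric n).u.map (base Γ n)

theorem p_magic : IsMagic (p Γ n) := (symmetric n).magic.map (base Γ n)

theorem nu_mul_p (i j : Fin n) (a : Γ.coeff) : nu Γ n i a * p Γ n i j = p Γ n i j * nu Γ n i a := by
  have := StarQuot.mk_eq (WreathRel.comm (Γ := Γ) i j a)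
  rwa [map_mul, map_mul] at this

theorem hom_ext {C : Type} [Ring C] [Algebra ℂ C] [StarRing C]
    {f g : WreathAlgebra Γ n →⋆ₐ[ℂ] C} (h : ∀ i a, f (nu Γ n i a) = g (nu Γ n i a))
    (h' : ∀ s, f (base Γ n s) = g (base Γ n s)) : f = g := by
  refine StarQuot.hom_ext fun a => ?_
  have : f.comp (StarQuot.mk _ _) = g.comp (StarQuot.mk _ _) := by
    refine FreeProduct.hom_ext (fun x => ?_) (fun s => h' s)
    have : (f.comp (StarQuot.mk _ _)).comp FreeProduct.inl
        = (g.comp (StarQuot.mk _ _)).comp FreeProduct.inl :=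
      FreePower.hom_ext fun i a => h i a
    exact DFunLike.congr_fun this x
  exact DFunLike.congr_fun this a

/-- The universal property. -/
noncomputable def lift {C : Type} [Ring C] [Algebra ℂ C] [StarRing C] [StarModule ℂ C]
    (f : Fin n → Γ.coeff →⋆ₐ[ℂ] C) (g : (symmetric n).coeff →⋆ₐ[ℂ] C)
    (h : ∀ i j a, f i a * g ((symmetric n).u i j) = g ((symmetric n).u i j) * f i a) :
    WreathAlgebra Γ n →⋆ₐ[ℂ] C :=
  StarQuot.lift (FreeProduct.lift (FreePower.lift f) g) fun _ _ hr => by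
    obtain ⟨i, j, a⟩ := hr
    simp only [map_mul, FreeProduct.lift_inl, FreeProduct.lift_inr, FreePower.lift_incl]
    exact h i j a

section

variable {C : Type} [Ring C] [Algebra ℂ C] [StarRing C] [StarModule ℂ C]
    (f : Fin n → Γ.coeff →⋆ₐ[ℂ] C) (g : (symmetric n).coeff →⋆ₐ[ℂ] C)
    (h : ∀ i j a, f i a * g ((symmetric n).u i j) = g ((symmetric n).u i j) * f i a)

@[simp] theorem lift_nu (i : Fin n) (a : Γ.coeff) : lift Γ n f g h (nu Γ n i a) = f i a := by
  simp [lift, nu]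

@[simp] theorem lift_base (s : (symmetric n).coeff) :
    lift Γ n f g h (base Γ n s) = g s := by
  simp [lift, base]

end

theorem mem_of_mem (S : StarSubalgebra ℂ (WreathAlgebra Γ n)) (h : ∀ i a, nu Γ n i a ∈ S)
    (h' : ∀ s, base Γ n s ∈ S) (x : WreathAlgebra Γ n) : x ∈ S := by
  have key : S.subtype.comp (lift Γ n (fun i => StarAlgHom.codRestrict (nu Γ n i) S (h i))
      (StarAlgHom.codRestrict (base Γ n) S h')
      (fun i j a => Subtype.ext (nu_mul_p Γ n i j a))) = StarAlgHom.id ℂ _ :=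
    hom_ext Γ n (fun i a => by simp) (fun s => by simp)
  have : _ = x := DFunLike.congr_fun key x
  rw [← this]
  exact Subtype.property _

/-- The magic unitary of the free wreath product. -/
noncomputable def w : Matrix (Fin n × Γ.ι) (Fin n × Γ.ι) (WreathAlgebra Γ n) :=
  fun ik jl => nu Γ n ik.1 (Γ.u ik.2 jl.2) * p Γ n ik.1 jl.1

theorem w_mul (i j j' : Fin n) (k l k' l' : Γ.ι) :
    w Γ n (i, k) (j, l) * w Γ n (i, k') (j', l')
      = nu Γ n i (Γ.u k l * Γ.u k' l') * (p Γ n i j * p Γ n i j') := by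
  simp only [w, map_mul]
  rw [mul_assoc, ← mul_assoc (p Γ n i j), ← nu_mul_p]
  simp only [mul_assoc]

theorem w_magic : IsMagic (w Γ n) where
  star_eq := by
    rintro ⟨i, k⟩ ⟨j, l⟩
    simp only [w, star_mul, (p_magic Γ n).star_eq, ← map_star, Γ.magic.star_eq, nu_mul_p]
  mul_self := by
    rintro ⟨i, k⟩ ⟨j, l⟩
    rw [w_mul, Γ.magic.mul_self, (p_magic Γ n).mul_self]; rfl
  row_sum := by
    rintro ⟨i, k⟩
    simp only [w, Fintype.sum_prod_type]
    rw [Finset.sum_comm]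
    simp only [← Finset.mul_sum, (p_magic Γ n).row_sum, mul_one, ← map_sum, Γ.magic.row_sum,
      map_one]
  col_sum := by
    rintro ⟨j, l⟩
    simp only [w, Fintype.sum_prod_type, ← Finset.sum_mul, ← map_sum, Γ.magic.col_sum, map_one,
      one_mul, (p_magic Γ n).col_sum]
  row_orth := by
    rintro ⟨i, k⟩ ⟨j, l⟩ ⟨j', l'⟩ h
    rw [w_mul]
    by_cases hj : j = j'
    · rw [Γ.magic.row_orth k l l' (fun e => h (by rw [hj, e])), map_zero, zero_mul]
    · rw [(p_magic Γ n).row_orth i j j' hj, mul_zero]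
  col_orth := by
    rintro ⟨i, k⟩ ⟨j, l⟩ ⟨i', k'⟩ h
    by_cases hi : i = i'
    · subst hi
      rw [w_mul, Γ.magic.col_orth k l k' (fun e => h (by rw [e])), map_zero, zero_mul]
    · simp only [w]
      rw [nu_mul_p Γ n i' j, mul_assoc, ← mul_assoc (p Γ n i j),
        (p_magic Γ n).col_orth i j i' hi, zero_mul, mul_zero]

theorem w_generated : StarAlgebra.adjoin ℂ
    (Set.range fun x : (Fin n × Γ.ι) × (Fin n × Γ.ι) => w Γ n x.1 x.2) = ⊤ := by
  set S := StarAlgebra.adjoin ℂ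
    (Set.range fun x : (Fin n × Γ.ι) × (Fin n × Γ.ι) => w Γ n x.1 x.2) with hS
  have hw : ∀ i j k l, w Γ n (i, k) (j, l) ∈ S := fun i j k l =>
    StarAlgebra.subset_adjoin ℂ _ ⟨((i, k), (j, l)), rfl⟩
  refine eq_top_iff.2 fun x _ => mem_of_mem Γ n S (fun i a => ?_) (fun s => ?_) x
  · refine Γ.generated_le (S.comap (nu Γ n i)) (fun k l => ?_) a
    have : nu Γ n i (Γ.u k l) = ∑ j, w Γ n (i, k) (j, l) := by
      simp only [w, ← Finset.mul_sum, (p_magic Γ n).row_sum, mul_one]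
    change nu Γ n i (Γ.u k l) ∈ S
    rw [this]
    exact sum_mem fun j _ => hw i j k l
  · refine (symmetric n).generated_le (S.comap (base Γ n)) (fun i j => ?_) s
    obtain ⟨k⟩ := Γ.nonempty
    have : p Γ n i j = ∑ l, w Γ n (i, k) (j, l) := by
      simp only [w, ← Finset.sum_mul, ← map_sum, Γ.magic.row_sum, map_one, one_mul]
    change p Γ n i j ∈ S
    rw [this]
    exact sum_mem fun l _ => hw i j k l

theorem commute_tensor (i k : Fin n) (a b : WreathAlgebra Γ n)
    (ha : ∀ x, Commute (nu Γ n i x) a) (hb : ∀ x, Commute (nu Γ n k x) b)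
    (x : Γ.coeff ⊗[ℂ] Γ.coeff) :
    Commute (starTensorMap (nu Γ n i) (nu Γ n k) x) (a ⊗ₜ[ℂ] b) := by
  induction x using TensorProduct.induction_on with
  | zero => rw [map_zero]; exact Commute.zero_left _
  | tmul y z =>
    simp only [starTensorMap_tmul, Commute, SemiconjBy, Algebra.TensorProduct.tmul_mul_tmul]
    rw [(ha y).eq, (hb z).eq]
  | add x y hx hy => rw [map_add]; exact hx.add_left hy

/-- The comultiplication on the `i`-th copy of the algebra of `Γ`: the element `a` is sent to
`∑ k, (ν i ⊗ ν k) (Δ a) * (p i k ⊗ 1)`. -/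
noncomputable def comulNu (i : Fin n) :
    Γ.coeff →⋆ₐ[ℂ] WreathAlgebra Γ n ⊗[ℂ] WreathAlgebra Γ n :=
  have hc : ∀ k l x, Commute (starTensorMap (nu Γ n i) (nu Γ n l) x)
      (p Γ n i k ⊗ₜ[ℂ] (1 : WreathAlgebra Γ n)) := fun k l x =>
    commute_tensor Γ n i l _ _ (fun y => nu_mul_p Γ n i k y) (fun _ => Commute.one_right _) x
  have hsum : ∑ k, (p Γ n i k ⊗ₜ[ℂ] (1 : WreathAlgebra Γ n)) = 1 := by
    rw [← TensorProduct.sum_tmul, (p_magic Γ n).row_sum]; rfl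
  { toFun := fun a => ∑ k, starTensorMap (nu Γ n i) (nu Γ n k) (Γ.comul a)
      * (p Γ n i k ⊗ₜ[ℂ] (1 : WreathAlgebra Γ n))
    map_one' := by simp only [map_one, one_mul, hsum]
    map_mul' := fun a b => by
      rw [Finset.sum_mul_sum]
      refine Finset.sum_congr rfl fun k _ => ?_
      have hterm : ∀ l, starTensorMap (nu Γ n i) (nu Γ n k) (Γ.comul a)
            * (p Γ n i k ⊗ₜ[ℂ] (1 : WreathAlgebra Γ n))
            * (starTensorMap (nu Γ n i) (nu Γ n l) (Γ.comul b)
              * (p Γ n i l ⊗ₜ[ℂ] (1 : WreathAlgebra Γ n)))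
          = starTensorMap (nu Γ n i) (nu Γ n k) (Γ.comul a)
            * starTensorMap (nu Γ n i) (nu Γ n l) (Γ.comul b)
            * ((p Γ n i k * p Γ n i l) ⊗ₜ[ℂ] (1 : WreathAlgebra Γ n)) := fun l => by
        rw [mul_assoc, ← mul_assoc (p Γ n i k ⊗ₜ[ℂ] (1 : WreathAlgebra Γ n)), ← (hc k l _).eq,
          mul_assoc, Algebra.TensorProduct.tmul_mul_tmul, one_mul, mul_assoc]
      rw [Finset.sum_eq_single k (fun l _ hl => by
        rw [hterm, (p_magic Γ n).row_orth i k l hl.symm, TensorProduct.zero_tmul, mul_zero])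
        (by simp), hterm, (p_magic Γ n).mul_self, map_mul, map_mul]
    map_zero' := by simp
    map_add' := fun a b => by simp only [map_add, add_mul, Finset.sum_add_distrib]
    commutes' := fun c => by
      simp only [AlgHomClass.commutes, ← Finset.mul_sum, hsum, mul_one]
    map_star' := fun a => by
      rw [star_sum]
      refine Finset.sum_congr rfl fun k _ => ?_
      rw [star_mul, TensorProduct.star_tmul, (p_magic Γ n).star_eq, star_one, map_star, map_star]
      rw [← map_star, (hc k k _).eq] }

theorem comulNu_apply (i : Fin n) (a : Γ.coeff) :
    comulNu Γ n i a = ∑ k, starTensorMap (nu Γ n i) (nu Γ n k) (Γ.comul a)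
      * (p Γ n i k ⊗ₜ[ℂ] (1 : WreathAlgebra Γ n)) :=
  rfl

/-- The comultiplication of the quantum permutation group on `n` points, with values in the
tensor square of the algebra of the free wreath product. -/
noncomputable def comulBase :
    (symmetric n).coeff →⋆ₐ[ℂ] WreathAlgebra Γ n ⊗[ℂ] WreathAlgebra Γ n :=
  (starTensorMap (base Γ n) (base Γ n)).comp (symmetric n).comul

theorem comulBase_u (i j : Fin n) :
    comulBase Γ n ((symmetric n).u i j) = ∑ k, p Γ n i k ⊗ₜ[ℂ] p Γ n k j := by
  have h := (symmetric n).comul_u i j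
  simp only [comulBase, StarAlgHom.comp_apply]
  rw [h, map_sum]
  rfl

theorem comulNu_mul_comulBase (i j : Fin n) (a : Γ.coeff) :
    comulNu Γ n i a * comulBase Γ n ((symmetric n).u i j)
      = ∑ k, starTensorMap (nu Γ n i) (nu Γ n k) (Γ.comul a) * (p Γ n i k ⊗ₜ[ℂ] p Γ n k j) := by
  rw [comulNu_apply, comulBase_u, Finset.sum_mul_sum]
  refine Finset.sum_congr rfl fun k _ => ?_
  rw [Finset.sum_eq_single k]
  · rw [mul_assoc, Algebra.TensorProduct.tmul_mul_tmul, one_mul, (p_magic Γ n).mul_self]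
  · intro l _ hl
    rw [mul_assoc, Algebra.TensorProduct.tmul_mul_tmul, (p_magic Γ n).row_orth i k l hl.symm,
      TensorProduct.zero_tmul, mul_zero]
  · simp

theorem comulBase_mul_comulNu (i j : Fin n) (a : Γ.coeff) :
    comulBase Γ n ((symmetric n).u i j) * comulNu Γ n i a
      = ∑ k, starTensorMap (nu Γ n i) (nu Γ n k) (Γ.comul a) * (p Γ n i k ⊗ₜ[ℂ] p Γ n k j) := by
  have hc : ∀ k l x, Commute (starTensorMap (nu Γ n i) (nu Γ n l) x)
      (p Γ n i k ⊗ₜ[ℂ] (1 : WreathAlgebra Γ n)) := fun k l x =>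
    commute_tensor Γ n i l _ _ (fun y => nu_mul_p Γ n i k y) (fun _ => Commute.one_right _) x
  have hc' : ∀ k x, Commute (starTensorMap (nu Γ n i) (nu Γ n k) x)
      (p Γ n i k ⊗ₜ[ℂ] p Γ n k j) := fun k x =>
    commute_tensor Γ n i k _ _ (fun y => nu_mul_p Γ n i k y) (fun y => nu_mul_p Γ n k j y) x
  rw [comulNu_apply, comulBase_u, Finset.sum_mul_sum]
  refine Finset.sum_congr rfl fun k _ => ?_
  rw [Finset.sum_eq_single k]
  · rw [(hc k k _).eq, ← mul_assoc, Algebra.TensorProduct.tmul_mul_tmul, mul_one,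
      (p_magic Γ n).mul_self, (hc' k _).eq]
  · intro l _ hl
    rw [(hc l l _).eq, ← mul_assoc, Algebra.TensorProduct.tmul_mul_tmul,
      (p_magic Γ n).row_orth i k l hl.symm, TensorProduct.zero_tmul, zero_mul]
  · simp

end Wreath

/-- The wreath product of `Γ` by the quantum permutation group on `n` points. -/
noncomputable def wreath (Γ : QuantumPermutationGroup) (n : ℕ) [NeZero n] :
    QuantumPermutationGroup where
  coeff := WreathAlgebra Γ n
  ι := Fin n × Γ.ι
  u := Wreath.w Γ n
  magic := Wreath.w_magic Γ n
  generated := Wreath.w_generated Γ n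
  comul := Wreath.lift Γ n (Wreath.comulNu Γ n) (Wreath.comulBase Γ n) fun i j a =>
    (Wreath.comulNu_mul_comulBase Γ n i j a).trans (Wreath.comulBase_mul_comulNu Γ n i j a).symm
  comul_u := by
    rintro ⟨i, k⟩ ⟨j, l⟩
    have h : Wreath.w Γ n (i, k) (j, l)
      = Wreath.nu Γ n i (Γ.u k l) * Wreath.base Γ n ((symmetric n).u i j) := rfl
    rw [h, map_mul, Wreath.lift_nu, Wreath.lift_base, Wreath.comulNu_mul_comulBase,
      Fintype.sum_prod_type, Γ.comul_u]
    simp only [map_sum, starTensorMap_tmul, Finset.sum_mul, Algebra.TensorProduct.tmul_mul_tmul]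
    rfl

/-! ## Families of quantum permutation groups -/

/-- A family of quantum permutation groups, understood up to isomorphism of quantum groups, is
Jordan closed if it contains the trivial quantum group and is stable by free products and by
wreath products with the quantum permutation groups on `n ≥ 1` points. -/
structure IsJordanClosed (F : Set QuantumPermutationGroup) : Prop where
  of_isomorphic : ∀ Γ Λ : QuantumPermutationGroup, Isomorphic Γ Λ → Γ ∈ F → Λ ∈ F
  trivialGroup_mem : trivialGroup ∈ F
  freeProduct_mem : ∀ Γ ∈ F, ∀ Λ ∈ F, freeProduct Γ Λ ∈ F
  wreath_mem : ∀ Γ ∈ F, ∀ (n : ℕ) [NeZero n], wreath Γ n ∈ F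

/-- The family of the quantum groups isomorphic to the quantum automorphism group of a finite
graph of the class `P`. -/
def quantumAutFamily (P : ∀ V : Type, SimpleGraph V → Prop) : Set QuantumPermutationGroup :=
  {Γ | ∃ (V : Type) (_ : Fintype V) (_ : Nonempty V) (G : SimpleGraph V),
    P V G ∧ Isomorphic (ofGraph G) Γ}

end QuantumPermutationGroup

/-! ## Tree-cographs -/

/-- The class of tree-cographs: the smallest class of finite graphs, closed under isomorphism,
which contains all finite trees and is stable by taking disjoint sums and complements. -/
inductive IsTreeCograph : ∀ V : Type, SimpleGraph V → Prop
  | tree (V : Type) [Finite V] (G : SimpleGraph V) : G.IsTree → IsTreeCograph V G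
  | sum (V W : Type) (G : SimpleGraph V) (H : SimpleGraph W) :
      IsTreeCograph V G → IsTreeCograph W H → IsTreeCograph (V ⊕ W) (G.sum H)
  | compl (V : Type) (G : SimpleGraph V) : IsTreeCograph V G → IsTreeCograph V Gᶜ
  | iso (V W : Type) (G : SimpleGraph V) (H : SimpleGraph W) :
      Nonempty (G ≃g H) → IsTreeCograph V G → IsTreeCograph W H

/-! Graphs are replaced by colourings `c : V → V → κ` of pairs of points, and magic unitaries by
matrices `u` between two colourings with `u x y * u x' y' = 0` whenever the colours of `(x, x')` and
`(y, y')` differ (`ColorIso`). A magic unitary commutes with an adjacency matrix exactly when it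
preserves adjacency in this sense (`IsMagic.commute_adjMatrix_iff`), and a colouring may be
exchanged for another one that forces the same products to vanish.

Tree-cographs lie in every Jordan closed family. Fix a colour `α` and join the distinct points whose
colour is not `α`. A quantum isomorphism permutes the connected components in the quantum sense, and
each of its blocks is a quantum isomorphism of two components, over a smaller unit. If quantum
isomorphic colourings of the class are isomorphic (`IsRigid`), the blocks between non-isomorphic
components vanish. So a decomposable colouring gives a wreath product by `S_n^+` if its `n`
components are all isomorphic, and a free product otherwise (`ofColoring_mem_of_isRigid`). Rigidity
follows from the same decomposition, by counting components (`IsHereditary.isRigid`). Only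
colourings that no colour disconnects remain. For adjacency, the two colour graphs are the graph and
its complement, and an indecomposable tree-cograph is a tree or the complement of a tree. For a
tree, adjacency is traded for the sum of the two eccentricities minus the distance. Quantum
isomorphisms preserve this quantity, it determines adjacency, and it is ultrametric by the
four-point condition. Its least colour disconnects any ultrametric colouring with several points, so
the decomposition ends with single points and the trivial group.

Conversely, rooted trees, coloured by depth and adjacency, form a Jordan closed family. Grafting a
tree on the root of a tree that is not higher gives the free product (`graft_qaut`), and hanging `n`
copies under a new root gives the wreath product (`bouquet_isomorphic`). Adding a stem, or grafting
long paths at the root, only adds trivial free factors. The stem provides the height needed for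
grafting. The paths make the root the unique vertex of largest degree, so that the rooted tree and
its underlying tree have the same quantum group. -/

/-! ## Quantum isomorphisms of coloured structures -/

/-- A quantum isomorphism between the colourings `c` and `d` of pairs of points, with values in a
ring, and with row and column sums equal to `e`. -/
structure ColorIso {V W κ A : Type} [Fintype V] [Fintype W] [Ring A] (e : A)
    (c : V → V → κ) (d : W → W → κ) (u : V → W → A) : Prop where
  mul_self : ∀ x y, u x y * u x y = u x y
  row_sum : ∀ x, ∑ y, u x y = e
  col_sum : ∀ y, ∑ x, u x y = e
  row_orth : ∀ x y y', y ≠ y' → u x y * u x y' = 0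
  col_orth : ∀ x x' y, x ≠ x' → u x y * u x' y = 0
  rel : ∀ x y x' y', c x x' ≠ d y y' → u x y * u x' y' = 0

namespace ColorIso

variable {V W κ A : Type} [Fintype V] [Fintype W] [Ring A] {e : A}
  {c : V → V → κ} {d : W → W → κ} {u : V → W → A}

theorem transpose (h : ColorIso e c d u) : ColorIso e d c (fun y x => u x y) where
  mul_self y x := h.mul_self x y
  row_sum := h.col_sum
  col_sum := h.row_sum
  row_orth y x x' hx := h.col_orth x x' y hx
  col_orth y y' x hy := h.row_orth x y y' hy
  rel y x y' x' hc := h.rel x y x' y' hc.symm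

theorem of_rel (h : ColorIso e c d u) {κ' : Type} {c' : V → V → κ'} {d' : W → W → κ'}
    (hrel : ∀ x y x' y', c' x x' ≠ d' y y' → u x y * u x' y' = 0) : ColorIso e c' d' u :=
  { h with rel := hrel }

theorem sum_ite_row (h : ColorIso e c d u) (x : V) (y : W) (s : Finset W) (hy : y ∈ s) :
    u x y * ∑ y' ∈ s, u x y' = u x y := by
  rw [Finset.mul_sum, Finset.sum_eq_single y (fun b _ hb => h.row_orth x y b hb.symm)
    (fun hn => (hn hy).elim), h.mul_self]

/-- The common sum `e` acts on the entries as a unit, in place of `1`. This generality keeps the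
notion stable under restriction to a pair of components, where the sum of a block is only an
idempotent. -/
theorem mul_unit (h : ColorIso e c d u) (x : V) (y : W) : u x y * e = u x y := by
  rw [← h.row_sum x]
  exact h.sum_ite_row x y _ (Finset.mem_univ y)

theorem unit_mul (h : ColorIso e c d u) (x : V) (y : W) : e * u x y = u x y := by
  rw [← h.row_sum x, Finset.sum_mul, Finset.sum_eq_single y (fun b _ hb => h.row_orth x b y hb)
    (by simp), h.mul_self]

theorem diag (h : ColorIso e c d u) {x : V} {y : W} (hxy : c x x ≠ d y y) : u x y = 0 := by
  rw [← h.mul_self]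
  exact h.rel _ _ _ _ hxy

/-- To check that a product vanishes, one may insert all the entries of a row. -/
theorem mul_eq_zero_of_row (h : ColorIso e c d u) (z : V) {a : A} {x : V} {y : W}
    (hz : ∀ w, a * (u z w * u x y) = 0) : a * u x y = 0 := by
  rw [← h.unit_mul x y, ← h.row_sum z, Finset.sum_mul, Finset.mul_sum]
  exact Finset.sum_eq_zero fun w _ => hz w

theorem eq_zero_of_row (h : ColorIso e c d u) (z : V) {x : V} {y : W}
    (hz : ∀ w, u z w * u x y = 0) : u x y = 0 := by
  rw [← h.unit_mul x y, ← h.row_sum z, Finset.sum_mul]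
  exact Finset.sum_eq_zero fun w _ => hz w

theorem eq_zero_of_row' (h : ColorIso e c d u) (z : V) {x : V} {y : W}
    (hz : ∀ w, u x y * u z w = 0) : u x y = 0 := by
  rw [← h.mul_unit x y, ← h.row_sum z, Finset.mul_sum]
  exact Finset.sum_eq_zero fun w _ => hz w

/-- Walks are preserved by quantum isomorphisms which preserve adjacency. -/
theorem mul_eq_zero_of_walk (h : ColorIso e c d u) {G : SimpleGraph V} {H : SimpleGraph W}
    (hadj : ∀ x y x' y', G.Adj x x' → ¬ H.Adj y y' → u x y * u x' y' = 0)
    {x x' : V} (p : G.Walk x x') {y y' : W} (hq : ∀ q : H.Walk y y', q.length ≠ p.length) :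
    u x y * u x' y' = 0 := by
  induction p generalizing y with
  | nil =>
    refine h.row_orth _ _ _ ?_
    rintro rfl
    exact hq SimpleGraph.Walk.nil rfl
  | @cons x z x' hxz p ih =>
    -- The row of `z` is inserted. A term vanishes by adjacency unless `w` is a neighbour of `y`,
    -- and then by induction on the rest of the walk.
    refine h.mul_eq_zero_of_row z fun w => ?_
    by_cases hyw : H.Adj y w
    · rw [ih fun q hql => hq (SimpleGraph.Walk.cons hyw q) (by simp [hql]), mul_zero]
    · rw [← mul_assoc, hadj _ _ _ _ hxz hyw, zero_mul]

theorem mul_eq_zero_of_reachable (h : ColorIso e c d u) {G : SimpleGraph V} {H : SimpleGraph W}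
    (hadj : ∀ x y x' y', G.Adj x x' → ¬ H.Adj y y' → u x y * u x' y' = 0)
    {x x' : V} {y y' : W} (hx : G.Reachable x x') (hy : ¬ H.Reachable y y') :
    u x y * u x' y' = 0 := by
  obtain ⟨p⟩ := hx
  exact h.mul_eq_zero_of_walk hadj p fun q => (hy ⟨q⟩).elim

theorem unit_mul_unit [Nonempty V] (h : ColorIso e c d u) : e * e = e := by
  obtain ⟨x⟩ := ‹Nonempty V›
  calc e * e = e * ∑ y, u x y := by rw [h.row_sum]
    _ = e := by rw [Finset.mul_sum, Finset.sum_congr rfl fun y _ => h.unit_mul x y, h.row_sum]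

end ColorIso

/-! ### Colour graphs and isomorphisms of colourings -/

/-- The graph of the pairs of distinct points whose colour is not `α`. -/
def colorGraph {V κ : Type} (c : V → V → κ) (hc : ∀ x y, c x y = c y x) (α : κ) :
    SimpleGraph V where
  Adj x y := x ≠ y ∧ c x y ≠ α
  symm := ⟨fun x y h => ⟨h.1.symm, by rw [hc]; exact h.2⟩⟩
  loopless := ⟨fun x h => h.1 rfl⟩

/-- Isomorphism of colourings. -/
def ColorEquiv {V W κ : Type} (c : V → V → κ) (d : W → W → κ) : Prop :=
  ∃ f : V ≃ W, ∀ x y, c x y = d (f x) (f y)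

theorem ColorEquiv.symm {V W κ : Type} {c : V → V → κ} {d : W → W → κ} (h : ColorEquiv c d) :
    ColorEquiv d c := by
  obtain ⟨f, hf⟩ := h
  exact ⟨f.symm, fun x y => by simp [hf]⟩

theorem ColorEquiv.trans {V W X κ : Type} {c : V → V → κ} {d : W → W → κ} {b : X → X → κ}
    (h : ColorEquiv c d) (h' : ColorEquiv d b) : ColorEquiv c b := by
  obtain ⟨f, hf⟩ := h
  obtain ⟨g, hg⟩ := h'
  exact ⟨f.trans g, fun x y => by simp [hf, hg]⟩

theorem ColorEquiv.refl {V κ : Type} (c : V → V → κ) : ColorEquiv c c :=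
  ⟨Equiv.refl V, fun _ _ => rfl⟩

/-- Two functions whose fibres have the same cardinalities differ by a bijection. -/
theorem exists_equiv_of_card_fiber_eq {X Y : Type} {T : Type*} [Finite X] [Finite Y]
    (f : X → T) (g : Y → T)
    (h : ∀ t, Nat.card {x // f x = t} = Nat.card {y // g y = t}) :
    ∃ σ : X ≃ Y, ∀ x, g (σ x) = f x := by
  have he : ∀ t, Nonempty ({x // f x = t} ≃ {y // g y = t}) := fun t => Finite.card_eq.1 (h t)
  refine ⟨(Equiv.sigmaFiberEquiv f).symm.trans ((Equiv.sigmaCongrRight fun t => (he t).some).trans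
    (Equiv.sigmaFiberEquiv g)), fun x => ?_⟩
  exact ((he (f x)).some ⟨x, rfl⟩).2

/-! ### Blocks of a quantum isomorphism -/

section blocks

variable {V W κ A : Type} [Fintype V] [Fintype W] [Ring A] {e : A}
  {c : V → V → κ} {d : W → W → κ} {u : V → W → A}
  {hc : ∀ x y, c x y = c y x} {hd : ∀ x y, d x y = d y x} {α : κ}

/-- The restriction of a colouring to a set of points. -/
abbrev restrictColor (c : V → V → κ) (p : V → Prop) : {x // p x} → {x // p x} → κ :=
  fun x y => c x.1 y.1

namespace ColorIso

/-- An edge of one colour graph facing a non-edge of the other gives a vanishing product: by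
orthogonality if the non-edge is a repeated point, and otherwise because exactly one of the two
colours is `α`. Walks propagate this to components. -/
theorem mul_eq_zero_of_color (h : ColorIso e c d u) {x x' : V} {y y' : W}
    (hx : (colorGraph c hc α).Reachable x x') (hy : ¬ (colorGraph d hd α).Reachable y y') :
    u x y * u x' y' = 0 := by
  refine h.mul_eq_zero_of_reachable (fun x y x' y' h1 h2 => ?_) hx hy
  by_cases hyy : y = y'
  · subst hyy
    exact h.col_orth _ _ _ h1.1
  · refine h.rel _ _ _ _ fun hcd => h1.2 ?_
    by_contra hne
    exact h2 ⟨hyy, fun hα => hne (hcd.trans hα)⟩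

open scoped Classical in
/-- The sum of a row of a block is the sum of any column of this block. -/
theorem block_sum (h : ColorIso e c d u) (x : V) (y : W) :
    ∑ y' with (colorGraph d hd α).Reachable y y', u x y'
      = ∑ x' with (colorGraph c hc α).Reachable x x', u x' y := by
  set R : A := ∑ y' with (colorGraph d hd α).Reachable y y', u x y' with hR
  set K : A := ∑ x' with (colorGraph c hc α).Reachable x x', u x' y with hK
  -- Both sums equal `R * K`. Completing `K` to a full column only adds terms with `y'` in the
  -- component of `y` and `x'` outside that of `x`, which vanish; completing `R` to a full row is
  -- symmetric.
  have h1 : R * K = R := by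
    have : R * e = R * K := by
      rw [← h.col_sum y, hR, hK, Finset.sum_mul, Finset.sum_mul]
      refine Finset.sum_congr rfl fun y' hy' => ?_
      rw [Finset.mul_sum, Finset.mul_sum, ← Finset.sum_filter_add_sum_filter_not Finset.univ
        (fun x' => (colorGraph c hc α).Reachable x x'), add_eq_left]
      refine Finset.sum_eq_zero fun x' hx' => ?_
      simp only [Finset.mem_filter, Finset.mem_univ, true_and] at hx' hy'
      exact h.transpose.mul_eq_zero_of_color (hc := hd) (hd := hc) hy'.symm hx'
    rw [← this, hR, Finset.sum_mul]
    exact Finset.sum_congr rfl fun y' _ => h.mul_unit _ _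
  have h2 : R * K = K := by
    have : e * K = R * K := by
      rw [← h.row_sum x, hR, hK, Finset.mul_sum, Finset.mul_sum]
      refine Finset.sum_congr rfl fun x' hx' => ?_
      rw [Finset.sum_mul, Finset.sum_mul, ← Finset.sum_filter_add_sum_filter_not Finset.univ
        (fun y' => (colorGraph d hd α).Reachable y y'), add_eq_left]
      refine Finset.sum_eq_zero fun y' hy' => ?_
      simp only [Finset.mem_filter, Finset.mem_univ, true_and] at hx' hy'
      exact h.mul_eq_zero_of_color (hc := hc) (hd := hd) hx' fun hr => hy' hr.symm
    rw [← this, hK, Finset.mul_sum]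
    exact Finset.sum_congr rfl fun y' _ => h.unit_mul _ _
  exact h1.symm.trans h2

open scoped Classical in
/-- The sum of the entries of the block of two components. -/
noncomputable def block (u : V → W → A) (C : (colorGraph c hc α).ConnectedComponent)
    (D : (colorGraph d hd α).ConnectedComponent) : A :=
  ∑ y with (colorGraph d hd α).connectedComponentMk y = D, u C.out y

-- Row and column sums agree in a block, so the block sum can be read off any column. With the next
-- lemma, it does not depend on the representative `C.out`.
open scoped Classical in
theorem block_eq_col (h : ColorIso e c d u) (C : (colorGraph c hc α).ConnectedComponent) (y : W) :
    block u C ((colorGraph d hd α).connectedComponentMk y)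
      = ∑ x with (colorGraph c hc α).connectedComponentMk x = C, u x y := by
  have := h.block_sum (hc := hc) (hd := hd) (α := α) C.out y
  simp only [← SimpleGraph.ConnectedComponent.eq] at this
  have hC : (colorGraph c hc α).connectedComponentMk C.out = C := Quot.out_eq C
  simpa only [block, eq_comm, hC] using this

open scoped Classical in
theorem block_eq_row (h : ColorIso e c d u) (x : V) (D : (colorGraph d hd α).ConnectedComponent) :
    block u ((colorGraph c hc α).connectedComponentMk x) D
      = ∑ y with (colorGraph d hd α).connectedComponentMk y = D, u x y := by
  induction D using SimpleGraph.ConnectedComponent.ind with | h y => ?_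
  rw [h.block_eq_col]
  have := h.block_sum (hc := hc) (hd := hd) (α := α) x y
  simp only [← SimpleGraph.ConnectedComponent.eq] at this
  simpa only [eq_comm] using this.symm

/-- The restriction of a quantum isomorphism to a pair of components. -/
theorem restrict_block (h : ColorIso e c d u) (C : (colorGraph c hc α).ConnectedComponent)
    (D : (colorGraph d hd α).ConnectedComponent)
    [Fintype {x // (colorGraph c hc α).connectedComponentMk x = C}]
    [Fintype {y // (colorGraph d hd α).connectedComponentMk y = D}] :
    ColorIso (block u C D)
      (restrictColor c fun x => (colorGraph c hc α).connectedComponentMk x = C)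
      (restrictColor d fun y => (colorGraph d hd α).connectedComponentMk y = D)
      (fun x y => u x.1 y.1) where
  mul_self x y := h.mul_self _ _
  row_sum := by
    classical
    rintro ⟨x, rfl⟩
    rw [h.block_eq_row]
    exact (Finset.sum_subtype _ (by simp) (fun y => u x y)).symm
  col_sum := by
    classical
    rintro ⟨y, rfl⟩
    rw [h.block_eq_col]
    exact (Finset.sum_subtype _ (by simp) (fun x => u x y)).symm
  row_orth x y y' hy := h.row_orth _ _ _ fun hn => hy (Subtype.ext hn)
  col_orth x x' y hy := h.col_orth _ _ _ fun hn => hy (Subtype.ext hn)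
  rel x y x' y' hr := h.rel _ _ _ _ hr

/-- An entry is absorbed by the sum of its row in its block, hence vanishes with it. -/
theorem eq_zero_of_block (h : ColorIso e c d u) {x : V} {y : W}
    (hb : block u ((colorGraph c hc α).connectedComponentMk x)
      ((colorGraph d hd α).connectedComponentMk y) = 0) : u x y = 0 := by
  classical
  rw [h.block_eq_row] at hb
  have := h.sum_ite_row x y {y' | (colorGraph d hd α).connectedComponentMk y'
    = (colorGraph d hd α).connectedComponentMk y} (by simp)
  rw [← this, hb, mul_zero]

open scoped Classical in
theorem sum_block_row (h : ColorIso e c d u) (C : (colorGraph c hc α).ConnectedComponent)  :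
    ∑ D : (colorGraph d hd α).ConnectedComponent, block u C D = e := by
  rw [← h.row_sum C.out]
  exact Finset.sum_fiberwise _ _ _

open scoped Classical in
theorem sum_block_col (h : ColorIso e c d u) (D : (colorGraph d hd α).ConnectedComponent)  :
    ∑ C : (colorGraph c hc α).ConnectedComponent, block u C D = e := by
  induction D using SimpleGraph.ConnectedComponent.ind with | h y => ?_
  rw [← h.col_sum y]
  simp only [h.block_eq_col]
  exact Finset.sum_fiberwise _ _ _

/-- Characteristic zero allows multiples of a nonzero element to be counted. Cardinality arguments
thus work in noncommutative algebras without any trace or character. -/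
theorem _root_.card_eq_of_nsmul_eq [Algebra ℂ A] {a : A} (ha : a ≠ 0) {m n : ℕ}
    (h : m • a = n • a) : m = n := by
  have h' : ((m : ℂ) - n) • a = 0 := by
    rw [sub_smul, Nat.cast_smul_eq_nsmul, Nat.cast_smul_eq_nsmul, h, sub_self]
  rcases smul_eq_zero.1 h' with h' | h'
  · exact_mod_cast sub_eq_zero.1 h'
  · exact (ha h').elim

/-- Gluing lemma: if the components which are linked by a quantum isomorphism are isomorphic, then
so are the colourings. -/
theorem colorEquiv_of_components [Algebra ℂ A] (h : ColorIso e c d u) (he : e ≠ 0)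
    (hcomp : ∀ (C : (colorGraph c hc α).ConnectedComponent)
      (D : (colorGraph d hd α).ConnectedComponent), block u C D ≠ 0 →
      ColorEquiv (restrictColor c fun x => (colorGraph c hc α).connectedComponentMk x = C)
        (restrictColor d fun y => (colorGraph d hd α).connectedComponentMk y = D)) :
    ColorEquiv c d := by
  classical
  let X := (colorGraph c hc α).ConnectedComponent
  let Y := (colorGraph d hd α).ConnectedComponent
  let rc (C : X) := restrictColor c fun x => (colorGraph c hc α).connectedComponentMk x = C
  let rd (D : Y) := restrictColor d fun x => (colorGraph d hd α).connectedComponentMk x = D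
  let T := Σ S : Type, S → S → κ
  let st : Setoid T := ⟨fun a b => ColorEquiv a.2 b.2, fun a => ColorEquiv.refl _,
    fun h => h.symm, fun h h' => h.trans h'⟩
  let f : X → Quotient st := fun C => Quotient.mk st ⟨_, rc C⟩
  let g : Y → Quotient st := fun D => Quotient.mk st ⟨_, rd D⟩
  have hfg : ∀ C D, f C ≠ g D → block u C D = 0 := fun C D hCD => by
    by_contra hne
    exact hCD (Quotient.sound (hcomp C D hne))
  -- Only components of the same isomorphism type are linked. So the blocks between components of
  -- type `t` sum to `e` times the number of these components on either side, and each type occurs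
  -- equally often in both.
  obtain ⟨σ, hσ⟩ : ∃ σ : X ≃ Y, ∀ x, g (σ x) = f x := by
    refine exists_equiv_of_card_fiber_eq f g fun t => card_eq_of_nsmul_eq he ?_
    rw [Nat.card_eq_fintype_card, Nat.card_eq_fintype_card, Fintype.card_subtype,
      Fintype.card_subtype, ← Finset.sum_const, ← Finset.sum_const]
    calc ∑ C with f C = t, e = ∑ C with f C = t, ∑ D : Y, block u C D :=
          Finset.sum_congr rfl fun C _ => by convert (h.sum_block_row C).symm
      _ = ∑ C with f C = t, ∑ D with g D = t, block u C D := by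
          refine Finset.sum_congr rfl fun C hC => ?_
          symm
          refine Finset.sum_subset (Finset.subset_univ _) fun D _ hD => hfg C D ?_
          simp only [Finset.mem_filter, Finset.mem_univ, true_and] at hC hD
          rw [hC]; exact fun h => hD h.symm
      _ = ∑ D with g D = t, ∑ C with f C = t, block u C D := Finset.sum_comm
      _ = ∑ D with g D = t, ∑ C : X, block u C D := by
          refine Finset.sum_congr rfl fun D hD => ?_
          refine Finset.sum_subset (Finset.subset_univ _) fun C _ hC => hfg C D ?_
          simp only [Finset.mem_filter, Finset.mem_univ, true_and] at hC hD
          rw [hD]; exact hC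
      _ = ∑ D with g D = t, e :=
          Finset.sum_congr rfl fun D _ => by convert h.sum_block_col D
  have hε : ∀ C : X, ColorEquiv (rc C) (rd (σ C)) := fun C => Quotient.exact (hσ C).symm
  choose ε hε using hε
  let τ : V ≃ W := (Equiv.sigmaFiberEquiv (colorGraph c hc α).connectedComponentMk).symm.trans
    ((Equiv.sigmaCongr σ ε).trans
      (Equiv.sigmaFiberEquiv (colorGraph d hd α).connectedComponentMk))
  have hτ : ∀ x, τ x = (ε ((colorGraph c hc α).connectedComponentMk x) ⟨x, rfl⟩).1 :=
    fun x => rfl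
  have hτ' : ∀ x C (hC : (colorGraph c hc α).connectedComponentMk x = C),
      τ x = (ε C ⟨x, hC⟩).1 := by rintro x C rfl; exact hτ x
  have hmk : ∀ x, (colorGraph d hd α).connectedComponentMk (τ x)
      = σ ((colorGraph c hc α).connectedComponentMk x) := fun x => (ε _ ⟨x, rfl⟩).2
  -- Inside a component the isomorphism `ε` preserves colours; between distinct components both
  -- colours are `α`.
  refine ⟨τ, fun x y => ?_⟩
  by_cases hxy : (colorGraph c hc α).connectedComponentMk x
      = (colorGraph c hc α).connectedComponentMk y
  · rw [hτ' x _ hxy, hτ y]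
    exact hε _ ⟨x, hxy⟩ ⟨y, rfl⟩
  · have h1 : c x y = α := by
      by_contra hne
      exact hxy (SimpleGraph.ConnectedComponent.sound
        (SimpleGraph.Adj.reachable ⟨fun e => hxy (by rw [e]), hne⟩))
    have h2 : d (τ x) (τ y) = α := by
      by_contra hne
      refine hxy (σ.injective ?_)
      rw [← hmk, ← hmk]
      exact SimpleGraph.ConnectedComponent.sound
        (SimpleGraph.Adj.reachable ⟨fun e => hxy (by rw [τ.injective e]), hne⟩)
    rw [h1, h2]

end ColorIso

end blocks

/-! ### Rigid and hereditary classes -/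

/-- Two colourings of a rigid class which are quantum isomorphic are isomorphic. -/
def IsRigid {κ : Type} (P : ∀ V : Type, (V → V → κ) → Prop) : Prop :=
  ∀ (V W A : Type) [Fintype V] [Fintype W] [Ring A] [Algebra ℂ A] (e : A) (c : V → V → κ)
    (d : W → W → κ) (u : V → W → A), P V c → P W d → e ≠ 0 → ColorIso e c d u → ColorEquiv c d

/-- A class of symmetric colourings closed under restriction. -/
structure IsHereditary {κ : Type} (P : ∀ V : Type, (V → V → κ) → Prop) : Prop where
  symm : ∀ {V c}, P V c → ∀ x y, c x y = c y x
  restrict : ∀ {V c}, P V c → ∀ {S : Type} (f : S → V), Function.Injective f →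
    P S (fun x y => c (f x) (f y))

theorem card_component_lt {V : Type} [Fintype V] {G : SimpleGraph V} (hG : ¬ G.Preconnected)
    (C : G.ConnectedComponent) [Fintype {x // G.connectedComponentMk x = C}] :
    Fintype.card {x // G.connectedComponentMk x = C} < Fintype.card V := by
  obtain ⟨x, hx⟩ : ∃ x, G.connectedComponentMk x ≠ C := by
    by_contra! hall
    exact hG fun x y => SimpleGraph.ConnectedComponent.exact ((hall x).trans (hall y).symm)
  exact Fintype.card_subtype_lt hx

/-- Induction on the number of points. If some colour disconnects `c`, each nonzero block is a
quantum isomorphism from a strictly smaller colouring of the class, with the block sum as its unit,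
and the gluing lemma concludes. Indecomposability is therefore only needed for `c`, not for `d`. -/
theorem IsHereditary.isRigid {κ : Type} {P : ∀ V : Type, (V → V → κ) → Prop}
    (hP : IsHereditary P)
    (hbase : ∀ (V W A : Type) [Fintype V] [Fintype W] [Ring A] [Algebra ℂ A] (e : A)
      (c : V → V → κ) (d : W → W → κ) (u : V → W → A) (hc : P V c), P W d → e ≠ 0 →
      (∀ α, (colorGraph c (hP.symm hc) α).Preconnected) → ColorIso e c d u → ColorEquiv c d) :
    IsRigid P := by
  intro V W A _ _ _ _ e c d u hc hd he h
  obtain ⟨n, hn⟩ : ∃ n, Fintype.card V = n := ⟨_, rfl⟩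
  induction n using Nat.strong_induction_on generalizing V W e with | _ n ih => ?_
  by_cases hconn : ∀ α, (colorGraph c (hP.symm hc) α).Preconnected
  · exact hbase V W A e c d u hc hd he hconn h
  · push Not at hconn
    obtain ⟨α, hα⟩ := hconn
    classical
    refine h.colorEquiv_of_components (hc := hP.symm hc) (hd := hP.symm hd) (α := α) he
      fun C D hCD => ?_
    exact ih _ (hn ▸ card_component_lt hα C) _ _ _ _ _ _ (hP.restrict hc _ Subtype.val_injective)
      (hP.restrict hd _ Subtype.val_injective) hCD (h.restrict_block C D) rfl

/-! ## Isomorphisms of quantum permutation groups -/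

@[simp] theorem starTensorMap_id {A B : Type}
    [Ring A] [Algebra ℂ A] [StarRing A] [StarModule ℂ A]
    [Ring B] [Algebra ℂ B] [StarRing B] [StarModule ℂ B] (x : A ⊗[ℂ] B) :
    starTensorMap (StarAlgHom.id ℂ A) (StarAlgHom.id ℂ B) x = x := by
  induction x using TensorProduct.induction_on with
  | zero => simp
  | tmul a b => simp
  | add x y hx hy => rw [map_add, hx, hy]

theorem starTensorMap_comp {A A' A'' B B' B'' : Type}
    [Ring A] [Algebra ℂ A] [StarRing A] [StarModule ℂ A]
    [Ring A'] [Algebra ℂ A'] [StarRing A'] [StarModule ℂ A']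
    [Ring A''] [Algebra ℂ A''] [StarRing A''] [StarModule ℂ A'']
    [Ring B] [Algebra ℂ B] [StarRing B] [StarModule ℂ B]
    [Ring B'] [Algebra ℂ B'] [StarRing B'] [StarModule ℂ B']
    [Ring B''] [Algebra ℂ B''] [StarRing B''] [StarModule ℂ B'']
    (f : A →⋆ₐ[ℂ] A') (f' : A' →⋆ₐ[ℂ] A'') (g : B →⋆ₐ[ℂ] B') (g' : B' →⋆ₐ[ℂ] B'')
    (x : A ⊗[ℂ] B) :
    starTensorMap f' g' (starTensorMap f g x) = starTensorMap (f'.comp f) (g'.comp g) x := by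
  induction x using TensorProduct.induction_on with
  | zero => simp
  | tmul a b => simp
  | add x y hx hy => simp only [map_add, hx, hy]

namespace QuantumPermutationGroup

theorem coeff_hom_ext (Γ : QuantumPermutationGroup) {B : Type} [Ring B] [Algebra ℂ B] [StarRing B]
    [StarModule ℂ B] {f g : Γ.coeff →⋆ₐ[ℂ] B} (h : ∀ i j, f (Γ.u i j) = g (Γ.u i j)) : f = g :=
  StarAlgHom.ext fun a => Γ.generated_le (StarAlgHom.equalizer f g) h a

/-- Two mutually inverse morphisms which intertwine the comultiplications on the generators. -/
theorem Isomorphic.of_homs {Γ Λ : QuantumPermutationGroup} (f : Γ.coeff →⋆ₐ[ℂ] Λ.coeff)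
    (g : Λ.coeff →⋆ₐ[ℂ] Γ.coeff) (hgf : ∀ a, g (f a) = a) (hfg : ∀ b, f (g b) = b)
    (hΔ : ∀ i j, Λ.comul (f (Γ.u i j)) = starTensorMap f f (Γ.comul (Γ.u i j))) :
    Isomorphic Γ Λ := by
  refine ⟨StarAlgEquiv.ofStarAlgHom f g (StarAlgHom.ext hgf) (StarAlgHom.ext hfg), fun a => ?_⟩
  have : Λ.comul.comp f = (starTensorMap f f).comp Γ.comul := coeff_hom_ext Γ hΔ
  exact DFunLike.congr_fun this a

theorem Isomorphic.exists_homs {Γ Λ : QuantumPermutationGroup} (h : Isomorphic Γ Λ) :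
    ∃ (f : Γ.coeff →⋆ₐ[ℂ] Λ.coeff) (g : Λ.coeff →⋆ₐ[ℂ] Γ.coeff),
      (∀ a, g (f a) = a) ∧ (∀ b, f (g b) = b) ∧
      (∀ a, Λ.comul (f a) = starTensorMap f f (Γ.comul a)) ∧
      ∀ b, Γ.comul (g b) = starTensorMap g g (Λ.comul b) := by
  obtain ⟨f, hf⟩ := h
  have h1 : ∀ a, (f.symm : Λ.coeff →⋆ₐ[ℂ] Γ.coeff) ((f : Γ.coeff →⋆ₐ[ℂ] Λ.coeff) a) = a :=
    f.symm_apply_apply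
  refine ⟨f, f.symm, h1, f.apply_symm_apply, hf, fun b => ?_⟩
  obtain ⟨a, rfl⟩ : ∃ a, (f : Γ.coeff →⋆ₐ[ℂ] Λ.coeff) a = b := f.surjective b
  have hfa : Λ.comul ((f : Γ.coeff →⋆ₐ[ℂ] Λ.coeff) a) = _ := hf a
  rw [hfa, starTensorMap_comp]
  have : (f.symm : Λ.coeff →⋆ₐ[ℂ] Γ.coeff).comp (f : Γ.coeff →⋆ₐ[ℂ] Λ.coeff)
      = StarAlgHom.id ℂ _ := StarAlgHom.ext h1
  rw [this, starTensorMap_id]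
  exact congrArg Γ.comul (h1 a)

theorem Isomorphic.refl (Γ : QuantumPermutationGroup) : Isomorphic Γ Γ :=
  .of_homs (StarAlgHom.id ℂ _) (StarAlgHom.id ℂ _) (fun _ => rfl) (fun _ => rfl)
    fun i j => by rw [starTensorMap_id]; rfl

theorem Isomorphic.symm {Γ Λ : QuantumPermutationGroup} (h : Isomorphic Γ Λ) :
    Isomorphic Λ Γ := by
  obtain ⟨f, g, h1, h2, -, h4⟩ := h.exists_homs
  exact .of_homs g f h2 h1 fun i j => h4 _

theorem Isomorphic.trans {Γ Λ Θ : QuantumPermutationGroup} (h : Isomorphic Γ Λ)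
    (h' : Isomorphic Λ Θ) : Isomorphic Γ Θ := by
  obtain ⟨f, g, h1, h2, h3, -⟩ := h.exists_homs
  obtain ⟨f', g', h1', h2', h3', -⟩ := h'.exists_homs
  refine .of_homs (f'.comp f) (g.comp g') (fun a => by simp [h1, h1']) (fun a => by simp [h2, h2'])
    fun i j => ?_
  rw [← starTensorMap_comp, ← h3, ← h3']; rfl

/-- Mutually inverse morphisms which exchange the entries of the magic unitaries. -/
theorem Isomorphic.of_entries {Γ Λ : QuantumPermutationGroup} (ε : Γ.ι ≃ Λ.ι)
    (f : Γ.coeff →⋆ₐ[ℂ] Λ.coeff) (g : Λ.coeff →⋆ₐ[ℂ] Γ.coeff)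
    (hf : ∀ i j, f (Γ.u i j) = Λ.u (ε i) (ε j)) (hg : ∀ i j, g (Λ.u (ε i) (ε j)) = Γ.u i j) :
    Isomorphic Γ Λ := by
  have h1 : g.comp f = StarAlgHom.id ℂ _ := coeff_hom_ext Γ fun i j => by simp [hf, hg]
  have h2 : f.comp g = StarAlgHom.id ℂ _ := coeff_hom_ext Λ fun i j => by
    obtain ⟨i, rfl⟩ := ε.surjective i
    obtain ⟨j, rfl⟩ := ε.surjective j
    simp [hf, hg]
  refine .of_homs f g (DFunLike.congr_fun h1) (DFunLike.congr_fun h2) fun i j => ?_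
  rw [hf, Λ.comul_u, Γ.comul_u, map_sum, ← ε.sum_comp]
  simp [hf]

section freeProduct

variable (Γ Λ : QuantumPermutationGroup)

/-- The first canonical morphism into the algebra of the free product. -/
noncomputable def freeInl : Γ.coeff →⋆ₐ[ℂ] (freeProduct Γ Λ).coeff :=
  FreeProduct.inl (A := Γ.coeff) (B := Λ.coeff)

/-- The second canonical morphism into the algebra of the free product. -/
noncomputable def freeInr : Λ.coeff →⋆ₐ[ℂ] (freeProduct Γ Λ).coeff :=
  FreeProduct.inr (A := Γ.coeff) (B := Λ.coeff)

variable {Γ Λ} {C : Type} [Ring C] [Algebra ℂ C] [StarRing C]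

/-- The universal property of the algebra of the free product. -/
noncomputable def freeLift [StarModule ℂ C] (f : Γ.coeff →⋆ₐ[ℂ] C) (g : Λ.coeff →⋆ₐ[ℂ] C) :
    (freeProduct Γ Λ).coeff →⋆ₐ[ℂ] C :=
  FreeProduct.lift f g

@[simp] theorem freeLift_inl [StarModule ℂ C] (f : Γ.coeff →⋆ₐ[ℂ] C) (g : Λ.coeff →⋆ₐ[ℂ] C)
    (a : Γ.coeff) : freeLift f g (freeInl Γ Λ a) = f a :=
  FreeProduct.lift_inl f g a

@[simp] theorem freeLift_inr [StarModule ℂ C] (f : Γ.coeff →⋆ₐ[ℂ] C) (g : Λ.coeff →⋆ₐ[ℂ] C)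
    (a : Λ.coeff) : freeLift f g (freeInr Γ Λ a) = g a :=
  FreeProduct.lift_inr f g a

theorem free_hom_ext {f g : (freeProduct Γ Λ).coeff →⋆ₐ[ℂ] C}
    (hl : ∀ a, f (freeInl Γ Λ a) = g (freeInl Γ Λ a))
    (hr : ∀ a, f (freeInr Γ Λ a) = g (freeInr Γ Λ a)) : f = g :=
  FreeProduct.hom_ext hl hr

theorem comul_freeInl (a : Γ.coeff) : (freeProduct Γ Λ).comul (freeInl Γ Λ a)
    = starTensorMap (freeInl Γ Λ) (freeInl Γ Λ) (Γ.comul a) :=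
  FreeProduct.lift_inl (C := FreeProduct Γ.coeff Λ.coeff ⊗[ℂ] FreeProduct Γ.coeff Λ.coeff) _ _ a

theorem comul_freeInr (a : Λ.coeff) : (freeProduct Γ Λ).comul (freeInr Γ Λ a)
    = starTensorMap (freeInr Γ Λ) (freeInr Γ Λ) (Λ.comul a) :=
  FreeProduct.lift_inr (C := FreeProduct Γ.coeff Λ.coeff ⊗[ℂ] FreeProduct Γ.coeff Λ.coeff) _ _ a

end freeProduct

theorem freeProduct_congr {Γ Γ' Λ Λ' : QuantumPermutationGroup} (h : Isomorphic Γ Γ')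
    (h' : Isomorphic Λ Λ') : Isomorphic (freeProduct Γ Λ) (freeProduct Γ' Λ') := by
  obtain ⟨f, g, h1, h2, h3, -⟩ := h.exists_homs
  obtain ⟨f', g', h1', h2', h3', -⟩ := h'.exists_homs
  let F := freeLift ((freeInl Γ' Λ').comp f) ((freeInr Γ' Λ').comp f')
  let G := freeLift ((freeInl Γ Λ).comp g) ((freeInr Γ Λ).comp g')
  have hGF : G.comp F = StarAlgHom.id ℂ _ :=
    free_hom_ext (fun a => by simp [F, G, h1]) (fun a => by simp [F, G, h1'])
  have hFG : F.comp G = StarAlgHom.id ℂ _ :=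
    free_hom_ext (fun a => by simp [F, G, h2]) (fun a => by simp [F, G, h2'])
  have hl : F.comp (freeInl Γ Λ) = (freeInl Γ' Λ').comp f := StarAlgHom.ext fun x => by simp [F]
  have hr : F.comp (freeInr Γ Λ) = (freeInr Γ' Λ').comp f' := StarAlgHom.ext fun x => by simp [F]
  have hΔ : (freeProduct Γ' Λ').comul.comp F
      = (starTensorMap F F).comp (freeProduct Γ Λ).comul := by
    refine free_hom_ext (fun a => ?_) (fun a => ?_)
    · rw [StarAlgHom.comp_apply, StarAlgHom.comp_apply, comul_freeInl, starTensorMap_comp, hl,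
        ← starTensorMap_comp, ← h3, ← comul_freeInl]
      exact congrArg _ (freeLift_inl _ _ a)
    · rw [StarAlgHom.comp_apply, StarAlgHom.comp_apply, comul_freeInr, starTensorMap_comp, hr,
        ← starTensorMap_comp, ← h3', ← comul_freeInr]
      exact congrArg _ (freeLift_inr _ _ a)
  exact .of_homs F G (DFunLike.congr_fun hGF) (DFunLike.congr_fun hFG)
    fun i j => DFunLike.congr_fun hΔ _

/-- All the elements of the algebra of the trivial quantum group are scalars. -/
theorem trivialGroup_hom_ext {C : Type} [Ring C] [Algebra ℂ C] [StarRing C]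
    (f g : trivialGroup.coeff →⋆ₐ[ℂ] C) : f = g :=
  StarAlgHom.ext fun (a : ℂ) =>
    (AlgHomClass.commutes f a).trans (AlgHomClass.commutes g a).symm

/-- `ℂ` is initial among unital algebras, so this free factor adds nothing. -/
theorem freeProduct_trivial_left (Γ : QuantumPermutationGroup) :
    Isomorphic Γ (freeProduct trivialGroup Γ) := by
  let G : (freeProduct trivialGroup Γ).coeff →⋆ₐ[ℂ] Γ.coeff :=
    freeLift (StarAlgHom.ofId ℂ Γ.coeff) (StarAlgHom.id ℂ _)
  have hFG : (freeInr trivialGroup Γ).comp G = StarAlgHom.id ℂ _ := by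
    refine free_hom_ext (fun a => ?_)
      (fun a => congrArg (freeInr trivialGroup Γ) (freeLift_inr _ _ a))
    exact DFunLike.congr_fun (trivialGroup_hom_ext
      (((freeInr trivialGroup Γ).comp G).comp (freeInl trivialGroup Γ)) (freeInl trivialGroup Γ)) a
  exact .of_homs (freeInr trivialGroup Γ) G (freeLift_inr _ _) (DFunLike.congr_fun hFG)
    fun i j => comul_freeInr _

theorem freeProduct_trivial_right (Γ : QuantumPermutationGroup) :
    Isomorphic Γ (freeProduct Γ trivialGroup) := by
  let G : (freeProduct Γ trivialGroup).coeff →⋆ₐ[ℂ] Γ.coeff :=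
    freeLift (StarAlgHom.id ℂ _) (StarAlgHom.ofId ℂ Γ.coeff)
  have hFG : (freeInl Γ trivialGroup).comp G = StarAlgHom.id ℂ _ := by
    refine free_hom_ext
      (fun a => congrArg (freeInl Γ trivialGroup) (freeLift_inl _ _ a)) (fun a => ?_)
    exact DFunLike.congr_fun (trivialGroup_hom_ext
      (((freeInl Γ trivialGroup).comp G).comp (freeInr Γ trivialGroup)) (freeInr Γ trivialGroup)) a
  exact .of_homs (freeInl Γ trivialGroup) G (freeLift_inl _ _) (DFunLike.congr_fun hFG)
    fun i j => comul_freeInl _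

section wreath

variable (Γ : QuantumPermutationGroup) (n : ℕ) [NeZero n]

/-- The canonical morphism from the `i`-th copy into the algebra of the wreath product. -/
noncomputable def wreathNu (i : Fin n) : Γ.coeff →⋆ₐ[ℂ] (wreath Γ n).coeff := Wreath.nu Γ n i

/-- The canonical morphism from the base into the algebra of the wreath product. -/
noncomputable def wreathBase : (symmetric n).coeff →⋆ₐ[ℂ] (wreath Γ n).coeff := Wreath.base Γ n

theorem wreathNu_mul_base (i j : Fin n) (a : Γ.coeff) :
    wreathNu Γ n i a * wreathBase Γ n ((symmetric n).u i j)
      = wreathBase Γ n ((symmetric n).u i j) * wreathNu Γ n i a :=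
  Wreath.nu_mul_p Γ n i j a

variable {Γ n} {C : Type} [Ring C] [Algebra ℂ C] [StarRing C]

/-- The universal property of the algebra of the wreath product. -/
noncomputable def wreathLift [StarModule ℂ C] (f : Fin n → Γ.coeff →⋆ₐ[ℂ] C)
    (g : (symmetric n).coeff →⋆ₐ[ℂ] C)
    (h : ∀ i j a, f i a * g ((symmetric n).u i j) = g ((symmetric n).u i j) * f i a) :
    (wreath Γ n).coeff →⋆ₐ[ℂ] C :=
  Wreath.lift Γ n f g h

@[simp] theorem wreathLift_nu [StarModule ℂ C] (f : Fin n → Γ.coeff →⋆ₐ[ℂ] C)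
    (g : (symmetric n).coeff →⋆ₐ[ℂ] C)
    (h : ∀ i j a, f i a * g ((symmetric n).u i j) = g ((symmetric n).u i j) * f i a) (i : Fin n)
    (a : Γ.coeff) : wreathLift f g h (wreathNu Γ n i a) = f i a :=
  Wreath.lift_nu Γ n f g h i a

@[simp] theorem wreathLift_base [StarModule ℂ C] (f : Fin n → Γ.coeff →⋆ₐ[ℂ] C)
    (g : (symmetric n).coeff →⋆ₐ[ℂ] C)
    (h : ∀ i j a, f i a * g ((symmetric n).u i j) = g ((symmetric n).u i j) * f i a)
    (a : (symmetric n).coeff) : wreathLift f g h (wreathBase Γ n a) = g a :=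
  Wreath.lift_base Γ n f g h a

theorem wreath_hom_ext {f g : (wreath Γ n).coeff →⋆ₐ[ℂ] C}
    (h : ∀ i a, f (wreathNu Γ n i a) = g (wreathNu Γ n i a))
    (h' : ∀ a, f (wreathBase Γ n a) = g (wreathBase Γ n a)) : f = g :=
  Wreath.hom_ext Γ n h h'

theorem comul_wreathNu (i : Fin n) (a : Γ.coeff) : (wreath Γ n).comul (wreathNu Γ n i a)
    = ∑ k, starTensorMap (wreathNu Γ n i) (wreathNu Γ n k) (Γ.comul a)
      * (wreathBase Γ n ((symmetric n).u i k) ⊗ₜ[ℂ] 1) :=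
  Wreath.lift_nu Γ n (C := WreathAlgebra Γ n ⊗[ℂ] WreathAlgebra Γ n) _ _
    (fun i j a => (Wreath.comulNu_mul_comulBase Γ n i j a).trans
      (Wreath.comulBase_mul_comulNu Γ n i j a).symm) i a

theorem comul_wreathBase (a : (symmetric n).coeff) : (wreath Γ n).comul (wreathBase Γ n a)
    = starTensorMap (wreathBase Γ n) (wreathBase Γ n) ((symmetric n).comul a) :=
  Wreath.lift_base Γ n (C := WreathAlgebra Γ n ⊗[ℂ] WreathAlgebra Γ n) _ _
    (fun i j a => (Wreath.comulNu_mul_comulBase Γ n i j a).trans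
      (Wreath.comulBase_mul_comulNu Γ n i j a).symm) a

end wreath

/-- The algebra of the wreath product and its comultiplication involve `Γ` only through its algebra
and comultiplication. The magic unitary, and even its size, may therefore differ between `Γ` and
`Λ`. -/
theorem wreath_congr {Γ Λ : QuantumPermutationGroup} (h : Isomorphic Γ Λ) (n : ℕ) [NeZero n] :
    Isomorphic (wreath Γ n) (wreath Λ n) := by
  obtain ⟨f, g, h1, h2, h3, -⟩ := h.exists_homs
  let F := wreathLift (fun i => (wreathNu Λ n i).comp f) (wreathBase Λ n)
      fun i j a => wreathNu_mul_base Λ n i j (f a)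
  let G := wreathLift (fun i => (wreathNu Γ n i).comp g) (wreathBase Γ n)
      fun i j a => wreathNu_mul_base Γ n i j (g a)
  have hGF : G.comp F = StarAlgHom.id ℂ _ :=
    wreath_hom_ext (fun i a => (congrArg G (wreathLift_nu _ _ _ i a)).trans
      ((wreathLift_nu _ _ _ i (f a)).trans (congrArg (wreathNu Γ n i) (h1 a))))
      (fun a => (congrArg G (wreathLift_base _ _ _ a)).trans (wreathLift_base _ _ _ a))
  have hFG : F.comp G = StarAlgHom.id ℂ _ :=
    wreath_hom_ext (fun i a => (congrArg F (wreathLift_nu _ _ _ i a)).trans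
      ((wreathLift_nu _ _ _ i (g a)).trans (congrArg (wreathNu Λ n i) (h2 a))))
      (fun a => (congrArg F (wreathLift_base _ _ _ a)).trans (wreathLift_base _ _ _ a))
  have hF : ∀ i, F.comp (wreathNu Γ n i) = (wreathNu Λ n i).comp f :=
    fun i => StarAlgHom.ext fun x => wreathLift_nu _ _ _ i x
  have hF' : F.comp (wreathBase Γ n) = wreathBase Λ n :=
    StarAlgHom.ext fun x => wreathLift_base _ _ _ x
  have hΔ : (wreath Λ n).comul.comp F = (starTensorMap F F).comp (wreath Γ n).comul := by
    refine wreath_hom_ext (fun i a => ?_) (fun a => ?_)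
    · rw [StarAlgHom.comp_apply, StarAlgHom.comp_apply, comul_wreathNu, map_sum]
      refine ((congrArg _ (DFunLike.congr_fun (hF i) a)).trans (comul_wreathNu i (f a))).trans ?_
      refine Finset.sum_congr rfl fun k _ => ?_
      rw [map_mul, starTensorMap_tmul, map_one, h3, starTensorMap_comp, starTensorMap_comp, hF, hF]
      exact congrArg (fun t => _ * (t ⊗ₜ[ℂ] (1 : (wreath Λ n).coeff)))
        (DFunLike.congr_fun hF' ((symmetric n).u i k)).symm
    · rw [StarAlgHom.comp_apply, StarAlgHom.comp_apply, comul_wreathBase, starTensorMap_comp, hF',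
        ← comul_wreathBase]
      exact congrArg _ (DFunLike.congr_fun hF' a)
  exact .of_homs F G (DFunLike.congr_fun hGF) (DFunLike.congr_fun hFG)
    fun i j => DFunLike.congr_fun hΔ _

/-! ## Quantum automorphism groups of colourings -/

/-- The relations saying that the generators preserve the colours of pairs of points. -/
inductive ColorRel {V κ : Type} (c : V → V → κ) :
    FreeStarAlgebra (V × V) → FreeStarAlgebra (V × V) → Prop
  | rel (x y x' y' : V) : c x x' ≠ c y y' →
      ColorRel c (FreeStarAlgebra.of (x, y) * FreeStarAlgebra.of (x', y')) 0

theorem gen_mul_gen_eq_zero {V κ : Type} [Fintype V] (c : V → V → κ) {x y x' y' : V}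
    (h : c x x' ≠ c y y') :
    UniversalMagic.gen (ColorRel c) x y * UniversalMagic.gen (ColorRel c) x' y' = 0 := by
  simpa [UniversalMagic.gen] using StarQuot.mk_eq (A := FreeStarAlgebra (V × V))
    (MagicRel.rel (R := ColorRel c) _ _ (ColorRel.rel x y x' y' h))

/-- The quantum automorphism group of a colouring of the pairs of points. -/
noncomputable def ofColoring {V κ : Type} [Fintype V] [Nonempty V] (c : V → V → κ) :
    QuantumPermutationGroup :=
  ofRelations V (ColorRel c) fun a b h => by
    obtain ⟨x, y, x', y', h⟩ := h
    simp only [map_mul, FreeStarAlgebra.lift_of, map_zero, tensorMul, Finset.sum_mul_sum,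
      Algebra.TensorProduct.tmul_mul_tmul]
    refine Finset.sum_eq_zero fun a _ => Finset.sum_eq_zero fun b _ => ?_
    by_cases hab : c x x' = c a b
    · exact (congrArg _ (gen_mul_gen_eq_zero c fun h' => h (hab.trans h'))).trans
        (TensorProduct.tmul_zero _ _)
    · exact (congrArg (· ⊗ₜ[ℂ] _) (gen_mul_gen_eq_zero c hab)).trans (TensorProduct.zero_tmul _ _)

theorem _root_.IsMagic.reindex {V W A : Type} [Fintype V] [Fintype W] [Ring A] [StarRing A]
    {p : Matrix W W A} (hp : IsMagic p) (ε : V ≃ W) :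
    IsMagic (fun x y : V => p (ε x) (ε y)) where
  star_eq _ _ := hp.star_eq _ _
  mul_self _ _ := hp.mul_self _ _
  row_sum i := (ε.sum_comp (p (ε i))).trans (hp.row_sum _)
  col_sum j := (ε.sum_comp fun i => p i (ε j)).trans (hp.col_sum _)
  row_orth _ _ _ h := hp.row_orth _ _ _ (ε.injective.ne h)
  col_orth _ _ _ h := hp.col_orth _ _ _ (ε.injective.ne h)

theorem _root_.IsMagic.colorIso {V κ A : Type} [Fintype V] [Ring A] [StarRing A]
    {p : Matrix V V A} (hp : IsMagic p) {c : V → V → κ}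
    (h : ∀ x y x' y', c x x' ≠ c y y' → p x y * p x' y' = 0) : ColorIso 1 c c p where
  mul_self := hp.mul_self
  row_sum := hp.row_sum
  col_sum := hp.col_sum
  row_orth := hp.row_orth
  col_orth x x' y := hp.col_orth x y x'
  rel := h

namespace ofColoring

variable {V κ : Type} [Fintype V] [Nonempty V] (c : V → V → κ)

/-- The universal magic unitary which preserves a colouring. -/
noncomputable def gen : Matrix V V (ofColoring c).coeff := (ofColoring c).u

theorem magic : IsMagic (gen c) := (ofColoring c).magic

theorem colorIso : ColorIso 1 c c (gen c) :=
  (magic c).colorIso fun _ _ _ _ h => gen_mul_gen_eq_zero c h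

variable {c} {B : Type} [Ring B] [Algebra ℂ B] [StarRing B] [StarModule ℂ B]

/-- The universal property. -/
noncomputable def lift (p : Matrix V V B) (hp : IsMagic p)
    (h : ∀ x y x' y', c x x' ≠ c y y' → p x y * p x' y' = 0) : (ofColoring c).coeff →⋆ₐ[ℂ] B :=
  UniversalMagic.lift p hp fun a b hab => by
    obtain ⟨x, y, x', y', hc⟩ := hab
    simp [h _ _ _ _ hc]

@[simp] theorem lift_gen (p : Matrix V V B) (hp : IsMagic p)
    (h : ∀ x y x' y', c x x' ≠ c y y' → p x y * p x' y' = 0) (x y : V) :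
    lift p hp h (gen c x y) = p x y :=
  UniversalMagic.lift_gen _ _ _ _ _

end ofColoring

/-- Colourings which impose the same relations on magic unitaries. -/
theorem ofColoring_isomorphic {V W κ κ' : Type} [Fintype V] [Nonempty V] [Fintype W] [Nonempty W]
    {c : V → V → κ} {d : W → W → κ'} (ε : V ≃ W)
    (h : ∀ x y x' y', c x x' ≠ c y y' →
      ofColoring.gen d (ε x) (ε y) * ofColoring.gen d (ε x') (ε y') = 0)
    (h' : ∀ x y x' y', d (ε x) (ε x') ≠ d (ε y) (ε y') →
      ofColoring.gen c x y * ofColoring.gen c x' y' = 0) :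
    Isomorphic (ofColoring c) (ofColoring d) := by
  have hd := ofColoring.magic d
  have hc := ofColoring.magic c
  let f : (ofColoring c).coeff →⋆ₐ[ℂ] (ofColoring d).coeff :=
    ofColoring.lift (fun x y => ofColoring.gen d (ε x) (ε y)) (hd.reindex ε) h
  let g : (ofColoring d).coeff →⋆ₐ[ℂ] (ofColoring c).coeff :=
    ofColoring.lift (fun x y => ofColoring.gen c (ε.symm x) (ε.symm y)) (hc.reindex ε.symm)
      fun x y x' y' hne => h' _ _ _ _ (by simpa using hne)
  refine .of_entries (Γ := ofColoring c) (Λ := ofColoring d) ε f g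
    (fun i j => ofColoring.lift_gen _ _ _ i j) fun i j => ?_
  refine (ofColoring.lift_gen _ _ _ (ε i) (ε j)).trans ?_
  exact congrArg₂ (ofColoring.gen c) (ε.symm_apply_apply i) (ε.symm_apply_apply j)

end QuantumPermutationGroup

namespace QuantumPermutationGroup

/-! ## Free products and wreath products from colourings -/

section sum

variable {V W κ κ₁ κ₂ : Type} [Fintype V] [Fintype W] [Nonempty V] [Nonempty W]
  {c : V ⊕ W → V ⊕ W → κ} {c₁ : V → V → κ₁} {c₂ : W → W → κ₂}

/-- If the universal magic unitary of a colouring is block diagonal, its quantum automorphism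
group is a free product. -/
theorem ofColoring_sum_isomorphic
    (h₁₂ : ∀ x y, ofColoring.gen c (.inl x) (.inr y) = 0)
    (h₂₁ : ∀ x y, ofColoring.gen c (.inr x) (.inl y) = 0)
    (hV : ∀ x y x' y', c₁ x x' ≠ c₁ y y' →
      ofColoring.gen c (.inl x) (.inl y) * ofColoring.gen c (.inl x') (.inl y') = 0)
    (hW : ∀ x y x' y', c₂ x x' ≠ c₂ y y' →
      ofColoring.gen c (.inr x) (.inr y) * ofColoring.gen c (.inr x') (.inr y') = 0)
    (hc₁ : ∀ x y x' y', c (.inl x) (.inl x') ≠ c (.inl y) (.inl y') →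
      ofColoring.gen c₁ x y * ofColoring.gen c₁ x' y' = 0)
    (hc₂ : ∀ x y x' y', c (.inr x) (.inr x') ≠ c (.inr y) (.inr y') →
      ofColoring.gen c₂ x y * ofColoring.gen c₂ x' y' = 0)
    (hcross : ∀ x y x' y', c (.inl x) (.inr x') ≠ c (.inl y) (.inr y') ∨
      c (.inr x') (.inl x) ≠ c (.inr y') (.inl y) →
      ofColoring.gen c₁ x y = 0 ∨ ofColoring.gen c₂ x' y' = 0) :
    Isomorphic (ofColoring c) (freeProduct (ofColoring c₁) (ofColoring c₂)) := by
  have hm := ofColoring.magic c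
  have hm₁ : IsMagic fun x y : V => ofColoring.gen c (.inl x) (.inl y) := by
    refine ⟨fun _ _ => hm.star_eq _ _, fun _ _ => hm.mul_self _ _, fun x => ?_, fun x => ?_,
      fun _ _ _ h => hm.row_orth _ _ _ (Sum.inl_injective.ne h),
      fun _ _ _ h => hm.col_orth _ _ _ (Sum.inl_injective.ne h)⟩
    · simpa [h₁₂] using hm.row_sum (.inl x)
    · simpa [h₂₁] using hm.col_sum (.inl x)
  have hm₂ : IsMagic fun x y : W => ofColoring.gen c (.inr x) (.inr y) := by
    refine ⟨fun _ _ => hm.star_eq _ _, fun _ _ => hm.mul_self _ _, fun x => ?_, fun x => ?_,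
      fun _ _ _ h => hm.row_orth _ _ _ (Sum.inr_injective.ne h),
      fun _ _ _ h => hm.col_orth _ _ _ (Sum.inr_injective.ne h)⟩
    · simpa [h₂₁] using hm.row_sum (.inr x)
    · simpa [h₁₂] using hm.col_sum (.inr x)
  let p : Matrix (V ⊕ W) (V ⊕ W) (freeProduct (ofColoring c₁) (ofColoring c₂)).coeff :=
    (freeProduct (ofColoring c₁) (ofColoring c₂)).u
  have hp : IsMagic p := (freeProduct (ofColoring c₁) (ofColoring c₂)).magic
  have p₁₁ : ∀ x y, p (.inl x) (.inl y) = freeInl _ _ (ofColoring.gen c₁ x y) := fun _ _ => rfl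
  have p₂₂ : ∀ x y, p (.inr x) (.inr y) = freeInr _ _ (ofColoring.gen c₂ x y) := fun _ _ => rfl
  have p₁₂ : ∀ x y, p (.inl x) (.inr y) = 0 := fun _ _ => rfl
  have p₂₁ : ∀ x y, p (.inr x) (.inl y) = 0 := fun _ _ => rfl
  let f : (ofColoring c).coeff →⋆ₐ[ℂ] (freeProduct (ofColoring c₁) (ofColoring c₂)).coeff :=
    ofColoring.lift p hp fun x y x' y' h => by
      rcases x with x | x <;> rcases y with y | y
      · rcases x' with x' | x' <;> rcases y' with y' | y'
        · rw [p₁₁, p₁₁, ← map_mul, hc₁ _ _ _ _ h, map_zero]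
        · rw [p₁₂, mul_zero]
        · rw [p₂₁, mul_zero]
        -- No relation links the two free factors, so the product has to vanish through one of its
        -- entries: this is the role of `hcross`.
        · rw [p₁₁, p₂₂]
          rcases hcross _ _ _ _ (Or.inl h) with h | h <;> simp [h]
      · rw [p₁₂, zero_mul]
      · rw [p₂₁, zero_mul]
      · rcases x' with x' | x' <;> rcases y' with y' | y'
        · rw [p₁₁, p₂₂]
          rcases hcross _ _ _ _ (Or.inr h) with h | h <;> simp [h]
        · rw [p₁₂, mul_zero]
        · rw [p₂₁, mul_zero]
        · rw [p₂₂, p₂₂, ← map_mul, hc₂ _ _ _ _ h, map_zero]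
  let g : (freeProduct (ofColoring c₁) (ofColoring c₂)).coeff →⋆ₐ[ℂ] (ofColoring c).coeff :=
    freeLift (ofColoring.lift _ hm₁ hV) (ofColoring.lift _ hm₂ hW)
  have hg : ∀ i j, g (p i j) = ofColoring.gen c i j := by
    rintro (i | i) (j | j)
    · rw [p₁₁]; exact (freeLift_inl _ _ _).trans (ofColoring.lift_gen _ _ _ _ _)
    · rw [p₁₂, map_zero, h₁₂]
    · rw [p₂₁, map_zero, h₂₁]
    · rw [p₂₂]; exact (freeLift_inr _ _ _).trans (ofColoring.lift_gen _ _ _ _ _)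
  exact .of_entries (Γ := ofColoring c) (Λ := freeProduct (ofColoring c₁) (ofColoring c₂))
    (Equiv.refl (V ⊕ W)) f g (fun i j => ofColoring.lift_gen _ _ _ i j) hg

end sum

section wreath

variable {V κ κ₀ : Type} [Fintype V] [Nonempty V] {n : ℕ} [NeZero n]
  {c : Fin n × V → Fin n × V → κ} {c₀ : V → V → κ₀}

/-- The universal property of the quantum permutation group on `n` points. -/
noncomputable def symmetricLift {B : Type} [Ring B] [Algebra ℂ B] [StarRing B] [StarModule ℂ B]
    (p : Matrix (Fin n) (Fin n) B) (hp : IsMagic p) : (symmetric n).coeff →⋆ₐ[ℂ] B :=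
  UniversalMagic.lift p hp fun _ _ h => h.elim

theorem symmetricLift_u {B : Type} [Ring B] [Algebra ℂ B] [StarRing B] [StarModule ℂ B]
    (p : Matrix (Fin n) (Fin n) B) (hp : IsMagic p) (i j : Fin n) :
    symmetricLift p hp ((symmetric n).u i j) = p i j :=
  UniversalMagic.lift_gen _ _ _ _ _

/-- If the universal magic unitary of a colouring permutes `n` identical blocks, its quantum
automorphism group is a wreath product. -/
theorem ofColoring_wreath_isomorphic
    (h₁ : ∀ i i' j j' k k' l l', (i = i' ↔ j ≠ j') →
      ofColoring.gen c (i, k) (j, l) * ofColoring.gen c (i', k') (j', l') = 0)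
    (h₂ : ∀ i j k k' l l', c₀ k k' ≠ c₀ l l' →
      ofColoring.gen c (i, k) (j, l) * ofColoring.gen c (i, k') (j, l') = 0)
    (h₃ : ∀ i j k k' l l', c (i, k) (i, k') ≠ c (j, l) (j, l') →
      ofColoring.gen c₀ k l * ofColoring.gen c₀ k' l' = 0)
    (h₄ : ∀ i i' j j' k k' l l', i ≠ i' → j ≠ j' → c (i, k) (i', k') ≠ c (j, l) (j', l') →
      ofColoring.gen c₀ k l = 0 ∨ ofColoring.gen c₀ k' l' = 0) :
    Isomorphic (ofColoring c) (wreath (ofColoring c₀) n) := by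
  have hm := ofColoring.magic c
  set u := ofColoring.gen c
  -- As for components, both sums equal their product: by `h₁`, completing either of them to a full
  -- column or row only adds vanishing terms.
  have hblock : ∀ i j k l, ∑ l', u (i, k) (j, l') = ∑ k', u (i, k') (j, l) := fun i j k l => by
    have e1 : (∑ l', u (i, k) (j, l')) * ∑ k', u (i, k') (j, l) = ∑ l', u (i, k) (j, l') := by
      rw [Finset.sum_mul]
      refine Finset.sum_congr rfl fun l' _ => ?_
      conv_rhs => rw [← mul_one (u (i, k) (j, l')), ← hm.col_sum (j, l), Fintype.sum_prod_type,
        Finset.mul_sum]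
      rw [Finset.sum_eq_single i (fun i' _ hi => ?_) (by simp)]
      rw [Finset.mul_sum]
      exact Finset.sum_eq_zero fun k' _ => h₁ _ _ _ _ _ _ _ _ (by simp [hi.symm])
    have e2 : (∑ l', u (i, k) (j, l')) * ∑ k', u (i, k') (j, l) = ∑ k', u (i, k') (j, l) := by
      rw [Finset.mul_sum]
      refine Finset.sum_congr rfl fun k' _ => ?_
      conv_rhs => rw [← one_mul (u (i, k') (j, l)), ← hm.row_sum (i, k), Fintype.sum_prod_type,
        Finset.sum_mul]
      rw [Finset.sum_eq_single j (fun j' _ hj => ?_) (by simp)]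
      rw [Finset.sum_mul]
      exact Finset.sum_eq_zero fun l' _ => h₁ _ _ _ _ _ _ _ _ (by simp [hj])
    exact e1.symm.trans e2
  let k₀ : V := Classical.arbitrary V
  -- `q` will be the image of the magic unitary of `S_n^+`, and `r i` below that of the `i`-th copy.
  -- The factorisation `u (i, k) (j, l) = r i k l * q i j` is the one of the wreath product.
  let q : Matrix (Fin n) (Fin n) (ofColoring c).coeff := fun i j => ∑ l, u (i, k₀) (j, l)
  have hqr : ∀ i j k, q i j = ∑ l, u (i, k) (j, l) := fun i j k =>
    (hblock i j k₀ k₀).trans (hblock i j k k₀).symm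
  have hqc : ∀ i j l, q i j = ∑ k, u (i, k) (j, l) := fun i j l => hblock i j k₀ l
  have hqu : ∀ i j k l, q i j * u (i, k) (j, l) = u (i, k) (j, l) := fun i j k l => by
    rw [hqr i j k, Finset.sum_mul, Finset.sum_eq_single l (fun l' _ hl =>
      hm.row_orth _ _ _ (by simp [hl])) (by simp), hm.mul_self]
  have hqu' : ∀ i j j' k l, j ≠ j' → q i j * u (i, k) (j', l) = 0 := fun i j j' k l hj => by
    rw [hqr i j k, Finset.sum_mul]
    exact Finset.sum_eq_zero fun l' _ => hm.row_orth _ _ _ (by simp [hj])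
  have huq : ∀ i j k l, u (i, k) (j, l) * q i j = u (i, k) (j, l) := fun i j k l => by
    rw [hqr i j k, Finset.mul_sum, Finset.sum_eq_single l (fun l' _ hl =>
      hm.row_orth _ _ _ (by simp [hl.symm])) (by simp), hm.mul_self]
  have huq' : ∀ i j j' k l, j ≠ j' → u (i, k) (j', l) * q i j = 0 := fun i j j' k l hj => by
    rw [hqr i j k, Finset.mul_sum]
    exact Finset.sum_eq_zero fun l' _ => hm.row_orth _ _ _ (by simp [hj.symm])
  have hq : IsMagic q := by
    refine ⟨fun i j => ?_, fun i j => ?_, fun i => ?_, fun j => ?_, fun i j j' h => ?_,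
      fun i j i' h => ?_⟩
    · simp only [q, star_sum, hm.star_eq]
    · conv_lhs => rw [hqr i j k₀, Finset.sum_mul]
      exact Finset.sum_congr rfl fun l _ => huq i j k₀ l
    · simpa only [q, Fintype.sum_prod_type] using hm.row_sum (i, k₀)
    · simp only [hqc _ j k₀]
      simpa only [Fintype.sum_prod_type] using hm.col_sum (j, k₀)
    · rw [hqr i j' k₀, Finset.mul_sum]
      exact Finset.sum_eq_zero fun l _ => hqu' i j j' k₀ l h
    · rw [hqc i j k₀, hqc i' j k₀, Finset.sum_mul_sum]
      exact Finset.sum_eq_zero fun k _ => Finset.sum_eq_zero fun k' _ =>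
        hm.col_orth _ _ _ (by simp [h])
  let r : Fin n → Matrix V V (ofColoring c).coeff := fun i k l => ∑ j, u (i, k) (j, l)
  have hrr : ∀ i k l k' l', r i k l * r i k' l' = ∑ j, u (i, k) (j, l) * u (i, k') (j, l') :=
    fun i k l k' l' => by
      simp only [r, Finset.sum_mul_sum]
      refine Finset.sum_congr rfl fun j _ => Finset.sum_eq_single j (fun j' _ hj => ?_) (by simp)
      exact h₁ _ _ _ _ _ _ _ _ (by simp [hj.symm])
  have hr : ∀ i, IsMagic (r i) := fun i => by
    refine ⟨fun k l => ?_, fun k l => ?_, fun k => ?_, fun l => ?_, fun k l l' h => ?_,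
      fun k l k' h => ?_⟩
    · simp only [r, star_sum, hm.star_eq]
    · simp only [hrr, hm.mul_self]; rfl
    · simp only [r]
      rw [Finset.sum_comm]
      simpa only [Fintype.sum_prod_type] using hm.row_sum (i, k)
    · simp only [r]
      rw [Finset.sum_comm]
      simp only [← hqc]
      exact hq.row_sum i
    · rw [hrr]
      exact Finset.sum_eq_zero fun j _ => hm.row_orth _ _ _ (by simp [h])
    · rw [hrr]
      exact Finset.sum_eq_zero fun j _ => hm.col_orth _ _ _ (by simp [h])
  have hru : ∀ i j k l, r i k l * q i j = u (i, k) (j, l) := fun i j k l => by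
    simp only [r, Finset.sum_mul]
    rw [Finset.sum_eq_single j (fun j' _ hj => huq' i j j' k l hj.symm) (by simp), huq]
  have hur : ∀ i j k l, q i j * r i k l = u (i, k) (j, l) := fun i j k l => by
    simp only [r, Finset.mul_sum]
    rw [Finset.sum_eq_single j (fun j' _ hj => hqu' i j j' k l hj.symm) (by simp), hqu]
  let ν : Fin n → (ofColoring c₀).coeff →⋆ₐ[ℂ] (ofColoring c).coeff := fun i =>
    ofColoring.lift (r i) (hr i) fun k l k' l' h => by
      rw [hrr]
      exact Finset.sum_eq_zero fun j _ => h₂ _ _ _ _ _ _ h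
  have hν : ∀ i k l, ν i (ofColoring.gen c₀ k l) = r i k l :=
    fun i k l => ofColoring.lift_gen _ _ _ _ _
  let β : (symmetric n).coeff →⋆ₐ[ℂ] (ofColoring c).coeff := symmetricLift q hq
  have hβ : ∀ i j, β ((symmetric n).u i j) = q i j := symmetricLift_u q hq
  -- On generators, both products are `u (i, k) (j, l)`; the centralizer of `q i j` extends this to
  -- the whole algebra.
  have hνq : ∀ (i j : Fin n) a, ν i a * q i j = q i j * ν i a := fun i j a => by
    have hkl : ∀ k l : V,
        q i j * ν i (ofColoring.gen c₀ k l) = ν i (ofColoring.gen c₀ k l) * q i j := fun k l => by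
      rw [hν, hru, hur]
    have := (ofColoring c₀).generated_le
      ((StarSubalgebra.centralizer ℂ {q i j}).comap (ν i)) (fun k l => ?_) a
    · exact ((StarSubalgebra.mem_centralizer_iff ℂ).1 this (q i j) rfl).1.symm
    · refine (StarSubalgebra.mem_centralizer_iff ℂ).2 ?_
      rintro _ rfl
      exact ⟨hkl k l, by rw [hq.star_eq]; exact hkl k l⟩
  let g : (wreath (ofColoring c₀) n).coeff →⋆ₐ[ℂ] (ofColoring c).coeff :=
    wreathLift ν β fun i j a => by
      refine (congrArg (ν i a * ·) (hβ i j)).trans ((hνq i j a).trans ?_)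
      exact (congrArg (· * ν i a) (hβ i j)).symm
  let w : Matrix (Fin n × V) (Fin n × V) (wreath (ofColoring c₀) n).coeff :=
    (wreath (ofColoring c₀) n).u
  have hw : ∀ i j k l, w (i, k) (j, l) = wreathNu (ofColoring c₀) n i (ofColoring.gen c₀ k l)
    * wreathBase (ofColoring c₀) n ((symmetric n).u i j) := fun i j k l => rfl
  have hwm : IsMagic w := (wreath (ofColoring c₀) n).magic
  have hbm := (symmetric n).magic.map (wreathBase (ofColoring c₀) n)
  let f : (ofColoring c).coeff →⋆ₐ[ℂ] (wreath (ofColoring c₀) n).coeff :=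
    ofColoring.lift w hwm fun x y x' y' h => by
      obtain ⟨i, k⟩ := x
      obtain ⟨j, l⟩ := y
      obtain ⟨i', k'⟩ := x'
      obtain ⟨j', l'⟩ := y'
      by_cases hi : i = i'
      · subst hi
        rw [hw, hw, mul_assoc, ← mul_assoc (wreathBase (ofColoring c₀) n _), ← wreathNu_mul_base,
          mul_assoc, ← mul_assoc, ← map_mul]
        by_cases hj : j = j'
        · subst hj
          rw [h₃ _ _ _ _ _ _ h, map_zero, zero_mul]
        · exact (congrArg _ (hbm.row_orth i j j' hj)).trans (mul_zero _)
      · by_cases hj : j = j'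
        · subst hj
          rw [hw, hw, wreathNu_mul_base _ _ i', mul_assoc,
            ← mul_assoc (wreathBase (ofColoring c₀) n _)]
          exact (congrArg (fun t => _ * (t * _)) (hbm.col_orth i j i' hi)).trans
            (by rw [zero_mul, mul_zero])
        · rcases h₄ _ _ _ _ _ _ _ _ hi hj h with h | h <;> simp [hw, h]
  refine .of_entries (Γ := ofColoring c) (Λ := wreath (ofColoring c₀) n)
    (Equiv.refl (Fin n × V)) f g (fun i j => ofColoring.lift_gen _ _ _ i j) ?_
  rintro ⟨i, k⟩ ⟨j, l⟩
  refine (map_mul g _ _).trans ?_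
  refine (congrArg₂ (· * ·) ((wreathLift_nu _ _ _ i _).trans (hν i k l))
    ((wreathLift_base _ _ _ _).trans (hβ i j))).trans (hru i j k l)

end wreath

/-! ## Quantum automorphism groups of rigid classes of colourings -/

theorem _root_.color_eq_of_not_reachable {V κ : Type} {c : V → V → κ} {hc : ∀ x y, c x y = c y x}
    {α : κ} {x y : V} (h : ¬ (colorGraph c hc α).Reachable x y) : c x y = α := by
  by_contra hne
  exact h (SimpleGraph.Adj.reachable ⟨fun e => h (by rw [e]), hne⟩)

theorem ofColoring_isomorphic_comp {V W κ : Type} [Fintype V] [Nonempty V] [Fintype W] [Nonempty W]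
    (c : V → V → κ) (ε : W ≃ V) :
    Isomorphic (ofColoring fun x y => c (ε x) (ε y)) (ofColoring c) :=
  ofColoring_isomorphic ε (fun _ _ _ _ h => (ofColoring.colorIso c).rel _ _ _ _ h)
    fun _ _ _ _ h => (ofColoring.colorIso fun x y => c (ε x) (ε y)).rel _ _ _ _ h

/-- Indexing the magic unitary of a relabelled colouring by the original points makes the colour
graphs of `c` itself available after `V` has been identified with a product or a sum. -/
theorem ofColoring.colorIso_comp {V W κ : Type} [Fintype V] [Fintype W] [Nonempty W]
    (c : V → V → κ) (ε : W ≃ V) :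
    ColorIso 1 c c fun x y => gen (fun x y => c (ε x) (ε y)) (ε.symm x) (ε.symm y) :=
  ((magic _).reindex ε.symm).colorIso fun _ _ _ _ h => (colorIso _).rel _ _ _ _ (by simpa using h)

theorem isomorphic_trivialGroup {V κ : Type} [Fintype V] [Nonempty V] [Subsingleton V]
    (c : V → V → κ) : Isomorphic trivialGroup (ofColoring c) := by
  obtain ⟨x₀⟩ := ‹Nonempty V›
  have : Unique V := ⟨⟨x₀⟩, fun _ => Subsingleton.elim _ _⟩
  have hu : ∀ x y, ofColoring.gen c x y = 1 := fun x y => by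
    rw [← (ofColoring.magic c).row_sum x, Fintype.sum_unique, Subsingleton.elim y default]
  have hm : IsMagic (fun _ _ : V => (1 : ℂ)) := by
    constructor <;> simp [Subsingleton.elim _ x₀]
  let f : ℂ →⋆ₐ[ℂ] (ofColoring c).coeff := StarAlgHom.ofId ℂ _
  let g : (ofColoring c).coeff →⋆ₐ[ℂ] ℂ := ofColoring.lift _ hm fun x y x' y' h =>
    (h (by rw [Subsingleton.elim x y, Subsingleton.elim x' y'])).elim
  exact .of_entries (Γ := trivialGroup) (Λ := ofColoring c) (Equiv.ofUnique Unit V)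
    f g (fun _ _ => (map_one f).trans (hu _ _).symm) fun i j => ofColoring.lift_gen (B := ℂ) _ _ _ _ _

/-- Induction on the number of points, along a colour `α` that disconnects `c`. Let `C₀` be a
component. If all components are isomorphic to `C₀`, they are permuted and a wreath product appears.
Otherwise the points of the components isomorphic to `C₀` are not mixed with the others, by
rigidity, and a free product appears. Colours between distinct components are all `α` and impose no
further relation. -/
theorem ofColoring_mem_of_isRigid {κ : Type} {P : ∀ V : Type, (V → V → κ) → Prop}
    (hP : IsHereditary P) (hR : IsRigid P) {F : Set QuantumPermutationGroup}
    (hF : IsJordanClosed F)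
    (hbase : ∀ (V : Type) [Fintype V] [Nonempty V] (c : V → V → κ) (hc : P V c),
      (∀ α, (colorGraph c (hP.symm hc) α).Preconnected) → ofColoring c ∈ F)
    (V : Type) [Fintype V] [Nonempty V] (c : V → V → κ) (hc : P V c) : ofColoring c ∈ F := by
  classical
  obtain ⟨m, hm⟩ : ∃ m, Fintype.card V = m := ⟨_, rfl⟩
  induction m using Nat.strong_induction_on generalizing V with | _ m ih => ?_
  by_cases hconn : ∀ α, (colorGraph c (hP.symm hc) α).Preconnected
  · exact hbase V c hc hconn
  push Not at hconn
  obtain ⟨α, hα⟩ := hconn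
  set G := colorGraph c (hP.symm hc) α with hG
  let rc (C : G.ConnectedComponent) := restrictColor c fun x => G.connectedComponentMk x = C
  obtain ⟨x₀⟩ := id ‹Nonempty V›
  set C₀ := G.connectedComponentMk x₀ with hC₀
  let Q : V → Prop := fun x => ColorEquiv (rc C₀) (rc (G.connectedComponentMk x))
  have hcα : ∀ x y, G.connectedComponentMk x ≠ G.connectedComponentMk y → c x y = α :=
    fun x y h => color_eq_of_not_reachable (hc := hP.symm hc) fun hr =>
      h (SimpleGraph.ConnectedComponent.sound hr)
  by_cases hQ : ∀ x, Q x
  -- All components are copies of `C₀`: through `τ`, a point is labelled by its component and by a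
  -- point of `C₀`.
  · have hε : ∀ C, ColorEquiv (rc C₀) (rc C) := fun C => by
      induction C using SimpleGraph.ConnectedComponent.ind with | h x => exact hQ x
    choose ε hε using hε
    have : Nonempty G.ConnectedComponent := ⟨C₀⟩
    obtain ⟨n, hn⟩ : ∃ n, Fintype.card G.ConnectedComponent = n := ⟨_, rfl⟩
    have : NeZero n := ⟨hn ▸ Fintype.card_ne_zero⟩
    let σ : Fin n ≃ G.ConnectedComponent := (Fintype.equivFinOfCardEq hn).symm
    have : Nonempty {x // G.connectedComponentMk x = C₀} := ⟨⟨x₀, rfl⟩⟩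
    let τ : Fin n × {x // G.connectedComponentMk x = C₀} ≃ V :=
      (Equiv.prodCongr σ (Equiv.refl _)).trans ((Equiv.sigmaEquivProd _ _).symm.trans
        ((Equiv.sigmaCongrRight ε).trans (Equiv.sigmaFiberEquiv G.connectedComponentMk)))
    have hτ : ∀ i k, τ (i, k) = (ε (σ i) k).1 := fun i k => rfl
    have hmk : ∀ i k, G.connectedComponentMk (τ (i, k)) = σ i := fun i k => (ε (σ i) k).2
    have hsame : ∀ i k l, c (τ (i, k)) (τ (i, l)) = rc C₀ k l := fun i k l => by
      rw [hτ, hτ]; exact (hε (σ i) k l).symm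
    have hdiff : ∀ i j k l, i ≠ j → c (τ (i, k)) (τ (j, l)) = α := fun i j k l h =>
      hcα _ _ (by rw [hmk, hmk]; exact σ.injective.ne h)
    have hU := ofColoring.colorIso_comp c τ
    have hreach : ∀ i i' k k', G.Reachable (τ (i, k)) (τ (i', k')) ↔ i = i' := fun i i' k k' => by
      rw [← SimpleGraph.ConnectedComponent.eq, hmk, hmk, σ.apply_eq_iff_eq]
    have key := ofColoring_wreath_isomorphic (n := n) (c := fun x y => c (τ x) (τ y)) (c₀ := rc C₀)
      (fun i i' j j' k k' l l' h => ?_) (fun i j k k' l l' h => ?_) (fun i j k k' l l' h => ?_)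
      (fun i i' j j' k k' l l' hi hj h => ?_)
    · exact hF.of_isomorphic _ _ (key.symm.trans (ofColoring_isomorphic_comp c τ))
        (hF.wreath_mem _ (ih _ (hm ▸ card_component_lt hα C₀) _ _
          (hP.restrict hc _ Subtype.val_injective) rfl) n)
    · by_cases hi : i = i'
      · simpa using hU.mul_eq_zero_of_color (hc := hP.symm hc) (hd := hP.symm hc)
          (y := τ (j, l)) (y' := τ (j', l')) ((hreach i i' k k').2 hi)
          fun hr => h.1 hi ((hreach _ _ _ _).1 hr)
      · have hj : j = j' := by
          by_contra hj
          exact hi (h.2 hj)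
        simpa using hU.transpose.mul_eq_zero_of_color (hc := hP.symm hc) (hd := hP.symm hc)
          (y := τ (i, k)) (y' := τ (i', k')) ((hreach j j' l l').2 hj)
          fun hr => hi ((hreach _ _ _ _).1 hr)
    · exact (ofColoring.colorIso _).rel _ _ _ _ (by simpa only [hsame] using h)
    · exact (ofColoring.colorIso _).rel _ _ _ _ (by simpa only [hsame] using h)
    · exact (h (by rw [hdiff _ _ _ _ hi, hdiff _ _ _ _ hj])).elim
  · push Not at hQ
    obtain ⟨y₀, hy₀⟩ := hQ
    have hx₀ : Q x₀ := ColorEquiv.refl _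
    have : Nonempty {x // Q x} := ⟨⟨x₀, hx₀⟩⟩
    have : Nonempty {x // ¬ Q x} := ⟨⟨y₀, hy₀⟩⟩
    let τ : {x // Q x} ⊕ {x // ¬ Q x} ≃ V := Equiv.sumCompl Q
    have hU := ofColoring.colorIso_comp c τ
    -- A nonzero entry lies in a nonzero block, which is a quantum isomorphism of two components;
    -- these are isomorphic by rigidity, so `Q` holds at both points or at neither.
    have hzero : ∀ x y, ¬ (Q x ↔ Q y) → ofColoring.gen (fun x y => c (τ x) (τ y)) (τ.symm x)
        (τ.symm y) = 0 := fun x y hxy => by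
      refine hU.eq_zero_of_block (hc := hP.symm hc) (hd := hP.symm hc) (α := α) ?_
      by_contra hne
      have he := hR _ _ _ _ _ _ _ (hP.restrict hc _ Subtype.val_injective)
        (hP.restrict hc _ Subtype.val_injective) hne (hU.restrict_block _ _)
      exact hxy ⟨fun h => h.trans he, fun h => h.trans he.symm⟩
    have hcross : ∀ (x : {x // Q x}) (y : {x // ¬ Q x}), c (τ (.inl x)) (τ (.inr y)) = α :=
      fun x y => hcα _ _ fun h => y.2 (by
        have hx := x.2
        change ColorEquiv _ _ at hx
        exact (congrArg (fun C => ColorEquiv (rc C₀) (rc C)) h).mp hx)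
    have key := ofColoring_sum_isomorphic (c := fun x y => c (τ x) (τ y))
      (c₁ := fun x y => c (τ (.inl x)) (τ (.inl y))) (c₂ := fun x y => c (τ (.inr x)) (τ (.inr y)))
      (fun x y => ?_) (fun x y => ?_) (fun x y x' y' h => (ofColoring.colorIso _).rel _ _ _ _ h)
      (fun x y x' y' h => (ofColoring.colorIso _).rel _ _ _ _ h)
      (fun x y x' y' h => (ofColoring.colorIso _).rel _ _ _ _ h)
      (fun x y x' y' h => (ofColoring.colorIso _).rel _ _ _ _ h) (fun x y x' y' h => ?_)
    · refine hF.of_isomorphic _ _ (key.symm.trans (ofColoring_isomorphic_comp c τ))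
        (hF.freeProduct_mem _ (ih _ (hm ▸ Fintype.card_subtype_lt hy₀) _ _
            (hP.restrict hc _ (τ.injective.comp Sum.inl_injective)) rfl) _
          (ih _ (hm ▸ Fintype.card_subtype_lt (x := x₀) (not_not.2 hx₀)) _ _
            (hP.restrict hc _ (τ.injective.comp Sum.inr_injective)) rfl))
    · simpa using hzero (τ (.inl x)) (τ (.inr y)) fun h => y.2 (h.1 x.2)
    · simpa using hzero (τ (.inr x)) (τ (.inl y)) fun h => x.2 (h.2 y.2)
    · simp [hcross, hP.symm hc (τ (.inr _))] at h

end QuantumPermutationGroup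

/-! ## Quantum isomorphisms of graphs -/

namespace ColorIso

variable {V W A : Type} [Fintype V] [Fintype W] [Ring A] {e : A}

/-- Summed by rows or by columns, all the entries add up to `e` times either number of points. -/
theorem card_eq {κ : Type} {c : V → V → κ} {d : W → W → κ} {u : V → W → A} [Algebra ℂ A]
    (h : ColorIso e c d u) (he : e ≠ 0) : Fintype.card V = Fintype.card W := by
  refine card_eq_of_nsmul_eq he ?_
  rw [← Finset.card_univ, ← Finset.card_univ, ← Finset.sum_const, ← Finset.sum_const,
    ← Finset.sum_congr rfl fun x _ => h.row_sum x, ← Finset.sum_congr rfl fun y _ => h.col_sum y]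
  exact Finset.sum_comm

variable {G : SimpleGraph V} {H : SimpleGraph W} {u : V → W → A}

/-- Orthogonality of rows and columns says that equality of points is preserved, hence so is being
distinct and non-adjacent. -/
theorem compl (h : ColorIso e G.Adj H.Adj u) : ColorIso e Gᶜ.Adj Hᶜ.Adj u := by
  refine h.of_rel fun x y x' y' hne => ?_
  by_cases hG : G.Adj x x' = H.Adj y y'
  · by_cases hx : x = x'
    · subst hx
      refine h.row_orth _ _ _ fun hy => hne ?_
      subst hy
      simp
    · by_cases hy : y = y'
      · subst hy
        exact h.col_orth _ _ _ hx
      · refine (hne ?_).elim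
        rw [SimpleGraph.compl_adj, SimpleGraph.compl_adj, hG]
        simp [hx, hy]
  · exact h.rel _ _ _ _ hG

theorem mul_eq_zero_of_adj (h : ColorIso e G.Adj H.Adj u) (x : V) (y : W) (x' : V) (y' : W)
    (h1 : G.Adj x x') (h2 : ¬ H.Adj y y') : u x y * u x' y' = 0 :=
  h.rel _ _ _ _ fun heq => h2 (heq ▸ h1)

theorem mul_eq_zero_of_dist_lt (h : ColorIso e G.Adj H.Adj u) (hG : G.Connected) {x x' : V}
    {y y' : W} (hd : G.dist x x' < H.dist y y') : u x y * u x' y' = 0 := by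
  obtain ⟨p, hp⟩ := hG.exists_walk_length_eq_dist x x'
  exact h.mul_eq_zero_of_walk h.mul_eq_zero_of_adj p fun q hq =>
    absurd (SimpleGraph.dist_le q) (by omega)

theorem mul_eq_zero_of_dist (h : ColorIso e G.Adj H.Adj u) (hG : G.Connected) (hH : H.Connected)
    {x x' : V} {y y' : W} (hd : G.dist x x' ≠ H.dist y y') : u x y * u x' y' = 0 := by
  rcases hd.lt_or_gt with hd | hd
  · exact h.mul_eq_zero_of_dist_lt hG hd
  · exact h.transpose.mul_eq_zero_of_dist_lt hH hd

-- Multiply `u x y` by the sum of the entries indexed by the neighbours of `x` and those of `y`. For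
-- a neighbour `x'` of `x`, the entries of its row outside the neighbours of `y` are killed by `u x
-- y`, so the partial row acts as the full one, that is as the unit. Each neighbour of `x` thus
-- counts once, and symmetrically each neighbour of `y`.
open scoped Classical in
theorem degree_smul (h : ColorIso e G.Adj H.Adj u) (x : V) (y : W) :
    G.degree x • u x y = H.degree y • u x y := by
  have key : ∀ {V W : Type} [Fintype V] [Fintype W] {G : SimpleGraph V} {H : SimpleGraph W}
      {u : V → W → A} (_ : ColorIso e G.Adj H.Adj u) (x : V) (y : W),
      u x y * ∑ x' ∈ G.neighborFinset x, ∑ y' ∈ H.neighborFinset y, u x' y'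
        = G.degree x • u x y := by
    intro V W _ _ G H u h x y
    rw [← SimpleGraph.card_neighborFinset_eq_degree, ← Finset.sum_const, Finset.mul_sum]
    refine Finset.sum_congr rfl fun x' hx' => ?_
    rw [← h.mul_unit x y, ← h.row_sum x', mul_assoc, Finset.mul_sum, Finset.mul_sum,
      Finset.mul_sum]
    rw [Finset.sum_subset (Finset.subset_univ (H.neighborFinset y)) fun y' _ hy' => ?_]
    · refine Finset.sum_congr rfl fun y' _ => ?_
      rw [h.row_sum, h.unit_mul]
    · rw [h.row_sum, h.unit_mul]
      exact h.mul_eq_zero_of_adj _ _ _ _ (by simpa using hx') (by simpa using hy')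
  rw [← key h x y, ← key h.transpose y x, Finset.sum_comm]

open scoped Classical in
theorem eq_zero_of_degree [Algebra ℂ A] (h : ColorIso e G.Adj H.Adj u) {x : V} {y : W}
    (hd : G.degree x ≠ H.degree y) : u x y = 0 := by
  by_contra hne
  exact hd (card_eq_of_nsmul_eq hne (h.degree_smul x y))

/-- If `y` and `y'` were separated, all the products `u x y * u x' y'` would vanish, since `x` and
`x'` are connected; summing them gives `e * e = 0`. -/
theorem connected (h : ColorIso e G.Adj H.Adj u) (he : e ≠ 0) (hG : G.Connected) :
    H.Connected := by
  have := hG.nonempty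
  have hW : Nonempty W := by
    by_contra hW
    rw [not_nonempty_iff] at hW
    obtain ⟨x⟩ := this
    exact he (by rw [← h.row_sum x, Fintype.sum_empty])
  refine ⟨fun y y' => ?_⟩
  by_contra hy
  refine he ?_
  rw [← h.unit_mul_unit]
  have hsum : e * e = (∑ x, u x y) * ∑ x, u x y' := by rw [h.col_sum, h.col_sum]
  rw [hsum, Finset.sum_mul_sum]
  exact Finset.sum_eq_zero fun x _ => Finset.sum_eq_zero fun x' _ =>
    h.mul_eq_zero_of_reachable h.mul_eq_zero_of_adj (hG.preconnected x x') hy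

/-- A tree is a connected graph with one more vertex than edges. Connectedness, the number of
vertices and, through the sum of the degrees, the number of edges all pass to `H`. -/
theorem isTree [Algebra ℂ A] (h : ColorIso e G.Adj H.Adj u) (he : e ≠ 0) (hG : G.IsTree) :
    H.IsTree := by
  classical
  rw [SimpleGraph.isTree_iff_connected_and_card]
  refine ⟨h.connected he hG.connected, ?_⟩
  have hcard := h.card_eq he
  have hE : ∑ x, G.degree x = ∑ y, H.degree y := by
    refine card_eq_of_nsmul_eq he ?_
    calc (∑ x, G.degree x) • e = ∑ x, ∑ y, G.degree x • u x y := by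
          simp only [Finset.sum_smul, ← Finset.smul_sum, h.row_sum]
      _ = ∑ y, ∑ x, H.degree y • u x y := by
          rw [Finset.sum_comm]; simp only [h.degree_smul]
      _ = _ := by simp only [Finset.sum_smul, ← Finset.smul_sum, h.col_sum]
  rw [SimpleGraph.sum_degrees_eq_twice_card_edges, SimpleGraph.sum_degrees_eq_twice_card_edges]
    at hE
  have hT := hG.card_edgeFinset
  rw [Nat.card_eq_fintype_card, Nat.card_eq_fintype_card, ← SimpleGraph.edgeFinset_card]
  omega

end ColorIso

/-! ### Eccentricities and Gromov products -/

/-- The largest distance to a given vertex. -/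
noncomputable def SimpleGraph.maxDist {V : Type} [Fintype V] (G : SimpleGraph V) (x : V) : ℕ :=
  Finset.univ.sup (G.dist x)

theorem SimpleGraph.dist_le_maxDist {V : Type} [Fintype V] (G : SimpleGraph V) (x y : V) :
    G.dist x y ≤ G.maxDist x :=
  Finset.le_sup (Finset.mem_univ y)

theorem SimpleGraph.exists_dist_eq_maxDist {V : Type} [Fintype V] (G : SimpleGraph V) (x : V) :
    ∃ y, G.dist x y = G.maxDist x := by
  have : Nonempty V := ⟨x⟩
  obtain ⟨y, -, hy⟩ := Finset.exists_mem_eq_sup Finset.univ Finset.univ_nonempty (G.dist x)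
  exact ⟨y, hy.symm⟩

/-- The Gromov product of two vertices, relatively to a point at infinity in the direction of the
center. -/
noncomputable def SimpleGraph.gromov {V : Type} [Fintype V] (G : SimpleGraph V) (x y : V) : ℤ :=
  G.maxDist x + G.maxDist y - G.dist x y

theorem SimpleGraph.gromov_comm {V : Type} [Fintype V] (G : SimpleGraph V) (x y : V) :
    G.gromov x y = G.gromov y x := by
  rw [gromov, gromov, G.dist_comm, add_comm (G.maxDist x : ℤ)]

/-- On the diagonal the product is twice the eccentricity, so it recovers the distance once its
diagonal values are known. -/
theorem SimpleGraph.adj_iff_of_gromov {V W : Type} [Fintype V] [Fintype W] {G : SimpleGraph V}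
    {H : SimpleGraph W} {x x' : V} {y y' : W} (h : G.gromov x x = H.gromov y y)
    (h' : G.gromov x' x' = H.gromov y' y') (hxy : G.gromov x x' = H.gromov y y') :
    G.Adj x x' = H.Adj y y' := by
  simp only [gromov, dist_self] at h h' hxy
  have : G.dist x x' = H.dist y y' := by omega
  rw [← dist_eq_one_iff_adj, this, dist_eq_one_iff_adj]

namespace ColorIso

variable {V W A : Type} [Fintype V] [Fintype W] [Ring A] {e : A}
variable {G : SimpleGraph V} {H : SimpleGraph W} {u : V → W → A}

/-- If `x` has the larger eccentricity, a vertex `x'` farthest from `x` is at a distance that no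
vertex has from `y`. So `u x y` kills the whole row of `x'`, whose sum is the unit. The other case
is the transpose. -/
theorem eq_zero_of_maxDist (h : ColorIso e G.Adj H.Adj u) (hG : G.Connected) (hH : H.Connected)
    {x : V} {y : W} (hd : G.maxDist x ≠ H.maxDist y) : u x y = 0 := by
  have key : ∀ {V W : Type} [Fintype V] [Fintype W] {G : SimpleGraph V} {H : SimpleGraph W}
      {u : V → W → A} (_ : ColorIso e G.Adj H.Adj u) (_ : G.Connected) (_ : H.Connected)
      (x : V) (y : W), H.maxDist y < G.maxDist x → u x y = 0 := by
    intro V W _ _ G H u h hG hH x y hlt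
    obtain ⟨x', hx'⟩ := G.exists_dist_eq_maxDist x
    refine h.eq_zero_of_row' x' fun y' => h.mul_eq_zero_of_dist hG hH ?_
    have := H.dist_le_maxDist y y'
    omega
  rcases hd.lt_or_gt with hd | hd
  · exact key h.transpose hH hG y x hd
  · exact key h hG hH x y hd

theorem gromov (h : ColorIso e G.Adj H.Adj u) (hG : G.Connected) (hH : H.Connected) :
    ColorIso e G.gromov H.gromov u := by
  refine h.of_rel fun x y x' y' hne => ?_
  by_cases h1 : G.maxDist x = H.maxDist y
  · by_cases h2 : G.maxDist x' = H.maxDist y'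
    · refine h.mul_eq_zero_of_dist hG hH fun h3 => hne ?_
      rw [SimpleGraph.gromov, SimpleGraph.gromov, h1, h2, h3]
    · rw [h.eq_zero_of_maxDist hG hH h2, mul_zero]
  · rw [h.eq_zero_of_maxDist hG hH h1, zero_mul]

theorem of_gromov (h : ColorIso e G.gromov H.gromov u) : ColorIso e G.Adj H.Adj u := by
  refine h.of_rel fun x y x' y' hne => ?_
  by_cases h1 : G.gromov x x = H.gromov y y
  · by_cases h2 : G.gromov x' x' = H.gromov y' y'
    · exact h.rel _ _ _ _ fun h3 => hne (SimpleGraph.adj_iff_of_gromov h1 h2 h3)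
    · rw [h.diag h2, mul_zero]
  · rw [h.diag h1, zero_mul]

end ColorIso

/-! ## Trees are ultrametric -/

namespace SimpleGraph

variable {V : Type} {G : SimpleGraph V}

theorem Connected.exists_adj_dist_eq (hG : G.Connected) {x y : V} (hxy : x ≠ y) :
    ∃ v, G.Adj x v ∧ G.dist x y = G.dist v y + 1 := by
  obtain ⟨p, hp⟩ := hG.exists_walk_length_eq_dist x y
  cases p with
  | nil => exact (hxy rfl).elim
  | @cons _ v _ hv q =>
    refine ⟨v, hv, ?_⟩
    have h1 := dist_le q
    have h2 := hG.dist_triangle (u := x) (v := v) (w := y)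
    rw [dist_eq_one_iff_adj.2 hv] at h2
    rw [Walk.length_cons] at hp
    omega

/-- In a tree, if `p` but not `q` lies in the direction of the neighbour `v` of `x`, then `x` is
between `p` and `q`. -/
theorem IsTree.dist_eq_add_of_adj (hG : G.IsTree) {x v p q : V} (hxv : G.Adj x v)
    (hp : G.dist x p = G.dist v p + 1) (hq : G.dist x q ≠ G.dist v q + 1) :
    G.dist p q = G.dist p x + G.dist x q := by
  classical
  have hconn := hG.connected
  obtain ⟨w, hw⟩ := hconn.exists_walk_length_eq_dist p q
  have hmem : ∀ {a b c : V} (r : G.Walk a b), c ∈ r.support →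
      G.dist a c + G.dist c b ≤ r.length := fun {a b c} r hc => by
    have h1 := dist_le (r.takeUntil c hc)
    have h2 := dist_le (r.dropUntil c hc)
    have h3 := congrArg Walk.length (r.take_spec hc)
    rw [Walk.length_append] at h3
    omega
  -- Otherwise the geodesic `w`, with geodesics from `p` to `v` and from `q` to `x`, joins the ends
  -- of the bridge `s(x, v)` without crossing it. The last two avoid this edge because `p` is closer
  -- to `v` and `q` is closer to `x`.
  have hx : x ∈ w.support := by
    by_contra hx
    have hbr := (isAcyclic_iff_forall_adj_isBridge.1 hG.isAcyclic) hxv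
    refine (isBridge_iff.1 hbr) ?_
    obtain ⟨r, hr⟩ := hconn.exists_walk_length_eq_dist p v
    obtain ⟨s, hs⟩ := hconn.exists_walk_length_eq_dist q x
    have h1 : s(x, v) ∉ w.edges := fun h => hx (w.fst_mem_support_of_mem_edges h)
    have h2 : s(x, v) ∉ r.edges := fun h => by
      have := hmem r (r.fst_mem_support_of_mem_edges h)
      rw [G.dist_comm (u := p) (v := x), G.dist_comm (u := p)] at *
      omega
    have h3 : s(x, v) ∉ s.edges := fun h => by
      have := hmem s (s.snd_mem_support_of_mem_edges h)
      have h4 := (hG.dist_eq_dist_add_one_of_adj q hxv)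
      have h5 := dist_eq_one_iff_adj.2 hxv.symm
      rw [G.dist_comm (u := q) (v := v), G.dist_comm (u := q)] at *
      omega
    exact ((s.toDeleteEdge _ h3).reachable.symm.trans
      (w.toDeleteEdge _ h1).reachable.symm).trans (r.toDeleteEdge _ h2).reachable
  have h1 := hmem w hx
  have h2 := hconn.dist_triangle (u := p) (v := x) (w := q)
  omega

/-- The four-point condition for trees. -/
theorem IsTree.four_point (hG : G.IsTree) (x y z w : V) :
    G.dist x z + G.dist y w ≤ G.dist x y + G.dist z w ∨
      G.dist x z + G.dist y w ≤ G.dist y z + G.dist x w := by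
  have ht := fun a b c => hG.connected.dist_triangle (u := a) (v := b) (w := c)
  obtain ⟨n, hn⟩ : ∃ n, G.dist x y = n := ⟨_, rfl⟩
  induction n generalizing x with
  | zero =>
    rw [hG.connected.dist_eq_zero_iff] at hn
    subst hn
    exact Or.inr le_rfl
  | succ n ih =>
    have hxy : x ≠ y := by
      rintro rfl
      simp at hn
    obtain ⟨v, hv, hvy⟩ := hG.connected.exists_adj_dist_eq hxy
    -- The neighbour `v` is one step closer to `y`. If it is also closer to `z` and `w`, all
    -- distances from `x` drop by one and the induction hypothesis applies. Otherwise `x` lies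
    -- between `y` and the point in another direction, and the inequality is direct.
    by_cases hz : G.dist x z = G.dist v z + 1
    · by_cases hw : G.dist x w = G.dist v w + 1
      · have := ih v (by omega)
        omega
      · have h1 := hG.dist_eq_add_of_adj hv hvy hw
        have h2 := hG.dist_eq_add_of_adj hv hz hw
        rw [G.dist_comm (u := y) (v := x)] at h1
        rw [G.dist_comm (u := z) (v := x)] at h2
        omega
    · have h1 := hG.dist_eq_add_of_adj hv hvy hz
      have h2 := ht y x w
      rw [G.dist_comm (u := y) (v := x)] at h1 h2
      omega

/-- In the four-point condition take `w` farthest from `y`: then `dist y w` is the eccentricity of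
`y`, while `x` and `z` are at a distance from `w` at most their own. The two alternatives bound the
product of `x` and `z` below by that of `x` and `y`, or of `y` and `z`. -/
theorem IsTree.gromov_ultrametric [Fintype V] (hG : G.IsTree) (x y z : V) :
    min (G.gromov x y) (G.gromov y z) ≤ G.gromov x z := by
  obtain ⟨w, hw⟩ := G.exists_dist_eq_maxDist y
  have h1 := G.dist_le_maxDist x w
  have h2 := G.dist_le_maxDist z w
  have := hG.four_point x y z w
  simp only [gromov, min_le_iff]
  omega

end SimpleGraph

/-! ### Ultrametric colourings -/

/-- Symmetric colourings by integers which satisfy the ultrametric inequality. -/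
def IsUltrametricColor (V : Type) (c : V → V → ℤ) : Prop :=
  (∀ x y, c x y = c y x) ∧ ∀ x y z, min (c x y) (c y z) ≤ c x z

theorem isHereditary_isUltrametricColor : IsHereditary IsUltrametricColor where
  symm h := h.1
  restrict h _ _ _ := ⟨fun _ _ => h.1 _ _, fun _ _ _ => h.2 _ _ _⟩

/-- Let `c a b` be the least colour of a pair of distinct points. The edges of its colour graph have
strictly larger colours, so by the ultrametric inequality a walk from `a` only meets `a` and points
whose colour with `a` is strictly larger: it never reaches `b`. -/
theorem IsUltrametricColor.subsingleton {V : Type} [Finite V] {c : V → V → ℤ}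
    (h : IsUltrametricColor V c) (hconn : ∀ α, (colorGraph c h.1 α).Preconnected) :
    Subsingleton V := by
  by_contra hV
  rw [not_subsingleton_iff_nontrivial] at hV
  obtain ⟨a₀, b₀, hab₀⟩ := exists_pair_ne V
  obtain ⟨⟨a, b⟩, hab, hmin⟩ := Set.exists_min_image {p : V × V | p.1 ≠ p.2}
    (fun p => c p.1 p.2) (Set.toFinite _) ⟨(a₀, b₀), hab₀⟩
  have key : ∀ {x y : V} (p : (colorGraph c h.1 (c a b)).Walk x y), x = a ∨ c a b < c a x →
      y = a ∨ c a b < c a y := by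
    intro x y p
    induction p with
    | nil => exact id
    | @cons x z y hxz p ih =>
      intro hx
      refine ih ?_
      have hlt : c a b < c x z := lt_of_le_of_ne (hmin (x, z) hxz.1) hxz.2.symm
      rcases hx with rfl | hx
      · exact Or.inr hlt
      · exact Or.inr ((lt_min hx hlt).trans_le (h.2 _ _ _))
  obtain ⟨p⟩ := hconn (c a b) a b
  rcases key p (Or.inl rfl) with hb | hb
  · exact hab hb.symm
  · exact lt_irrefl _ hb

/-- By counting, both sides have at most one point. Only the diagonal colours could differ, and then
all entries vanish, hence `e` too. -/
theorem ColorIso.colorEquiv_of_subsingleton {V W κ A : Type} [Fintype V] [Fintype W] [Ring A]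
    [Algebra ℂ A] [Subsingleton V] {e : A} {c : V → V → κ} {d : W → W → κ} {u : V → W → A}
    (h : ColorIso e c d u) (he : e ≠ 0) : ColorEquiv c d := by
  have hcard := h.card_eq he
  have hW : Subsingleton W := by
    rw [← Fintype.card_le_one_iff_subsingleton, ← hcard, Fintype.card_le_one_iff_subsingleton]
    infer_instance
  refine ⟨Fintype.equivOfCardEq hcard, fun x y => ?_⟩
  rw [Subsingleton.elim y x]
  by_contra hne
  refine he ?_
  rw [← h.row_sum x]
  exact Finset.sum_eq_zero fun y _ => by rw [Subsingleton.elim y]; exact h.diag hne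

theorem isRigid_isUltrametricColor : IsRigid IsUltrametricColor :=
  isHereditary_isUltrametricColor.isRigid fun V W A _ _ _ _ e c d u hc _ he hconn h => by
    have := hc.subsingleton hconn
    exact h.colorEquiv_of_subsingleton he

/-- A tree and a graph which are quantum isomorphic are isomorphic. -/
theorem ColorIso.colorEquiv_of_isTree {V W A : Type} [Fintype V] [Fintype W] [Ring A]
    [Algebra ℂ A] {e : A} {G : SimpleGraph V} {H : SimpleGraph W} {u : V → W → A}
    (h : ColorIso e G.Adj H.Adj u) (he : e ≠ 0) (hG : G.IsTree) : ColorEquiv G.Adj H.Adj := by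
  have hH := h.isTree he hG
  obtain ⟨f, hf⟩ := isRigid_isUltrametricColor V W A e _ _ u
    ⟨G.gromov_comm, hG.gromov_ultrametric⟩ ⟨H.gromov_comm, hH.gromov_ultrametric⟩ he
    (h.gromov hG.connected hH.connected)
  exact ⟨f, fun x y => SimpleGraph.adj_iff_of_gromov (hf _ _) (hf _ _) (hf _ _)⟩

namespace QuantumPermutationGroup

/-! ## Quantum automorphism groups of tree-cographs -/

open scoped Classical in
/-- A magic unitary commutes with the adjacency matrix if and only if it preserves adjacency. -/
theorem _root_.IsMagic.commute_adjMatrix_iff {V A : Type} [Fintype V] [Ring A] [Algebra ℂ A]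
    [StarRing A] {p : Matrix V V A} (hp : IsMagic p) (G : SimpleGraph V) :
    (∀ x y, ∑ z, G.adjMatrix ℂ x z • p z y = ∑ z, G.adjMatrix ℂ z y • p x z) ↔
      ∀ x y x' y', G.Adj x x' ≠ G.Adj y y' → p x y * p x' y' = 0 := by
  have hM : ∀ {x y x' y'}, G.Adj x x' = G.Adj y y' →
      G.adjMatrix ℂ x x' = G.adjMatrix ℂ y y' := fun {x y x' y'} h => by
    simp only [SimpleGraph.adjMatrix_apply, h]
  constructor
  · intro h x y x' y' hne
    -- Multiplying the commutation relation at `(x, y')` by `p x y` on the left and `p x' y'` on the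
    -- right isolates one coefficient on each side.
    have h1 : p x y * (∑ z, G.adjMatrix ℂ x z • p z y') * p x' y'
        = G.adjMatrix ℂ x x' • (p x y * p x' y') := by
      rw [mul_assoc, Finset.sum_mul, Finset.sum_eq_single x' (fun z _ hz => by
        rw [smul_mul_assoc, hp.col_orth _ _ _ hz, smul_zero]) (by simp), smul_mul_assoc,
        hp.mul_self, mul_smul_comm]
    have h2 : p x y * (∑ z, G.adjMatrix ℂ z y' • p x z) * p x' y'
        = G.adjMatrix ℂ y y' • (p x y * p x' y') := by
      rw [Finset.mul_sum, Finset.sum_eq_single y (fun z _ hz => by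
        rw [mul_smul_comm, hp.row_orth _ _ _ hz.symm, smul_zero]) (by simp), mul_smul_comm,
        hp.mul_self, smul_mul_assoc]
    rw [h, h2] at h1
    have h3 := sub_eq_zero.2 h1
    rw [← sub_smul, smul_eq_zero] at h3
    refine h3.resolve_left fun h4 => hne ?_
    by_cases hx : G.Adj x x' <;> by_cases hy : G.Adj y y' <;> simp [hx, hy] at h4 ⊢
  · intro h x y
    -- The full row of `x`, with sum `1`, is inserted; the coefficients are exchanged term by term;
    -- the column of `y` is then summed out.
    calc ∑ z, G.adjMatrix ℂ x z • p z y
        = ∑ z, ∑ w, G.adjMatrix ℂ x z • (p x w * p z y) := by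
          refine Finset.sum_congr rfl fun z _ => ?_
          rw [← Finset.smul_sum, ← Finset.sum_mul, hp.row_sum, one_mul]
      _ = ∑ z, ∑ w, G.adjMatrix ℂ w y • (p x w * p z y) := by
          refine Finset.sum_congr rfl fun z _ => Finset.sum_congr rfl fun w _ => ?_
          by_cases hxw : G.Adj x z = G.Adj w y
          · rw [hM hxw]
          · rw [h _ _ _ _ hxw, smul_zero, smul_zero]
      _ = ∑ w, G.adjMatrix ℂ w y • p x w := by
          rw [Finset.sum_comm]
          refine Finset.sum_congr rfl fun w _ => ?_
          rw [← Finset.smul_sum, ← Finset.mul_sum, hp.col_sum, mul_one]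

theorem isomorphic_ofGraph {V : Type} [Fintype V] [Nonempty V] (G : SimpleGraph V) :
    Isomorphic (ofColoring G.Adj) (ofGraph G) := by
  classical
  have h1 := ((ofColoring.magic G.Adj).commute_adjMatrix_iff G).2 (ofColoring.colorIso G.Adj).rel
  have hm := UniversalMagic.gen_magic (CommuteRel G)
  have h2 : ∀ x y, ∑ z, G.adjMatrix ℂ x z • UniversalMagic.gen (CommuteRel G) z y
      = ∑ z, G.adjMatrix ℂ z y • UniversalMagic.gen (CommuteRel G) x z := fun x y => by
    have := StarQuot.mk_eq (A := FreeStarAlgebra (V × V))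
      (MagicRel.rel (R := CommuteRel G) _ _ (CommuteRel.comm x y))
    rw [map_sum, map_sum] at this
    simp only [map_smul] at this
    convert this <;> rfl
  let f : (ofColoring G.Adj).coeff →⋆ₐ[ℂ] UniversalMagic V (CommuteRel G) :=
    ofColoring.lift _ hm ((hm.commute_adjMatrix_iff G).1 fun x y => by convert h2 x y)
  let g : UniversalMagic V (CommuteRel G) →⋆ₐ[ℂ] (ofColoring G.Adj).coeff :=
    UniversalMagic.lift (ofColoring.gen G.Adj) (ofColoring.magic G.Adj) fun a b hab => by
      obtain ⟨x, y⟩ := hab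
      simp only [map_sum, map_smul, FreeStarAlgebra.lift_of]
      convert h1 x y
  exact .of_entries (Γ := ofColoring G.Adj) (Λ := ofGraph G) (Equiv.refl V) f g
    (fun i j => ofColoring.lift_gen (B := UniversalMagic V (CommuteRel G)) _ _ _ _ _)
    fun i j => UniversalMagic.lift_gen _ _ _ _ _

theorem ofColoring_compl_isomorphic {V : Type} [Fintype V] [Nonempty V] (G : SimpleGraph V) :
    Isomorphic (ofColoring Gᶜ.Adj) (ofColoring G.Adj) :=
  ofColoring_isomorphic (Equiv.refl V) (ofColoring.colorIso G.Adj).compl.rel <| by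
    have := (ofColoring.colorIso Gᶜ.Adj).compl.rel
    rwa [compl_compl] at this

/-- A magic unitary that preserves adjacency preserves distances and eccentricities, and conversely
Gromov products determine adjacency: the two colourings impose the same relations. -/
theorem ofColoring_gromov_isomorphic {V : Type} [Fintype V] [Nonempty V] {G : SimpleGraph V}
    (hG : G.Connected) : Isomorphic (ofColoring G.gromov) (ofColoring G.Adj) :=
  ofColoring_isomorphic (Equiv.refl V) ((ofColoring.colorIso G.Adj).gromov hG hG).rel
    (ofColoring.colorIso G.gromov).of_gromov.rel

/-- Indecomposable ultrametric colourings have one point, so the decomposition starts from trivial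
groups only. -/
theorem ofColoring_mem_of_isTree {F : Set QuantumPermutationGroup} (hF : IsJordanClosed F)
    {V : Type} [Fintype V] [Nonempty V] {G : SimpleGraph V} (hG : G.IsTree) :
    ofColoring G.Adj ∈ F := by
  refine hF.of_isomorphic _ _ (ofColoring_gromov_isomorphic hG.connected)
    (ofColoring_mem_of_isRigid isHereditary_isUltrametricColor isRigid_isUltrametricColor hF
      (fun V _ _ c hc hconn => ?_) V _ ⟨G.gromov_comm, hG.gromov_ultrametric⟩)
  have := hc.subsingleton hconn
  exact hF.of_isomorphic _ _ (isomorphic_trivialGroup c) hF.trivialGroup_mem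

/-! ### A hereditary form of tree-cographs -/

/-- The adjacency relations of the graphs all of whose induced subgraphs are disconnected or
acyclic, up to complementation. -/
def IsHereditaryTreeCograph (V : Type) (c : V → V → Prop) : Prop :=
  ∃ G : SimpleGraph V, G.Adj = c ∧ ∀ (S : Type) (f : S → V), Function.Injective f →
    ¬ (G.comap f).Preconnected ∨ ¬ (G.comap f)ᶜ.Preconnected ∨
      (G.comap f).IsAcyclic ∨ (G.comap f)ᶜ.IsAcyclic

theorem _root_.SimpleGraph.comap_compl_of_injective {V S : Type} (G : SimpleGraph V) {f : S → V}
    (hf : Function.Injective f) : Gᶜ.comap f = (G.comap f)ᶜ := by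
  ext x y
  simp [hf.ne_iff]

/-- Induced subgraphs of trees are only forests, whence acyclicity in the hereditary condition. A
part of a disjoint sum either meets both sides, and is disconnected, or is an induced subgraph of
one of them. -/
theorem _root_.IsTreeCograph.isHereditaryTreeCograph {V : Type} {G : SimpleGraph V}
    (h : IsTreeCograph V G) : IsHereditaryTreeCograph V G.Adj := by
  refine ⟨G, rfl, ?_⟩
  induction h with
  | tree V G hG => exact fun S f hf => Or.inr (Or.inr (Or.inl (hG.isAcyclic.of_comap ⟨f, hf⟩)))
  | compl V G _ ih =>
    intro S f hf
    rw [G.comap_compl_of_injective hf, compl_compl]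
    have := ih S f hf
    tauto
  | iso V W G H hGH _ ih =>
    intro S f hf
    obtain ⟨φ⟩ := hGH
    have : H.comap f = G.comap (φ.symm ∘ f) := by
      ext x y
      simp [φ.symm.map_adj_iff]
    rw [this]
    exact ih S _ (φ.symm.injective.comp hf)
  | sum V W G H _ _ ihG ihH =>
    intro S f hf
    by_cases hmix : ∃ a b, (f a).isLeft ∧ (f b).isRight
    · obtain ⟨a, b, ha, hb⟩ := hmix
      refine Or.inl fun hconn => ?_
      obtain ⟨p⟩ := hconn a b
      have key : ∀ {x y : S} (p : ((G.sum H).comap f).Walk x y), (f x).isLeft → (f y).isLeft := by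
        intro x y p
        induction p with
        | nil => exact id
        | @cons x z y hxz p ih =>
          intro hx
          refine ih ?_
          have hadj : (G.sum H).Adj (f x) (f z) := hxz
          revert hadj hx
          rcases f x with x | x <;> rcases f z with z | z <;> simp
      have := key p ha
      revert this hb
      rcases f b <;> simp
    · push Not at hmix
      by_cases hl : ∀ a, (f a).isLeft
      · choose f' hf' using fun a => Sum.isLeft_iff.1 (hl a)
        have : (G.sum H).comap f = G.comap f' := by
          ext x y
          simp [hf']
        rw [this]
        refine ihG S f' fun x y hxy => hf ?_
        rw [hf', hf', hxy]
      · push Not at hl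
        obtain ⟨b, hb⟩ := hl
        have hr : ∀ a, (f a).isRight := fun a => by
          by_contra ha
          exact hmix a b (by simpa using ha) (by simpa using hb)
        choose f' hf' using fun a => Sum.isRight_iff.1 (hr a)
        have : (G.sum H).comap f = H.comap f' := by
          ext x y
          simp [hf']
        rw [this]
        refine ihH S f' fun x y hxy => hf ?_
        rw [hf', hf', hxy]

theorem isHereditary_isHereditaryTreeCograph : IsHereditary IsHereditaryTreeCograph where
  symm := by
    rintro V c ⟨G, rfl, -⟩ x y
    rw [G.adj_comm]
  restrict := by
    rintro V c ⟨G, rfl, hG⟩ S f hf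
    exact ⟨G.comap f, rfl, fun T g hg => by
      rw [SimpleGraph.comap_comap]
      exact hG T _ (hf.comp hg)⟩

/-- An indecomposable tree-cograph is a tree or the complement of a tree. -/
theorem IsHereditaryTreeCograph.exists_isTree {V : Type} [Nonempty V] {c : V → V → Prop}
    (hc : IsHereditaryTreeCograph V c)
    (hconn : ∀ α, (colorGraph c (isHereditary_isHereditaryTreeCograph.symm hc) α).Preconnected) :
    ∃ G : SimpleGraph V, G.Adj = c ∧ (G.IsTree ∨ Gᶜ.IsTree) := by
  have hs := isHereditary_isHereditaryTreeCograph.symm hc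
  obtain ⟨G, rfl, hG⟩ := id hc
  -- With colours in `Prop` there are two colour graphs, the graph itself and its complement.
  have h1 : colorGraph G.Adj hs False = G := by
    ext x y
    simpa [colorGraph] using fun h : G.Adj x y => h.ne
  have h2 : colorGraph G.Adj hs True = Gᶜ := by
    ext x y
    simp [colorGraph]
  have hG1 := hconn False
  have hG2 := hconn True
  rw [h1] at hG1
  rw [h2] at hG2
  refine ⟨G, rfl, ?_⟩
  have := hG V id Function.injective_id
  rw [SimpleGraph.comap_id] at this
  rcases this with h | h | h | h
  · exact (h hG1).elim
  · exact (h hG2).elim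
  · exact Or.inl ⟨⟨hG1⟩, h⟩
  · exact Or.inr ⟨⟨hG2⟩, h⟩

/-- Indecomposable colourings on a nonempty set are trees or complements of trees, and a tree is
isomorphic to any graph quantum isomorphic to it. The empty set is apart, since a tree has a vertex.
-/
theorem isRigid_isHereditaryTreeCograph : IsRigid IsHereditaryTreeCograph := by
  refine isHereditary_isHereditaryTreeCograph.isRigid
    fun V W A _ _ _ _ e c d u hc hd he hconn h => ?_
  rcases isEmpty_or_nonempty V with hV | hV
  · exact h.colorEquiv_of_subsingleton he
  · obtain ⟨G, rfl, hG⟩ := hc.exists_isTree hconn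
    obtain ⟨H, rfl, -⟩ := hd
    rcases hG with hG | hG
    · exact h.colorEquiv_of_isTree he hG
    · obtain ⟨f, hf⟩ := h.compl.colorEquiv_of_isTree he hG
      refine ⟨f, fun x y => ?_⟩
      by_cases hxy : x = y
      · simp [hxy]
      · have := hf x y
        simpa [hxy, not_iff_not] using this

/-- The decomposition is run twice: along adjacency down to trees and their complements, then along
Gromov products down to points. -/
theorem quantumAutFamily_isTreeCograph_subset {F : Set QuantumPermutationGroup}
    (hF : IsJordanClosed F) : quantumAutFamily IsTreeCograph ⊆ F := by
  rintro Γ ⟨V, _, _, G, hG, hΓ⟩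
  refine hF.of_isomorphic _ _ ((isomorphic_ofGraph G).trans hΓ)
    (ofColoring_mem_of_isRigid isHereditary_isHereditaryTreeCograph isRigid_isHereditaryTreeCograph
      hF (fun V _ _ c hc hconn => ?_) V _ hG.isHereditaryTreeCograph)
  obtain ⟨G, rfl, hG | hG⟩ := hc.exists_isTree hconn
  · exact ofColoring_mem_of_isTree hF hG
  · exact hF.of_isomorphic _ _ (ofColoring_compl_isomorphic G) (ofColoring_mem_of_isTree hF hG)

end QuantumPermutationGroup

/-! ## Rooted trees -/

/-- A finite rooted tree, described by the parent and the depth of each vertex. -/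
structure FiniteRootedTree : Type 1 where
  V : Type
  [fintype : Fintype V]
  root : V
  parent : V → V
  depth : V → ℕ
  depth_root : depth root = 0
  depth_parent : ∀ x, x ≠ root → depth x = depth (parent x) + 1

namespace FiniteRootedTree

attribute [instance] fintype

instance (T : FiniteRootedTree) : Nonempty T.V := ⟨T.root⟩

variable (T : FiniteRootedTree)

/-- The graph of a rooted tree. -/
def graph : SimpleGraph T.V where
  Adj x y := (x ≠ T.root ∧ T.parent x = y) ∨ (y ≠ T.root ∧ T.parent y = x)
  symm := ⟨fun _ _ h => h.symm⟩
  loopless := ⟨fun x h => by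
    have : x ≠ T.root ∧ T.parent x = x := h.elim id id
    have h1 := T.depth_parent x this.1
    rw [this.2] at h1
    omega⟩

variable {T}

theorem graph_adj {x y : T.V} : T.graph.Adj x y ↔
    (x ≠ T.root ∧ T.parent x = y) ∨ (y ≠ T.root ∧ T.parent y = x) :=
  Iff.rfl

theorem adj_parent {x : T.V} (hx : x ≠ T.root) : T.graph.Adj (T.parent x) x :=
  Or.inr ⟨hx, rfl⟩

theorem depth_eq_zero {x : T.V} : T.depth x = 0 ↔ x = T.root := by
  refine ⟨fun h => ?_, fun h => h ▸ T.depth_root⟩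
  by_contra hx
  have := T.depth_parent x hx
  omega

theorem depth_le_of_adj {x y : T.V} (h : T.graph.Adj x y) : T.depth y ≤ T.depth x + 1 := by
  rcases h with ⟨hx, rfl⟩ | ⟨hy, rfl⟩
  · have := T.depth_parent x hx
    omega
  · exact (T.depth_parent y hy).le

theorem depth_le_length {x y : T.V} (p : T.graph.Walk x y) :
    T.depth y ≤ T.depth x + p.length := by
  induction p with
  | nil => simp
  | cons h p ih =>
    have := depth_le_of_adj h
    rw [SimpleGraph.Walk.length_cons]
    omega

theorem exists_walk (x : T.V) : ∃ p : T.graph.Walk T.root x, p.length = T.depth x := by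
  obtain ⟨n, hn⟩ : ∃ n, T.depth x = n := ⟨_, rfl⟩
  induction n generalizing x with
  | zero =>
    obtain rfl := depth_eq_zero.1 hn
    exact ⟨SimpleGraph.Walk.nil, hn.symm⟩
  | succ n ih =>
    have hx : x ≠ T.root := fun h => by
      rw [h, T.depth_root] at hn
      omega
    have h1 := T.depth_parent x hx
    obtain ⟨p, hp⟩ := ih (T.parent x) (by omega)
    refine ⟨p.concat (adj_parent hx), ?_⟩
    rw [SimpleGraph.Walk.length_concat, hp, h1]

variable (T)

theorem connected : T.graph.Connected := by
  refine ⟨fun x y => ?_⟩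
  obtain ⟨p, -⟩ := exists_walk x
  obtain ⟨q, -⟩ := exists_walk y
  exact p.reachable.symm.trans q.reachable

/-- The vertices other than the root correspond to the edges towards their parents. Injectivity
holds because depths prevent two vertices from being each other's parent. -/
theorem isTree : T.graph.IsTree := by
  classical
  rw [SimpleGraph.isTree_iff_connected_and_card]
  refine ⟨T.connected, ?_⟩
  let f : {x // x ≠ T.root} → T.graph.edgeSet := fun x =>
    ⟨s(x.1, T.parent x.1), (adj_parent x.2).symm⟩
  have hf : Function.Bijective f := by
    constructor
    · rintro ⟨x, hx⟩ ⟨y, hy⟩ hxy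
      have hxy' : s(x, T.parent x) = s(y, T.parent y) := congrArg Subtype.val hxy
      rw [Sym2.eq_iff] at hxy'
      rcases hxy' with h | h
      · exact Subtype.ext h.1
      · have h1 := T.depth_parent x hx
        have h2 := T.depth_parent y hy
        rw [h.2] at h1
        rw [← h.1] at h2
        omega
    · rintro ⟨s, hs⟩
      induction s using Sym2.ind with | _ x y => ?_
      rcases hs with ⟨hx, h⟩ | ⟨hy, h⟩
      · exact ⟨⟨x, hx⟩, Subtype.ext (congrArg (fun z => s(x, z)) h)⟩
      · exact ⟨⟨y, hy⟩, Subtype.ext ((congrArg (fun z => s(y, z)) h).trans Sym2.eq_swap)⟩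
  rw [← Nat.card_congr (Equiv.ofBijective f hf), Nat.card_eq_fintype_card,
    Nat.card_eq_fintype_card]
  have h1 : Fintype.card {x // x ≠ T.root} = Fintype.card T.V - 1 := by
    simp [Fintype.card_subtype_compl]
  have h2 : 0 < Fintype.card T.V := Fintype.card_pos
  omega

/-- The colouring of the pairs of vertices by their depths and their adjacency. -/
def color (x y : T.V) : ℕ × ℕ × Prop := (T.depth x, T.depth y, T.graph.Adj x y)

/-- The quantum automorphism group of a rooted tree. -/
noncomputable def qaut : QuantumPermutationGroup := QuantumPermutationGroup.ofColoring T.color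

variable {T} in
theorem color_eq_iff {S : FiniteRootedTree} {x x' : T.V} {y y' : S.V} :
    T.color x x' = S.color y y' ↔ T.depth x = S.depth y ∧ T.depth x' = S.depth y' ∧
      (T.graph.Adj x x' ↔ S.graph.Adj y y') := by
  simp [color]

/-- The rooted tree with one vertex. -/
def point : FiniteRootedTree where
  V := Unit
  root := ()
  parent := id
  depth _ := 0
  depth_root := rfl
  depth_parent _ h := (h rfl).elim

theorem point_qaut : QuantumPermutationGroup.trivialGroup.Isomorphic point.qaut :=
  have : Subsingleton point.V := inferInstanceAs (Subsingleton Unit)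
  QuantumPermutationGroup.isomorphic_trivialGroup point.color

/-! ### Grafts and free products -/

open scoped Classical in
/-- Grafting a rooted tree on the root of another. -/
noncomputable def graft (S T : FiniteRootedTree) : FiniteRootedTree where
  V := S.V ⊕ T.V
  root := .inl S.root
  parent := Sum.elim (fun x => .inl (S.parent x))
    fun y => if y = T.root then .inl S.root else .inr (T.parent y)
  depth := Sum.elim S.depth fun y => T.depth y + 1
  depth_root := S.depth_root
  depth_parent := by
    rintro (x | y) h
    · exact S.depth_parent x fun hx => h (by rw [hx])
    · by_cases hy : y = T.root
      · simp [hy, T.depth_root, S.depth_root]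
      · simp [hy, T.depth_parent y hy]

section graft

variable {S T : FiniteRootedTree}

/-- The inclusion of the trunk of a graft. -/
def trunk (x : S.V) : (graft S T).V := .inl x

/-- The inclusion of the branch of a graft. -/
def branch (y : T.V) : (graft S T).V := .inr y

theorem depth_trunk (x : S.V) : (graft S T).depth (trunk x) = S.depth x := rfl

theorem depth_branch (y : T.V) : (graft S T).depth (branch y) = T.depth y + 1 := rfl

theorem adj_trunk {x y : S.V} :
    (graft S T).graph.Adj (trunk x) (trunk y) ↔ S.graph.Adj x y := by
  simp [graph_adj, graft, trunk]

theorem adj_trunk_branch {x : S.V} {y : T.V} :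
    (graft S T).graph.Adj (trunk x) (branch y) ↔ x = S.root ∧ y = T.root := by
  by_cases hy : y = T.root <;> simp [graph_adj, graft, trunk, branch, hy, eq_comm]

theorem adj_branch_trunk {x : S.V} {y : T.V} :
    (graft S T).graph.Adj (branch y) (trunk x) ↔ x = S.root ∧ y = T.root := by
  rw [SimpleGraph.adj_comm, adj_trunk_branch]

theorem adj_branch {x y : T.V} :
    (graft S T).graph.Adj (branch x) (branch y) ↔ T.graph.Adj x y := by
  by_cases hx : x = T.root <;> by_cases hy : y = T.root <;>
    simp [graph_adj, graft, branch, hx, hy]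

open scoped Classical in
theorem degree_eq_sum {V : Type} [Fintype V] (G : SimpleGraph V) (x : V) :
    G.degree x = ∑ y, if G.Adj x y then 1 else 0 := by
  rw [← G.card_neighborFinset_eq_degree, ← Finset.card_filter]
  congr 1
  ext y
  simp

open scoped Classical in
theorem degree_trunk (x : S.V) : (graft S T).graph.degree (trunk x)
    = S.graph.degree x + if x = S.root then 1 else 0 := by
  rw [degree_eq_sum, degree_eq_sum]
  refine (Fintype.sum_sum_type _).trans (congrArg₂ _ ?_ ?_)
  · exact Finset.sum_congr rfl fun y _ => if_congr adj_trunk rfl rfl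
  · refine (Finset.sum_congr rfl fun y _ => if_congr adj_trunk_branch rfl rfl).trans ?_
    by_cases hx : x = S.root <;> simp [hx]

open scoped Classical in
theorem degree_branch (y : T.V) : (graft S T).graph.degree (branch y)
    = T.graph.degree y + if y = T.root then 1 else 0 := by
  rw [degree_eq_sum, degree_eq_sum, add_comm]
  refine (Fintype.sum_sum_type _).trans (congrArg₂ _ ?_ ?_)
  · refine (Finset.sum_congr rfl fun x _ => if_congr adj_branch_trunk rfl rfl).trans ?_
    by_cases hy : y = T.root <;> simp [hy]
  · exact Finset.sum_congr rfl fun y _ => if_congr adj_branch rfl rfl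

/-- If the branch is higher than the trunk, they are not mixed by quantum automorphisms. -/
theorem eq_zero_of_graft {A : Type} [Ring A] {e : A} {u : (graft S T).V → (graft S T).V → A}
    (h : ColorIso e (graft S T).color (graft S T).color u)
    {z : T.V} (hz : ∀ x, S.depth x ≤ T.depth z) (x : S.V) (y : T.V) :
    u (trunk x) (branch y) = 0 := by
  by_cases hx : x = S.root
  · refine h.diag fun hc => ?_
    have := (color_eq_iff.1 hc).1
    rw [depth_trunk, depth_branch, hx, S.depth_root] at this
    omega
  -- `K` keeps the edges between vertices of positive depth; it is preserved because colours include
  -- depths. The branch stays connected in `K`, so it reaches `branch z`, which is deeper than the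
  -- whole trunk, but `K` no longer links it to the trunk.
  let K : SimpleGraph (graft S T).V :=
    { Adj := fun a b => (graft S T).depth a ≠ 0 ∧ (graft S T).depth b ≠ 0 ∧
        (graft S T).graph.Adj a b
      symm := ⟨fun a b hab => ⟨hab.2.1, hab.1, hab.2.2.symm⟩⟩
      loopless := ⟨fun a ha => ha.2.2.ne rfl⟩ }
  have hadj : ∀ a b a' b', K.Adj a a' → ¬ K.Adj b b' → u b a * u b' a' = 0 := by
    intro a b a' b' h1 h2
    refine h.transpose.rel _ _ _ _ fun hc => h2 ?_
    obtain ⟨hc1, hc2, hc3⟩ := color_eq_iff.1 hc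
    exact ⟨hc1 ▸ h1.1, hc2 ▸ h1.2.1, hc3.1 h1.2.2⟩
  have hreach : K.Reachable (branch y) (branch z) := by
    let φ : T.graph →g K := ⟨branch, fun {a b} hab =>
      ⟨by rw [depth_branch]; omega, by rw [depth_branch]; omega, adj_branch.2 hab⟩⟩
    exact (T.connected.preconnected y z).map φ
  have hstay : ∀ {a b : (graft S T).V} (p : K.Walk a b), (∃ x, a = trunk x) →
      ∃ x, b = trunk x := by
    intro a b p
    induction p with
    | nil => exact id
    | @cons a m b ham p ih =>
      rintro ⟨x, rfl⟩
      refine ih ?_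
      rcases m with m | m
      · exact ⟨m, rfl⟩
      · have := (adj_trunk_branch (T := T)).1 ham.2.2
        exact (ham.1 (by rw [depth_trunk, this.1, S.depth_root])).elim
  -- In the column of `branch z`, the trunk entries vanish by depth and the branch entries are
  -- killed by connectedness in `K`.
  refine h.transpose.eq_zero_of_row' (branch z) fun w => ?_
  rcases w with w | w
  · have hw : u (trunk w) (branch z) = 0 := h.diag fun hc => by
      have := (color_eq_iff.1 hc).1
      rw [depth_trunk, depth_branch] at this
      have := hz w
      omega
    exact (congrArg (_ * ·) hw).trans (mul_zero _)
  · refine h.transpose.mul_eq_zero_of_reachable hadj hreach ?_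
    rintro ⟨p⟩
    obtain ⟨x', hx'⟩ := hstay p ⟨x, rfl⟩
    cases hx'

/-- The height of the branch keeps it apart from the trunk. The only edge between them joins the two
roots, the vertices of depth zero, so the colours across are determined by depths and impose no
other relation. -/
theorem graft_qaut {z : T.V} (hz : ∀ x, S.depth x ≤ T.depth z) :
    (graft S T).qaut.Isomorphic (S.qaut.freeProduct T.qaut) := by
  have hU := QuantumPermutationGroup.ofColoring.colorIso (graft S T).color
  have hS := QuantumPermutationGroup.ofColoring.colorIso S.color
  have hT := QuantumPermutationGroup.ofColoring.colorIso T.color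
  have hcr : ∀ {x y : S.V} {x' y' : T.V}, S.depth x = S.depth y → T.depth x' = T.depth y' →
      ((x = S.root ∧ x' = T.root) ↔ (y = S.root ∧ y' = T.root)) := by
    intro x y x' y' h1 h2
    rw [← depth_eq_zero, ← depth_eq_zero, ← depth_eq_zero, ← depth_eq_zero, h1, h2]
  refine QuantumPermutationGroup.ofColoring_sum_isomorphic (V := S.V) (W := T.V)
    (c := (graft S T).color) (c₁ := S.color) (c₂ := T.color) (fun x y => eq_zero_of_graft hU hz x y)
    (fun x y => eq_zero_of_graft hU.transpose hz y x) (fun x y x' y' h => ?_)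
    (fun x y x' y' h => ?_) (fun x y x' y' h => ?_) (fun x y x' y' h => ?_)
    (fun x y x' y' h => ?_)
  · refine hU.rel (trunk x) (trunk y) (trunk x') (trunk y') fun hc => h ?_
    simpa [color_eq_iff, depth_trunk, adj_trunk] using hc
  · refine hU.rel (branch x) (branch y) (branch x') (branch y') fun hc => h ?_
    simpa [color_eq_iff, depth_branch, adj_branch] using hc
  · refine hS.rel _ _ _ _ fun hc => h ?_
    refine (color_eq_iff (x := trunk x) (x' := trunk x') (y := trunk y) (y' := trunk y')).2 ?_
    simpa [color_eq_iff, depth_trunk, adj_trunk] using hc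
  · refine hT.rel _ _ _ _ fun hc => h ?_
    refine (color_eq_iff (x := branch x) (x' := branch x') (y := branch y) (y' := branch y')).2 ?_
    simpa [color_eq_iff, depth_branch, adj_branch] using hc
  · by_cases h1 : S.depth x = S.depth y
    · by_cases h2 : T.depth x' = T.depth y'
      · rcases h with h | h
        · refine (h ((color_eq_iff (x := trunk x) (x' := branch x') (y := trunk y)
            (y' := branch y')).2 ?_)).elim
          simpa [depth_trunk, depth_branch, adj_trunk_branch, h1, h2] using hcr h1 h2
        · refine (h ((color_eq_iff (x := branch x') (x' := trunk x) (y := branch y')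
            (y' := trunk y)).2 ?_)).elim
          simpa [depth_trunk, depth_branch, adj_branch_trunk, h1, h2] using hcr h1 h2
      · exact Or.inr (hT.diag fun hc => h2 (color_eq_iff.1 hc).1)
    · exact Or.inl (hS.diag fun hc => h1 (color_eq_iff.1 hc).1)

end graft

/-- Grafting on a point lengthens the stem by one edge; any branch is high enough for this. -/
theorem graft_point_qaut : T.qaut.Isomorphic (graft point T).qaut :=
  (QuantumPermutationGroup.freeProduct_trivial_left _).trans
    ((QuantumPermutationGroup.freeProduct_congr point_qaut (.refl _)).trans
      (graft_qaut (z := T.root) fun _ => Nat.zero_le _).symm)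

theorem exists_depth_ge (k : ℕ) : ∃ S : FiniteRootedTree, T.qaut.Isomorphic S.qaut ∧
    ∃ z, k ≤ S.depth z := by
  induction k with
  | zero => exact ⟨T, .refl _, T.root, Nat.zero_le _⟩
  | succ k ih =>
    obtain ⟨S, hS, z, hz⟩ := ih
    exact ⟨graft point S, hS.trans S.graft_point_qaut, branch z, by rw [depth_branch]; omega⟩

/-! ### Making the root recognisable by its degree -/

open scoped Classical in
/-- Paths, rooted at an end. -/
theorem exists_path (k : ℕ) : ∃ S : FiniteRootedTree,
    QuantumPermutationGroup.trivialGroup.Isomorphic S.qaut ∧ (∃ z, k ≤ S.depth z) ∧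
    S.graph.degree S.root ≤ 1 ∧ ∀ x, S.graph.degree x ≤ 2 := by
  induction k with
  | zero =>
    have hd : ∀ x, point.graph.degree x = 0 := fun x => by
      rw [degree_eq_sum]
      exact Finset.sum_eq_zero fun y _ => if_neg fun h => h.ne rfl
    exact ⟨point, point_qaut, ⟨point.root, Nat.zero_le _⟩, by simp [hd], by simp [hd]⟩
  | succ k ih =>
    obtain ⟨S, hS, ⟨z, hz⟩, h1, h2⟩ := ih
    have hd : ∀ x, (graft point S).graph.degree (trunk x) ≤ 1 := fun x => by
      have : point.graph.degree x = 0 := by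
        rw [degree_eq_sum]
        exact Finset.sum_eq_zero fun y _ => if_neg fun h => h.ne rfl
      rw [degree_trunk, this]
      split_ifs <;> simp
    refine ⟨graft point S, hS.trans S.graft_point_qaut,
      ⟨branch z, by rw [depth_branch]; omega⟩, hd _, ?_⟩
    rintro (x | y)
    · exact (hd x).trans (by norm_num)
    · refine (degree_branch (S := point) y).le.trans ?_
      have := h2 y
      split_ifs with hy
      · rw [hy]; omega
      · omega

-- A path grafted at the root raises its degree by one and contributes a trivial free factor,
-- provided that it is as high as the current tree. The bound on the other degrees does not depend
-- on `k`: the other vertices of `T` keep their degrees, and those of the paths have degree at most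
-- `2`.
open scoped Classical in
theorem exists_degree_root_ge (k : ℕ) : ∃ S : FiniteRootedTree, T.qaut.Isomorphic S.qaut ∧
    k ≤ S.graph.degree S.root ∧ ∀ x, x ≠ S.root → S.graph.degree x ≤ Fintype.card T.V + 2 := by
  induction k with
  | zero => exact ⟨T, .refl _, Nat.zero_le _, fun x _ =>
      (T.graph.degree_lt_card_verts x).le.trans (Nat.le_add_right _ _)⟩
  | succ k ih =>
    obtain ⟨S, hS, h1, h2⟩ := ih
    obtain ⟨P, hP, ⟨z, hz⟩, h4, h3⟩ := exists_path (Finset.univ.sup S.depth)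
    refine ⟨graft S P, hS.trans ((QuantumPermutationGroup.freeProduct_trivial_right _).trans
      ((QuantumPermutationGroup.freeProduct_congr (.refl _) hP).trans
        (graft_qaut (z := z) fun x => (Finset.le_sup (Finset.mem_univ x)).trans hz).symm)), ?_, ?_⟩
    · refine le_trans ?_ (degree_trunk S.root).ge
      rw [if_pos rfl]
      omega
    · rintro (x | y) hx
      · have hx' : x ≠ S.root := fun h => hx (by rw [h]; rfl)
        refine (degree_trunk x).le.trans ?_
        rw [if_neg hx']
        exact h2 x hx'
      · refine (degree_branch y).le.trans ?_
        have := h3 y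
        split_ifs with hy
        · rw [hy]; omega
        · omega

/-- If the degree of the root is larger than all the other degrees, the quantum automorphisms of
the graph fix the root. -/
theorem isomorphic_ofColoring_adj [DecidableRel T.graph.Adj]
    (hT : ∀ x, x ≠ T.root → T.graph.degree x < T.graph.degree T.root) :
    (QuantumPermutationGroup.ofColoring T.graph.Adj).Isomorphic T.qaut := by
  have hroot : ∀ {A : Type} [Ring A] [Algebra ℂ A] {e : A} {u : T.V → T.V → A}
      (_ : ColorIso e T.graph.Adj T.graph.Adj u) (y : T.V), y ≠ T.root → u T.root y = 0 := by
    intro A _ _ e u h y hy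
    refine h.eq_zero_of_degree ?_
    convert (hT y hy).ne'
  have hlt : ∀ {A : Type} [Ring A] [Algebra ℂ A] {e : A} {u : T.V → T.V → A}
      (_ : ColorIso e T.graph.Adj T.graph.Adj u) (x y : T.V), T.depth x < T.depth y →
      u x y = 0 := by
    intro A _ _ e u h x y hxy
    -- The row of the root is concentrated at the root. A walk of length `T.depth x` leads from the
    -- root to `x`, but none of this length leads to the deeper vertex `y`.
    refine h.eq_zero_of_row T.root fun w => ?_
    by_cases hw : w = T.root
    · rw [hw]
      obtain ⟨p, hp⟩ := exists_walk x
      refine h.mul_eq_zero_of_walk h.mul_eq_zero_of_adj p fun q hq => ?_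
      have := depth_le_length q
      rw [T.depth_root] at this
      omega
    · rw [hroot h w hw, zero_mul]
  have hU := QuantumPermutationGroup.ofColoring.colorIso T.graph.Adj
  refine QuantumPermutationGroup.ofColoring_isomorphic (Equiv.refl T.V) (fun x y x' y' h => ?_)
    (fun x y x' y' h => ?_)
  · refine (QuantumPermutationGroup.ofColoring.colorIso T.color).rel _ _ _ _ fun hc => h ?_
    exact propext (color_eq_iff.1 hc).2.2
  · have hd : ∀ x y, T.depth x ≠ T.depth y →
        QuantumPermutationGroup.ofColoring.gen T.graph.Adj x y = 0 := fun x y hxy => by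
      rcases hxy.lt_or_gt with hxy | hxy
      · exact hlt hU x y hxy
      · exact hlt hU.transpose y x hxy
    by_cases h1 : T.depth x = T.depth y
    · by_cases h2 : T.depth x' = T.depth y'
      · exact hU.rel _ _ _ _ fun hc => h (color_eq_iff.2 ⟨h1, h2, hc.to_iff⟩)
      · rw [hd _ _ h2, mul_zero]
    · rw [hd _ _ h1, zero_mul]

/-! ### Bouquets and wreath products -/

open scoped Classical in
/-- Grafting `n` copies of a rooted tree on a new root. -/
noncomputable def bouquet (n : ℕ) : FiniteRootedTree where
  V := Unit ⊕ (Fin n × T.V)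
  root := .inl ()
  parent := Sum.elim .inl fun x => if x.2 = T.root then .inl () else .inr (x.1, T.parent x.2)
  depth := Sum.elim (fun _ => 0) fun x => T.depth x.2 + 1
  depth_root := rfl
  depth_parent := by
    rintro (x | ⟨i, x⟩) h
    · exact (h rfl).elim
    · by_cases hx : x = T.root
      · simp [hx, T.depth_root]
      · simp [hx, T.depth_parent x hx]

/-- The graph consisting of `n` copies of a rooted tree. -/
def copies (n : ℕ) : SimpleGraph (Fin n × T.V) where
  Adj x y := x.1 = y.1 ∧ T.graph.Adj x.2 y.2
  symm := ⟨fun _ _ h => ⟨h.1.symm, h.2.symm⟩⟩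
  loopless := ⟨fun _ h => h.2.ne rfl⟩

theorem copies_reachable {n : ℕ} {x y : Fin n × T.V} :
    (T.copies n).Reachable x y ↔ x.1 = y.1 := by
  constructor
  · rintro ⟨p⟩
    induction p with
    | nil => rfl
    | cons h _ ih => exact h.1.trans ih
  · obtain ⟨i, x⟩ := x
    obtain ⟨j, y⟩ := y
    rintro (rfl : i = j)
    let φ : T.graph →g T.copies n := ⟨fun x => (i, x), fun hab => ⟨rfl, hab⟩⟩
    exact (T.connected.preconnected x y).map φ

theorem bouquet_adj_inr {n : ℕ} {x y : Fin n × T.V} :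
    (T.bouquet n).graph.Adj (.inr x) (.inr y) ↔ (T.copies n).Adj x y := by
  obtain ⟨i, x⟩ := x
  obtain ⟨j, y⟩ := y
  by_cases hx : x = T.root <;> by_cases hy : y = T.root <;>
    (simp [graph_adj, bouquet, copies, hx, hy, eq_comm]; try tauto)

theorem bouquet_adj_inr_inl {n : ℕ} {x : Unit} {y : Fin n × T.V} :
    (T.bouquet n).graph.Adj (.inr y) (.inl x) ↔ T.depth y.2 = 0 := by
  rw [depth_eq_zero]
  by_cases hy : y.2 = T.root <;> simp [graph_adj, bouquet, hy]

theorem bouquet_adj_inl_inr {n : ℕ} {x : Unit} {y : Fin n × T.V} :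
    (T.bouquet n).graph.Adj (.inl x) (.inr y) ↔ T.depth y.2 = 0 := by
  rw [depth_eq_zero]
  by_cases hy : y.2 = T.root <;> simp [graph_adj, bouquet, hy]

/-- The colouring of the pairs of vertices of several copies of a rooted tree. -/
def copiesColor (n : ℕ) (x y : Fin n × T.V) : ℕ × ℕ × Prop :=
  (T.depth x.2, T.depth y.2, (T.copies n).Adj x y)

/-- The connected components are the copies, so these are permuted as blocks. Vertices of different
copies are not adjacent: their colour only records depths, which each entry already preserves. -/
theorem copies_isomorphic (n : ℕ) [NeZero n] :
    (QuantumPermutationGroup.ofColoring (T.copiesColor n)).Isomorphic (T.qaut.wreath n) := by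
  have hU := QuantumPermutationGroup.ofColoring.colorIso (T.copiesColor n)
  have hT := QuantumPermutationGroup.ofColoring.colorIso T.color
  have hA : ColorIso 1 (T.copies n).Adj (T.copies n).Adj
      (QuantumPermutationGroup.ofColoring.gen (T.copiesColor n)) :=
    hU.of_rel fun x y x' y' h => hU.rel _ _ _ _ fun hc => h (congrArg (fun t => t.2.2) hc)
  refine QuantumPermutationGroup.ofColoring_wreath_isomorphic (c₀ := T.color)
    (fun i i' j j' k k' l l' h => ?_) (fun i j k k' l l' h => ?_) (fun i j k k' l l' h => ?_)
    (fun i i' j j' k k' l l' hi hj h => ?_)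
  · by_cases hi : i = i'
    · exact hA.mul_eq_zero_of_reachable hA.mul_eq_zero_of_adj (T.copies_reachable.2 hi)
        fun hr => h.1 hi (T.copies_reachable.1 hr)
    · have hj : j = j' := by
        by_contra hj
        exact hi (h.2 hj)
      exact hA.transpose.mul_eq_zero_of_reachable hA.transpose.mul_eq_zero_of_adj
        (T.copies_reachable.2 hj) fun hr => hi (T.copies_reachable.1 hr)
  · exact hU.rel _ _ _ _ fun hc => h (by simpa [copiesColor, copies, color] using hc)
  · exact hT.rel _ _ _ _ fun hc => h (by simpa [copiesColor, copies, color] using hc)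
  · by_cases h1 : T.depth k = T.depth l
    · refine Or.inr (hT.diag fun hc => h ?_)
      have h2 := (color_eq_iff.1 hc).1
      simp [copiesColor, copies, hi, hj, h1, h2]
    · exact Or.inl (hT.diag fun hc => h1 (color_eq_iff.1 hc).1)

/-- The new root is the only vertex of depth zero, so it splits off as a trivial free factor. Its
neighbours are the roots of the copies, already recognised by their depth. -/
theorem bouquet_isomorphic (n : ℕ) [NeZero n] :
    (T.bouquet n).qaut.Isomorphic (T.qaut.wreath n) := by
  have : Nonempty (Fin n × T.V) := ⟨(0, T.root)⟩
  have hU := QuantumPermutationGroup.ofColoring.colorIso (T.bouquet n).color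
  have hC := QuantumPermutationGroup.ofColoring.colorIso (T.copiesColor n)
  have key : (T.bouquet n).qaut.Isomorphic
      ((QuantumPermutationGroup.ofColoring fun _ _ : Unit => ()).freeProduct
        (QuantumPermutationGroup.ofColoring (T.copiesColor n))) := by
    refine QuantumPermutationGroup.ofColoring_sum_isomorphic (V := Unit) (W := Fin n × T.V)
      (c := (T.bouquet n).color) (fun x y => ?_) (fun x y => ?_) (fun x y x' y' h => (h rfl).elim)
      (fun x y x' y' h => ?_) (fun x y x' y' h => (h rfl).elim) (fun x y x' y' h => ?_)
      (fun x y x' y' h => ?_)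
    · exact hU.diag (x := .inl x) (y := .inr y) fun hc => by
        simpa [bouquet] using (color_eq_iff.1 hc).1
    · exact hU.diag (x := .inr x) (y := .inl y) fun hc => by
        simpa [bouquet] using (color_eq_iff.1 hc).1
    · refine hU.rel (.inr x) (.inr y) (.inr x') (.inr y') fun hc => h ?_
      obtain ⟨h1, h2, h3⟩ := color_eq_iff.1 hc
      rw [bouquet_adj_inr, bouquet_adj_inr] at h3
      simp only [copiesColor, Prod.mk.injEq]
      exact ⟨by simpa [bouquet] using h1, by simpa [bouquet] using h2, propext h3⟩
    · refine hC.rel _ _ _ _ fun hc => h ?_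
      simp only [copiesColor, Prod.mk.injEq] at hc
      obtain ⟨h1, h2, h3⟩ := hc
      refine (color_eq_iff (T := T.bouquet n) (S := T.bouquet n)
        (x := .inr x) (x' := .inr x') (y := .inr y) (y' := .inr y')).2 ?_
      rw [bouquet_adj_inr, bouquet_adj_inr]
      exact ⟨by simpa [bouquet] using h1, by simpa [bouquet] using h2, h3.to_iff⟩
    · refine Or.inr (hC.diag fun hc => ?_)
      have h1 : T.depth x'.2 = T.depth y'.2 := congrArg Prod.fst hc
      rcases h with h | h
      · refine h ((color_eq_iff (T := T.bouquet n) (S := T.bouquet n)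
          (x := .inl x) (x' := .inr x') (y := .inl y) (y' := .inr y')).2 ?_)
        rw [bouquet_adj_inl_inr, bouquet_adj_inl_inr, h1]
        exact ⟨rfl, by simpa [bouquet] using h1, Iff.rfl⟩
      · refine h ((color_eq_iff (T := T.bouquet n) (S := T.bouquet n)
          (x := .inr x') (x' := .inl x) (y := .inr y') (y' := .inl y)).2 ?_)
        rw [bouquet_adj_inr_inl, bouquet_adj_inr_inl, h1]
        exact ⟨by simpa [bouquet] using h1, rfl, Iff.rfl⟩
  exact key.trans ((QuantumPermutationGroup.freeProduct_congr
    (QuantumPermutationGroup.isomorphic_trivialGroup _).symm (.refl _)).trans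
      ((QuantumPermutationGroup.freeProduct_trivial_left _).symm.trans (T.copies_isomorphic n)))

end FiniteRootedTree

/-! ### Comparison of the families -/

namespace QuantumPermutationGroup

/-- The quantum groups which are isomorphic to the quantum automorphism group of a rooted tree. -/
def rootedTreeFamily : Set QuantumPermutationGroup :=
  {Γ | ∃ T : FiniteRootedTree, T.qaut.Isomorphic Γ}

theorem isJordanClosed_rootedTreeFamily : IsJordanClosed rootedTreeFamily where
  of_isomorphic := by
    rintro Γ Λ h ⟨T, hT⟩
    exact ⟨T, hT.trans h⟩
  trivialGroup_mem := ⟨FiniteRootedTree.point, FiniteRootedTree.point_qaut.symm⟩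
  freeProduct_mem := by
    rintro Γ ⟨S, hS⟩ Λ ⟨T, hT⟩
    -- `graft_qaut` needs a branch at least as high as the trunk, so the stem of `T` is lengthened
    -- first.
    obtain ⟨T', hT', z, hz⟩ := T.exists_depth_ge (Finset.univ.sup S.depth)
    exact ⟨S.graft T', (FiniteRootedTree.graft_qaut (z := z) fun x =>
      (Finset.le_sup (Finset.mem_univ x)).trans hz).trans
        (freeProduct_congr hS (hT'.symm.trans hT))⟩
  wreath_mem := by
    rintro Γ ⟨T, hT⟩ n _
    exact ⟨T.bouquet n, (T.bouquet_isomorphic n).trans (wreath_congr hT n)⟩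

theorem rootedTreeFamily_subset :
    rootedTreeFamily ⊆ quantumAutFamily (fun _ G => G.IsTree) := by
  classical
  rintro Γ ⟨T, hT⟩
  -- The other degrees are at most `Fintype.card T.V + 2`, so this makes the degree of the root
  -- strictly the largest.
  obtain ⟨S, hS, h1, h2⟩ := T.exists_degree_root_ge (Fintype.card T.V + 3)
  refine ⟨S.V, S.fintype, inferInstance, S.graph, S.isTree, (isomorphic_ofGraph _).symm.trans
    ((S.isomorphic_ofColoring_adj fun x hx => ?_).trans (hS.symm.trans hT))⟩
  have := h2 x hx
  convert lt_of_lt_of_le (Nat.lt_succ_of_le this) h1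

theorem isTree_family_subset :
    quantumAutFamily (fun _ G => G.IsTree) ⊆ quantumAutFamily IsTreeCograph := by
  rintro Γ ⟨V, _, _, G, hG, hΓ⟩
  exact ⟨V, _, ‹_›, G, .tree V G hG, hΓ⟩

end QuantumPermutationGroup

/-- The inclusions form a cycle: tree-cographs into rooted trees, since these are Jordan closed,
rooted trees into trees, trees into tree-cographs. All three families coincide, and closure is
inherited from rooted trees. -/
theorem mainTheorem11 :
    IsLeast {F : Set QuantumPermutationGroup | QuantumPermutationGroup.IsJordanClosed F}
      (QuantumPermutationGroup.quantumAutFamily IsTreeCograph) ∧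
    QuantumPermutationGroup.quantumAutFamily IsTreeCograph =
      QuantumPermutationGroup.quantumAutFamily (fun _ G => G.IsTree) := by
  have h1 := QuantumPermutationGroup.quantumAutFamily_isTreeCograph_subset
    QuantumPermutationGroup.isJordanClosed_rootedTreeFamily
  have h2 := QuantumPermutationGroup.rootedTreeFamily_subset
  have h3 := QuantumPermutationGroup.isTree_family_subset
  have h4 : QuantumPermutationGroup.quantumAutFamily IsTreeCograph =
      QuantumPermutationGroup.rootedTreeFamily := h1.antisymm (h2.trans h3)
  refine ⟨⟨?_, fun _ hF =>
    QuantumPermutationGroup.quantumAutFamily_isTreeCograph_subset hF⟩, (h1.trans h2).antisymm h3⟩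
  rw [h4]
  exact QuantumPermutationGroup.isJordanClosed_rootedTreeFamily
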